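/- **Conventions.** A prespectrum $\mathbf G$ consists of based Hausdorff spaces $G_0,G_1,\dots$ and based maps $\Sigma G_n\to G_{n+1}$ whose adjoints $G_n\to\Omega G_{n+1}$ are embeddings. For a based space $Y$ put $\overline G^\%(Y)=\operatorname{colim}_n\Omega^n(Y\wedge G_n)$, and $G^\%(X)=\overline G^\%(X_+)$. For a map $p:W\to B$ of compact Hausdorff spaces, a subset $S\subseteq W$ and $A\subseteq B$, let $G^\%_B(S)=\{(b,f): b\in B,\ f\in G^\%(S\cap p^{-1}(b))\}$, topologized as a subspace of $B\times G^\%(W)$, and let $\Gamma_{B,A}G^\%_B(S)$ be the space of continuous sections of $G^\%_B(S)\to B$ that are trivial on $A$ (with the Delta-generated topology associated to the compact-open topology); $\Gamma_B=\Gamma_{B,\emptyset}$. Let $B$ and $L$ be compact smooth $q$-manifolds, possibly with boundary and corners, with $\partial B=\partial_0B\cup\partial_1B$ and $\partial L=\partial_0L\cup\partial_1L$, all four pieces closed. Let $p:W\to B$ and $\pi:E\to L$ be continuous maps with $W,E$ compact Hausdorff (for instance compact smooth manifold bundles). Let $(\tilde\lambda,\lambda)$ be a stratified embedding: $\lambda:L\to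 B$ is a smooth codimension $0$ immersion with $\lambda(L)\cap\partial_0B=\emptyset$ and $\lambda^{-1}(\partial_1B)=\partial_1L$, and $\tilde\lambda:E\to W$ is an embedding with $p\tilde\lambda=\lambda\pi$. (Self-transversality of $\lambda$ and transversality to $\partial B$ may be assumed but are not needed.) Put $E^\delta=\tilde\lambda(E\smallsetminus\pi^{-1}(\partial_0L))\subseteq W$. *The maps $\rho$ and $\iota$.* For $x\in L$ let $\mathrm{pr}_x:(E^\delta_{\lambda(x)})_+\to(E_x)_+$ be inverse to $\tilde\lambda$ on $\tilde\lambda(E_x)\cap E^\delta$ and send all other points to the base point. Let $\rho(s)(x)=(\mathrm{pr}_x)_*s(\lambda(x))$, and let $\iota:\Gamma_BG^\%_B(E^\delta)\to\Gamma_{B,\partial_0B}G^\%_B(W)$ be induced by the inclusion $E^\delta\subseteq W$. *The duality maps.* Let $i:B\to\mathbb R^{q+n}$ be a smooth embedding with normal bundle $\nu$ (the orthogonal complements of the tangent spaces), and let $\delta>0$ be such that $t_B(b,v)=i(b)+v$ is a tubular embedding of the disk bundle $D(\nu)$ of radius $\delta$ in $(0,1)^{q+n}$, where *tubular embedding* means: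 continuous, injective, and open on the interior. Let $\xi=p^*\nu$ and $\xi_E=\tilde\lambda^*\xi=\pi^*\lambda^*\nu$, and write $T(\xi)/T(\xi_{\partial_1W})$ for the $n$-fold formal desuspension of $D(\xi)/(S(\xi)\cup D(\xi|_{p^{-1}(\partial_1B)}))$, so that $\Omega^q\overline G^\%(T(\xi)/T(\xi_{\partial_1W}))=\Omega^{q+n}\overline G^\%\big(D(\xi)/(S(\xi)\cup D(\xi|_{p^{-1}(\partial_1B)}))\big)$; similarly for $E$. The map $$\varphi_B:\Gamma_{B,\partial_0B}G^\%_B(W)\to\Omega^q\overline G^\%(T(\xi)/T(\xi_{\partial_1W}))$$ sends $s$ to the loop whose value at $t_B(b,v)$ is the image of $s(b)\in G^\%(W_b)$ under $w\mapsto(w,v)$, and whose value off $t_B(D(\nu))$ is the base point. Let $t_L:D(\lambda^*\nu)\to(0,1)^{q+n}$ be any tubular embedding which is regularly homotopic (homotopic in the open cube through codimension $0$ immersions, i.e. so that the track of the homotopy is locally injective and is open on the interior) to the immersion $(x,v)\mapsto t_B(\lambda(x),v)$; this expresses that $\lambda^*\nu$ is the normal bundle of $L$. The map $\varphi_L:\Gamma_{L,\partial_0L}G^\%_L(E)\to\Omega^q\overline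 G^\%(T(\xi_E)/T(\xi_{\partial_1E}))$ is defined in the same way with $t_L$. **Theorem.** The maps $\rho:\Gamma_BG^\%_B(E^\delta)\to\Gamma_{L,\partial_0L}G^\%_L(E)$ and $\iota$ are well defined and continuous, and there is a weak homotopy equivalence $$\mu:\Gamma_{L,\partial_0L}G^\%_L(E)\to\Gamma_BG^\%_B(E^\delta)$$ with $\rho\circ\mu\simeq\mathrm{id}$ (that is, under $G^\%(E^\delta_b)\simeq\prod_{x\in\lambda^{-1}(b)\smallsetminus\partial_0L}G^\%(E_x)$ the section $\mu(\gamma)$ is $b\mapsto(\gamma(x))_x$), such that for all choices of $n,i,\delta,t_L$ as above the maps $\varphi_L,\varphi_B$ are well defined and continuous and the diagram $$\begin{array}{ccccc}\Gamma_{L,\partial_0L}G^\%_L(E)&\xrightarrow{\ \mu\ }&\Gamma_BG^\%_B(E^\delta)&\xrightarrow{\ \iota\ }&\Gamma_{B,\partial_0B}G^\%_B(W)\\ {\scriptstyle\varphi_L}\downarrow&&&&\downarrow{\scriptstyle\varphi_B}\\ \Omega^q\overline G^\%(T(\xi_E)/T(\xi_{\partial_1E}))&&\xrightarrow{\ \tilde\lambda_*\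 }&&\Omega^q\overline G^\%(T(\xi)/T(\xi_{\partial_1W}))\end{array}$$ commutes up to homotopy: $\varphi_B\circ\iota\circ\mu\simeq\tilde\lambda_*\circ\varphi_L$, where $\tilde\lambda_*$ is induced by $(e,v)\mapsto(\tilde\lambda(e),v)$. -/

import Mathlib

open scoped Topology unitInterval Manifold ContDiff Topology.Homotopy

noncomputable section

namespace StratHom

universe u

/-! ### Based spaces, quotients, smash products -/

/-- A chosen base point of a space. -/
class HasBase (X : Type*) where
  base : X

/-- The base point of `X`. -/
def pt (X : Type*) [HasBase X] : X := HasBase.base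

/-- Based continuous maps. -/
structure BasedMap (X Y : Type*) [TopologicalSpace X] [TopologicalSpace Y]
    [HasBase X] [HasBase Y] where
  toMap : C(X, Y)
  map_pt : toMap (pt X) = pt Y

/-- The equivalence relation that identifies all points of `S` with each other. -/
def collapseSetoid {X : Type*} (S : Set X) : Setoid X where
  r a b := a = b ∨ (a ∈ S ∧ b ∈ S)
  iseqv :=
    { refl := fun _ => Or.inl rfl
      symm := by
        rintro a b (h | h)
        · exact Or.inl h.symm
        · exact Or.inr ⟨h.2, h.1⟩
      trans := by
        rintro a b c (rfl | h) (rfl | h')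
        · exact Or.inl rfl
        · exact Or.inr h'
        · exact Or.inr h
        · exact Or.inr ⟨h.1, h'.2⟩ }

/-- `X₊`: the space `X` with a disjoint base point added. -/
abbrev Plus (X : Type*) : Type _ := X ⊕ Unit

instance instHasBasePlus (X : Type*) : HasBase (Plus X) := ⟨Sum.inr ()⟩

/-- The based space `X / A`, i.e. `X₊` with `A` collapsed to the base point (so `X / ∅ = X₊`). -/
def Quo {X : Type*} (A : Set X) : Type _ :=
  Quotient (collapseSetoid {a : Plus X | a = pt (Plus X) ∨ ∃ x ∈ A, a = Sum.inl x})

instance instTopQuo {X : Type*} [TopologicalSpace X] (A : Set X) : TopologicalSpace (Quo A) :=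
  inferInstanceAs (TopologicalSpace (Quotient _))

instance instHasBaseQuo {X : Type*} (A : Set X) : HasBase (Quo A) :=
  ⟨Quotient.mk _ (pt (Plus X))⟩

/-- The quotient map `X → X / A`. -/
def Quo.mk {X : Type*} (A : Set X) (x : X) : Quo A := Quotient.mk _ (Sum.inl x)

theorem Quo.continuous_mk {X : Type*} [TopologicalSpace X] (A : Set X) :
    Continuous (Quo.mk A) :=
  continuous_quotient_mk'.comp continuous_inl

/-- The based map `X₊ → Y / A` given by a map `X → Y`. -/
def Quo.ofMap {X Y : Type*} [TopologicalSpace X] [TopologicalSpace Y] (A : Set Y)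
    (f : C(X, Y)) : BasedMap (Plus X) (Quo A) where
  toMap := ⟨Sum.elim (fun x => Quo.mk A (f x)) (fun _ => pt (Quo A)),
    ((Quo.continuous_mk A).comp f.continuous).sumElim continuous_const⟩
  map_pt := rfl

/-- The based map `X / A → Y / A'` induced by a map of pairs `(X, A) → (Y, A')`. -/
def Quo.map {X Y : Type*} [TopologicalSpace X] [TopologicalSpace Y] {A : Set X} {A' : Set Y}
    (f : C(X, Y)) (hf : ∀ x ∈ A, f x ∈ A') : BasedMap (Quo A) (Quo A') where
  toMap := ⟨Quotient.lift (Quo.ofMap A' f).toMap (by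
      have key : ∀ a : Plus X, (a = pt (Plus X) ∨ ∃ x ∈ A, a = Sum.inl x) →
          (Quo.ofMap A' f).toMap a = pt (Quo A') := by
        rintro a (rfl | ⟨x, hx, rfl⟩)
        · rfl
        · exact Quotient.sound (Or.inr ⟨Or.inr ⟨f x, hf x hx, rfl⟩, Or.inl rfl⟩)
      rintro a b (rfl | ⟨ha, hb⟩)
      · rfl
      · rw [key a ha, key b hb]),
    (Quo.ofMap A' f).toMap.continuous.quotient_lift _⟩
  map_pt := rfl

/-- The based map `X₊ → Y₊` given by a map `X → Y`. -/
def plusMap {X Y : Type*} [TopologicalSpace X] [TopologicalSpace Y] (f : C(X, Y)) :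
    BasedMap (Plus X) (Plus Y) where
  toMap := ⟨Sum.map f id, f.continuous.sumMap continuous_id⟩
  map_pt := rfl

/-- The smash product `Y ∧ Z = (Y × Z) / (Y × {*} ∪ {*} × Z)`. -/
def Smash (Y Z : Type*) [HasBase Y] [HasBase Z] : Type _ :=
  Quotient (collapseSetoid {a : Y × Z | a.1 = pt Y ∨ a.2 = pt Z})

instance instHasBaseSmash {Y Z : Type*} [HasBase Y] [HasBase Z] : HasBase (Smash Y Z) :=
  ⟨Quotient.mk _ (pt Y, pt Z)⟩

/-- The class of a pair in the smash product. -/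
def Smash.mk {Y Z : Type*} [HasBase Y] [HasBase Z] (a : Y × Z) : Smash Y Z := Quotient.mk _ a

theorem Smash.mk_eq_pt {Y Z : Type*} [HasBase Y] [HasBase Z] {a : Y × Z}
    (h : a.1 = pt Y ∨ a.2 = pt Z) : Smash.mk a = pt (Smash Y Z) :=
  Quotient.sound (Or.inr ⟨h, Or.inl rfl⟩)

section Smash

variable {Y Y' Z : Type*} [TopologicalSpace Y] [TopologicalSpace Y'] [TopologicalSpace Z]
  [HasBase Y] [HasBase Y'] [HasBase Z]

instance instTopSmash : TopologicalSpace (Smash Y Z) :=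
  inferInstanceAs (TopologicalSpace (Quotient _))

theorem Smash.isQuotientMap_mk : Topology.IsQuotientMap (Smash.mk : Y × Z → Smash Y Z) :=
  isQuotientMap_quot_mk

/-- The based map `c ∧ id : Y ∧ Z → Y' ∧ Z`. -/
def Smash.map (Z : Type*) [TopologicalSpace Z] [HasBase Z] (c : BasedMap Y Y') :
    BasedMap (Smash Y Z) (Smash Y' Z) where
  toMap := ⟨Quotient.lift (fun a : Y × Z => (Smash.mk (c.toMap a.1, a.2) : Smash Y' Z)) (by
      have key : ∀ a : Y × Z, (a.1 = pt Y ∨ a.2 = pt Z) →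
          (Smash.mk (c.toMap a.1, a.2) : Smash Y' Z) = pt _ := by
        rintro ⟨y, z⟩ (h | h)
        · exact Smash.mk_eq_pt (Or.inl (by
            have h' : y = pt Y := h
            simp only [h', c.map_pt]))
        · exact Smash.mk_eq_pt (Or.inr h)
      rintro a b (rfl | ⟨ha, hb⟩)
      · rfl
      · exact (key a ha).trans (key b hb).symm),
    (Smash.isQuotientMap_mk.continuous.comp
      ((c.toMap.continuous.comp continuous_fst).prodMk continuous_snd)).quotient_lift _⟩
  map_pt := Smash.mk_eq_pt (Or.inl c.map_pt)

end Smash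

/-! ### Prespectra and generalized homology -/

/-- A prespectrum: based Hausdorff spaces `G₀, G₁, …` with based maps `Σ Gₙ → Gₙ₊₁` whose adjoints
`Gₙ → Ω Gₙ₊₁` are embeddings. -/
structure Prespectrum where
  space : ℕ → Type u
  [top : ∀ n, TopologicalSpace (space n)]
  [t2 : ∀ n, T2Space (space n)]
  [base : ∀ n, HasBase (space n)]
  /-- the structure map, on `Gₙ × [0,1]` -/
  susp : ∀ n, C(space n × I, space (n + 1))
  susp_pt : ∀ n t, susp n (pt (space n), t) = pt (space (n + 1))
  susp_zero : ∀ n x, susp n (x, 0) = pt (space (n + 1))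
  susp_one : ∀ n x, susp n (x, 1) = pt (space (n + 1))
  isEmbedding_adjoint : ∀ n, Topology.IsEmbedding (fun x => (susp n).curry x)

attribute [instance] Prespectrum.top Prespectrum.t2 Prespectrum.base

section Homology

variable (G : Prespectrum.{u}) {Y Y' : Type*} [TopologicalSpace Y] [TopologicalSpace Y']
  [HasBase Y] [HasBase Y']

/-- The structure map of the prespectrum `Y ∧ G`, on `(Y ∧ Gₙ) × [0,1]`:
`([y, g], t) ↦ [y, susp (g, t)]`. -/
def smashSusp (Y : Type*) [TopologicalSpace Y] [HasBase Y] (n : ℕ) :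
    C(Smash Y (G.space n) × I, Smash Y (G.space (n + 1))) where
  toFun a := Quotient.lift
    (fun b : Y × G.space n =>
      (Smash.mk (b.1, G.susp n (b.2, a.2)) : Smash Y (G.space (n + 1)))) (by
      have key : ∀ b : Y × G.space n, (b.1 = pt Y ∨ b.2 = pt (G.space n)) →
          (Smash.mk (b.1, G.susp n (b.2, a.2)) : Smash Y (G.space (n + 1))) = pt _ := by
        rintro ⟨y, g⟩ (h | h)
        · exact Smash.mk_eq_pt (Or.inl h)
        · refine Smash.mk_eq_pt (Or.inr ?_)
          have h' : g = pt (G.space n) := h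
          simp only [h', G.susp_pt]
      rintro b c (rfl | ⟨hb, hc⟩)
      · rfl
      · exact (key b hb).trans (key c hc).symm) a.1
  continuous_toFun := by
    refine Smash.isQuotientMap_mk.continuous_lift_prod_left ?_
    exact Smash.isQuotientMap_mk.continuous.comp
      ((continuous_fst.comp continuous_fst).prodMk ((G.susp n).continuous.comp
        ((continuous_snd.comp continuous_fst).prodMk continuous_snd)))

theorem smashSusp_mk (n : ℕ) (y : Y) (g : G.space n) (t : I) :
    smashSusp G Y n (Smash.mk (y, g), t) = Smash.mk (y, G.susp n (g, t)) := rfl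

theorem smashSusp_pt (n : ℕ) (t : I) :
    smashSusp G Y n (pt _, t) = pt (Smash Y (G.space (n + 1))) :=
  Smash.mk_eq_pt (Or.inl rfl)

theorem smashSusp_zero (n : ℕ) (a : Smash Y (G.space n)) :
    smashSusp G Y n (a, 0) = pt (Smash Y (G.space (n + 1))) := by
  obtain ⟨⟨y, g⟩, rfl⟩ := Smash.isQuotientMap_mk.surjective a
  rw [smashSusp_mk, G.susp_zero]
  exact Smash.mk_eq_pt (Or.inr rfl)

theorem smashSusp_one (n : ℕ) (a : Smash Y (G.space n)) :
    smashSusp G Y n (a, 1) = pt (Smash Y (G.space (n + 1))) := by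
  obtain ⟨⟨y, g⟩, rfl⟩ := Smash.isQuotientMap_mk.surjective a
  rw [smashSusp_mk, G.susp_one]
  exact Smash.mk_eq_pt (Or.inr rfl)

/-- The stage `Ωⁿ (Y ∧ Gₙ)`. -/
abbrev Stage (Y : Type*) [TopologicalSpace Y] [HasBase Y] (n : ℕ) : Type _ :=
  Ω^ (Fin n) (Smash Y (G.space n)) (pt _)

/-- The stabilization `Ωⁿ (Y ∧ Gₙ) → Ωⁿ⁺¹ (Y ∧ Gₙ₊₁)`; the new coordinate is the last one. -/
def stab {n : ℕ} (f : Stage G Y n) : Stage G Y (n + 1) :=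
  ⟨⟨fun t => smashSusp G Y n (f (fun k => t k.castSucc), t (Fin.last n)),
    (smashSusp G Y n).continuous.comp
      (Continuous.prodMk
        (f.1.continuous.comp (continuous_pi fun k : Fin n => continuous_apply k.castSucc))
        (continuous_apply (Fin.last n)))⟩, by
    rintro t ⟨k, hk⟩
    change smashSusp G Y n (f (fun k => t k.castSucc), t (Fin.last n)) = _
    induction k using Fin.lastCases with
    | last =>
      rcases hk with hk | hk <;> rw [hk]
      · exact smashSusp_zero G n _
      · exact smashSusp_one G n _
    | cast k =>
      rw [GenLoop.boundary f _ ⟨k, hk⟩]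
      exact smashSusp_pt G n _⟩

/-- Reduced generalized homology `Ω^∞ (Y ∧ G) = colim Ωⁿ (Y ∧ Gₙ)` of a based space `Y`, as a
space with the colimit topology. -/
def RedHom (Y : Type*) [TopologicalSpace Y] [HasBase Y] : Type _ :=
  Quot (fun a b : (Σ n, Stage G Y n) => b = ⟨a.1 + 1, stab G a.2⟩)

instance instTopRedHom : TopologicalSpace (RedHom G Y) :=
  inferInstanceAs (TopologicalSpace (Quot _))

instance instHasBaseRedHom : HasBase (RedHom G Y) :=
  ⟨Quot.mk _ ⟨0, GenLoop.const⟩⟩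

/-- The map of stages induced by a based map. -/
def stageMap (c : BasedMap Y Y') {n : ℕ} (f : Stage G Y n) : Stage G Y' n :=
  ⟨(Smash.map (G.space n) c).toMap.comp f.1, fun t ht => by
    change (Smash.map (G.space n) c).toMap (f t) = _
    rw [GenLoop.boundary f t ht]
    exact (Smash.map (G.space n) c).map_pt⟩

theorem stageMap_stab (c : BasedMap Y Y') {n : ℕ} (f : Stage G Y n) :
    stageMap G c (stab G f) = stab G (stageMap G c f) := by
  ext t
  change (Smash.map (G.space (n + 1)) c).toMap
      (smashSusp G Y n (f (fun k => t k.castSucc), t (Fin.last n))) =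
    smashSusp G Y' n ((Smash.map (G.space n) c).toMap (f (fun k => t k.castSucc)), t (Fin.last n))
  obtain ⟨⟨y, g⟩, h⟩ := Smash.isQuotientMap_mk.surjective (f (fun k => t k.castSucc))
  rw [← h]
  rfl

/-- The induced map on reduced generalized homology. -/
def redMap (c : BasedMap Y Y') : RedHom G Y → RedHom G Y' :=
  Quot.map (fun a => ⟨a.1, stageMap G c a.2⟩) (by
    rintro a b rfl
    simp only [stageMap_stab])

theorem continuous_redMap (c : BasedMap Y Y') : Continuous (redMap G c) := by
  have h : ∀ n, Continuous (fun f : Stage G Y n => stageMap G c f) := fun n =>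
    Continuous.subtype_mk ((ContinuousMap.continuous_postcomp
      (Smash.map (G.space n) c).toMap).comp continuous_subtype_val) _
  have h' : Continuous (fun a : (Σ n, Stage G Y n) =>
      (Quot.mk _ ⟨a.1, stageMap G c a.2⟩ : RedHom G Y')) :=
    continuous_quot_mk.comp (continuous_sigma fun n => continuous_sigmaMk.comp (h n))
  exact continuous_quot_lift _ h'

theorem stageMap_const (c : BasedMap Y Y') (n : ℕ) :
    stageMap G c (GenLoop.const : Stage G Y n) = GenLoop.const := by
  ext t
  exact (Smash.map (G.space n) c).map_pt

theorem redMap_pt (c : BasedMap Y Y') : redMap G c (pt _) = pt _ := by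
  change Quot.mk _ (⟨0, stageMap G c GenLoop.const⟩ : Σ n, Stage G Y' n) = Quot.mk _ _
  rw [stageMap_const]

/-- The map `Ω^N` of the induced map on reduced generalized homology. -/
def loopMap (N : ℕ) (c : BasedMap Y Y') :
    C(Ω^ (Fin N) (RedHom G Y) (pt _), Ω^ (Fin N) (RedHom G Y') (pt _)) where
  toFun f := ⟨(⟨redMap G c, continuous_redMap G c⟩ : C(RedHom G Y, RedHom G Y')).comp f.1,
    fun t ht => by
      change redMap G c (f t) = _
      rw [GenLoop.boundary f t ht]
      exact redMap_pt G c⟩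
  continuous_toFun := Continuous.subtype_mk
    ((ContinuousMap.continuous_postcomp _).comp continuous_subtype_val) _

end Homology

/-! ### Fiberwise homology and spaces of sections -/

section Sections

variable {B W : Type*} [TopologicalSpace B] [TopologicalSpace W]

/-- The fiber over `b` of the restriction of `p : W → B` to a subset `S` of `W`. -/
abbrev Fib (p : C(W, B)) (S : Set W) (b : B) : Type _ := {w : W // w ∈ S ∧ p w = b}

/-- The inclusion of a fiber in the total space. -/
def fibIncl (p : C(W, B)) (S : Set W) (b : B) : BasedMap (Plus (Fib p S b)) (Plus W) :=
  plusMap ⟨Subtype.val, continuous_subtype_val⟩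

/-- The inclusion of the fibers of a subset in the fibers of `p`. -/
def fibInclUniv (p : C(W, B)) (S : Set W) (b : B) :
    BasedMap (Plus (Fib p S b)) (Plus (Fib p Set.univ b)) :=
  plusMap ⟨fun w => ⟨w.1, trivial, w.2.2⟩, continuous_subtype_val.subtype_mk _⟩

/-- The fiberwise homology `G^%_B(S)` of a subset `S` of `W` over `B`: its fiber over `b` is
`G^%(S_b) = Ω^∞ ((S_b)₊ ∧ G)`. -/
structure FibHom (G : Prespectrum.{u}) (p : C(W, B)) (S : Set W) where
  proj : B
  val : RedHom G (Plus (Fib p S proj))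

/-- `G^%_B(S)` is topologized as a subspace of `B × G^%(W)`; for a fiber bundle `p` with compact
fibers and `S = W` this is the bundle with fiber `G^%(W_b)`. -/
instance instTopFibHom (G : Prespectrum.{u}) (p : C(W, B)) (S : Set W) :
    TopologicalSpace (FibHom G p S) :=
  TopologicalSpace.induced
    (fun a => ((a.proj, redMap G (fibIncl p S a.proj) a.val) : B × RedHom G (Plus W)))
    inferInstance

/-- The continuous sections over `B` of `G^%_B(S)` that are trivial on `A`. -/
structure Sec (G : Prespectrum.{u}) (p : C(W, B)) (S : Set W) (A : Set B) where
  val : ∀ b : B, RedHom G (Plus (Fib p S b))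
  continuous_val : Continuous (fun b => FibHom.mk (G := G) (p := p) (S := S) b (val b))
  eq_pt : ∀ b ∈ A, val b = pt _

/-- A section as a continuous map. -/
def Sec.toMap {G : Prespectrum.{u}} {p : C(W, B)} {S : Set W} {A : Set B} (s : Sec G p S A) :
    C(B, FibHom G p S) := ⟨fun b => FibHom.mk b (s.val b), s.continuous_val⟩

/-- The compact-open topology on sections, made Delta-generated (a set is open if and only if its
preimage under every compact-open continuous map from some `ℝⁿ` is open), as usual in a
convenient category of spaces. -/
instance instTopSec (G : Prespectrum.{u}) (p : C(W, B)) (S : Set W) (A : Set B) :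
    TopologicalSpace (Sec G p S A) :=
  @TopologicalSpace.generatedBy ℕ (fun n => Fin n → ℝ) (fun _ => inferInstance) (Sec G p S A)
    (TopologicalSpace.induced Sec.toMap inferInstance)

end Sections

/-- Weak homotopy equivalences, by the relative lifting criterion for the pairs `(Iⁿ, ∂Iⁿ)`. -/
def IsWeakEquiv {X Y : Type*} [TopologicalSpace X] [TopologicalSpace Y] (f : C(X, Y)) : Prop :=
  ∀ (n : ℕ) (a : C(Cube.boundary (Fin n), X)) (b : C(Fin n → I, Y)),
    (∀ y : Cube.boundary (Fin n), f (a y) = b y) →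
      ∃ a' : C(Fin n → I, X), (∀ y : Cube.boundary (Fin n), a' y = a y) ∧
        (f.comp a').HomotopicRel b (Cube.boundary (Fin n))

/-! ### Stratified embeddings -/

section Stratified

variable {q : ℕ} {HB HL : Type*} [TopologicalSpace HB] [TopologicalSpace HL]
  (IB : ModelWithCorners ℝ (EuclideanSpace ℝ (Fin q)) HB)
  (IL : ModelWithCorners ℝ (EuclideanSpace ℝ (Fin q)) HL)
  {B L W E : Type*} [TopologicalSpace B] [TopologicalSpace L] [TopologicalSpace W]
  [TopologicalSpace E] [ChartedSpace HB B] [ChartedSpace HL L]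

/-- `∂B = ∂₀B ∪ ∂₁B` with closed pieces. -/
structure IsBoundaryDecomposition (d0 d1 : Set B) : Prop where
  isClosed_left : IsClosed d0
  isClosed_right : IsClosed d1
  union_eq : d0 ∪ d1 = IB.boundary B

/-- A codimension 0 immersion `lam : L → B` covered by an embedding `lamT : E → W`, such that the
image of `lam` misses `∂₀B` and `lam⁻¹(∂₁B) = ∂₁L`. (Self-transversality of `lam` is not needed.) -/
structure IsStratifiedEmbedding (d0B d1B : Set B) (d1L : Set L)
    (p : C(W, B)) (π : C(E, L)) (lam : C(L, B)) (lamT : C(E, W)) : Prop where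
  contMDiff : ContMDiff IL IB ∞ lam
  bijective_mfderiv : ∀ x, Function.Bijective (mfderiv IL IB lam x)
  notMem : ∀ x, lam x ∉ d0B
  preimage_eq : lam ⁻¹' d1B = d1L
  isEmbedding : Topology.IsEmbedding lamT
  comm : ∀ e, p (lamT e) = lam (π e)

/-- The stratified subbundle `E^δ`: the image of the complement of `E` over `∂₀L`. -/
def stratSub (d0L : Set L) (π : C(E, L)) (lamT : C(E, W)) : Set W :=
  lamT '' {e | π e ∉ d0L}

variable {IB IL}

theorem IsStratifiedEmbedding.isolated {d0B d1B : Set B} {d1L : Set L}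
    {p : C(W, B)} {π : C(E, L)} {lam : C(L, B)} {lamT : C(E, W)}
    (h : IsStratifiedEmbedding IB IL d0B d1B d1L p π lam lamT) (x : L) :
    ∃ U ∈ 𝓝 x, ∀ y ∈ U, lam y = lam x → y = x := by
  have hd : MDifferentiableAt IL IB lam x := h.contMDiff.mdifferentiable (by simp) x
  have hm := hd.hasMFDerivAt
  have hder := hm.2
  have hb := h.bijective_mfderiv x
  let f' : EuclideanSpace ℝ (Fin q) →L[ℝ] EuclideanSpace ℝ (Fin q) := mfderiv IL IB lam x
  obtain ⟨K, _, hK⟩ := f'.toLinearMap.exists_antilipschitzWith (LinearMap.ker_eq_bot.2 hb.1)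
  have hev := hder.eventually_ne (c := extChartAt IB (lam x) (lam x)) ⟨K, hK⟩
  have hcont : Filter.Tendsto (extChartAt IL x) (𝓝[≠] x)
      (𝓝[Set.range IL \ {extChartAt IL x x}] (extChartAt IL x x)) := by
    refine tendsto_nhdsWithin_iff.2 ⟨(continuousAt_extChartAt x).tendsto.mono_left
      nhdsWithin_le_nhds, ?_⟩
    have hs : ∀ᶠ y in 𝓝[≠] x, y ∈ (extChartAt IL x).source :=
      nhdsWithin_le_nhds (extChartAt_source_mem_nhds x)
    filter_upwards [hs, self_mem_nhdsWithin] with y hy hyx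
    refine ⟨extChartAt_target_subset_range x ((extChartAt IL x).map_source hy), fun hxy => hyx ?_⟩
    exact (extChartAt IL x).injOn hy (mem_extChartAt_source x) hxy
  have h2 := hcont.eventually hev
  have hs : ∀ᶠ y in 𝓝[≠] x, y ∈ (extChartAt IL x).source :=
    nhdsWithin_le_nhds (extChartAt_source_mem_nhds x)
  have h3 : ∀ᶠ y in 𝓝[≠] x, lam y ≠ lam x := by
    filter_upwards [h2, hs] with y hy hys hxy
    apply hy
    simp only [writtenInExtChartAt, Function.comp_apply, (extChartAt IL x).left_inv hys, hxy]
  rw [eventually_nhdsWithin_iff] at h3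
  refine ⟨_, h3, fun y hy hxy => ?_⟩
  by_contra hne
  exact hy hne hxy

open Classical in
/-- The projection `(E^δ_{lam x})₊ → (E_x)₊`: the identity on the component `lamT (E_x)`; the other
components are sent to the base point. -/
def IsStratifiedEmbedding.proj {d0B d1B : Set B} {d1L : Set L}
    {p : C(W, B)} {π : C(E, L)} {lam : C(L, B)} {lamT : C(E, W)}
    [T2Space L]
    (h : IsStratifiedEmbedding IB IL d0B d1B d1L p π lam lamT) (d0L : Set L) (x : L) :
    BasedMap (Plus (Fib p (stratSub d0L π lamT) (lam x))) (Plus (Fib π Set.univ x)) where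
  toMap := ⟨Sum.elim
      (fun w => if hw : ∃ e, π e = x ∧ lamT e = w.1 then
          Sum.inl ⟨hw.choose, trivial, hw.choose_spec.1⟩ else Sum.inr ())
      (fun _ => Sum.inr ()), by
    refine Continuous.sumElim ?_ continuous_const
    have hr : ∀ w : Fib p (stratSub d0L π lamT) (lam x), w.1 ∈ Set.range lamT := by
      rintro ⟨w, ⟨e, _, rfl⟩, _⟩
      exact ⟨e, rfl⟩
    let g : Fib p (stratSub d0L π lamT) (lam x) → E :=
      fun w => h.isEmbedding.toHomeomorph.symm ⟨w.1, hr w⟩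
    have hg : Continuous g := h.isEmbedding.toHomeomorph.symm.continuous.comp
      (continuous_subtype_val.subtype_mk _)
    have hgw : ∀ w, lamT (g w) = w.1 := fun w => congrArg Subtype.val
      (h.isEmbedding.toHomeomorph.apply_symm_apply ⟨w.1, hr w⟩)
    have hex : ∀ w : Fib p (stratSub d0L π lamT) (lam x),
        (∃ e, π e = x ∧ lamT e = w.1) ↔ π (g w) = x := by
      intro w
      constructor
      · rintro ⟨e, he, hew⟩
        rw [← he]
        exact congrArg π (h.isEmbedding.injective ((hgw w).trans hew.symm))
      · exact fun hw => ⟨g w, hw, hgw w⟩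
    obtain ⟨U, hU, hUx⟩ := h.isolated x
    have hclosed : IsClosed {w | π (g w) = x} :=
      isClosed_eq (π.continuous.comp hg) continuous_const
    have hopen : IsOpen {w | π (g w) = x} := by
      have : {w | π (g w) = x} = (fun w => π (g w)) ⁻¹' interior U := by
        ext w
        refine ⟨fun hw => ?_, fun hw => hUx _ (interior_subset hw) ?_⟩
        · have hw' : π (g w) = x := hw
          change π (g w) ∈ interior U
          rw [hw']
          exact mem_interior_iff_mem_nhds.2 hU
        · rw [← h.comm, hgw]
          exact w.2.2
      rw [this]
      exact isOpen_interior.preimage (π.continuous.comp hg)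
    rw [continuous_iff_continuousAt]
    intro w
    by_cases hw : π (g w) = x
    · refine ContinuousOn.continuousAt (s := {w | π (g w) = x}) ?_ (hopen.mem_nhds hw)
      rw [continuousOn_iff_continuous_domRestrict]
      have hc : Continuous (fun v : {w | π (g w) = x} =>
          (Sum.inl ⟨g v.1, trivial, v.2⟩ : Plus (Fib π Set.univ x))) :=
        continuous_inl.comp ((hg.comp continuous_subtype_val).subtype_mk _)
      refine hc.congr fun v => ?_
      have hv := (hex v.1).2 v.2
      rw [Set.domRestrict_apply, dif_pos hv]
      congr 1
      apply Subtype.ext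
      exact h.isEmbedding.injective ((hgw v.1).trans hv.choose_spec.2.symm)
    · refine ContinuousAt.congr (f := fun _ => (Sum.inr () : Plus (Fib π Set.univ x)))
        continuousAt_const ?_
      filter_upwards [hclosed.isOpen_compl.mem_nhds hw] with v hv
      rw [dif_neg (fun hv' => hv ((hex v).1 hv'))]⟩
  map_pt := rfl

end Stratified

/-! ### Disk bundles, Thom spaces and the duality maps -/

section Thom

variable {B W V : Type*} [TopologicalSpace B] [TopologicalSpace W] [NormedAddCommGroup V]
  [NormedSpace ℝ V]

/-- The closed disk bundle of radius `δ` of the pull-back to `W`, along `p : W → B`, of a bundle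
`ν` of subspaces of `V` over `B`. -/
abbrev Disk (p : C(W, B)) (ν : B → Submodule ℝ V) (δ : ℝ) : Type _ :=
  {x : W × V // x.2 ∈ ν (p x.1) ∧ ‖x.2‖ ≤ δ}

/-- The sphere bundle together with the part of the disk bundle over `A`. -/
def diskBdry (p : C(W, B)) (ν : B → Submodule ℝ V) (δ : ℝ) (A : Set B) : Set (Disk p ν δ) :=
  {x | ‖x.1.2‖ = δ ∨ p x.1.1 ∈ A}

/-- The quotient `(D(ξ)/S(ξ)) / (D(ξ_A)/S(ξ_A)) = D(ξ) / (S(ξ) ∪ D(ξ_A))` of Thom spaces, where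
`ξ` is the pull-back of `ν` to `W` and `ξ_A` is its restriction to the part of `W` over `A`. -/
abbrev ThomQuo (p : C(W, B)) (ν : B → Submodule ℝ V) (δ : ℝ) (A : Set B) : Type _ :=
  Quo (diskBdry p ν δ A)

theorem fibToDisk_mem (p : C(W, B)) (ν : B → Submodule ℝ V) (δ : ℝ)
    (d : Disk (ContinuousMap.id B) ν δ) (w : Fib p Set.univ d.1.1) :
    d.1.2 ∈ ν (p w.1) ∧ ‖d.1.2‖ ≤ δ := by
  have h1 : d.1.2 ∈ ν d.1.1 ∧ ‖d.1.2‖ ≤ δ := d.2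
  have h2 : p w.1 = d.1.1 := w.2.2
  rwa [h2]

/-- For `d = (b, v)` in the disk bundle of `ν`, the map `W_b → D(ξ)` that sends `w` to `(w, v)`. -/
def fibToDisk (p : C(W, B)) (ν : B → Submodule ℝ V) (δ : ℝ)
    (d : Disk (ContinuousMap.id B) ν δ) : C(Fib p Set.univ d.1.1, Disk p ν δ) where
  toFun w := ⟨(w.1, d.1.2), fibToDisk_mem p ν δ d w⟩
  continuous_toFun := Continuous.subtype_mk (continuous_subtype_val.prodMk continuous_const) _

/-- For `d = (b, v)` in the disk bundle of `ν`, the map `W_b → D(ξ) → D(ξ) / (S(ξ) ∪ D(ξ_A))`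
that sends `w` to `(w, v)`. -/
def fibToThom (p : C(W, B)) (ν : B → Submodule ℝ V) (δ : ℝ) (A : Set B)
    (d : Disk (ContinuousMap.id B) ν δ) :
    BasedMap (Plus (Fib p Set.univ d.1.1)) (ThomQuo p ν δ A) :=
  Quo.ofMap _ (fibToDisk p ν δ d)

/-- A tubular embedding of the disk bundle `D(ν)` in the open unit cube of `ℝᴺ`: continuous,
injective, and open on the interior of `D(ν)` (where `bd` is the boundary of the base). -/
structure IsTubular {N : ℕ} (ν : B → Submodule ℝ V) (δ : ℝ) (bd : Set B)
    (t : Disk (ContinuousMap.id B) ν δ → EuclideanSpace ℝ (Fin N)) : Prop where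
  continuous : Continuous t
  injective : Function.Injective t
  mem_cube : ∀ d k, 0 < t d k ∧ t d k < 1
  isOpen_image : ∀ U : Set (Disk (ContinuousMap.id B) ν δ), IsOpen U →
    (∀ d ∈ U, ‖d.1.2‖ < δ ∧ d.1.1 ∉ bd) → IsOpen (t '' U)

/-- Two maps from the disk bundle `D(ν)` to the open unit cube of `ℝᴺ`, `N = dim D(ν)`, are
regularly homotopic if they are joined by a homotopy through codimension 0 immersions: the track
`(τ, d) ↦ (τ, H (τ, d))` is locally injective, and it is open on the interior of `D(ν)`. -/
def RegularlyHomotopic {N : ℕ} (ν : B → Submodule ℝ V) (δ : ℝ) (bd : Set B)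
    (t t' : Disk (ContinuousMap.id B) ν δ → EuclideanSpace ℝ (Fin N)) : Prop :=
  ∃ H : C(I × Disk (ContinuousMap.id B) ν δ, EuclideanSpace ℝ (Fin N)),
    (∀ d, H (0, d) = t d) ∧ (∀ d, H (1, d) = t' d) ∧
    (∀ a k, 0 < H a k ∧ H a k < 1) ∧
    (∀ a, ∃ U ∈ 𝓝 a, Set.InjOn (fun x => (x.1, H x)) U) ∧
    (∀ U : Set (I × Disk (ContinuousMap.id B) ν δ), IsOpen U →
      (∀ a ∈ U, ‖a.2.1.2‖ < δ ∧ a.2.1.1 ∉ bd) →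
      IsOpen ((fun x => ((x.1, H x) : I × EuclideanSpace ℝ (Fin N))) '' U))

/-- `φ` is the duality map `Γ_{B,∂₀B} G^%_B(W) → Ω^N G^%(D(ξ) / (S(ξ) ∪ D(ξ_{∂₁B})))` of the
tubular embedding `t`: `φ s` sends `t (b, v)` to the image of `s b ∈ G^%(W_b)` under
`w ↦ (w, v)`, and it sends the complement of `t (D(ν))` to the base point. Since
`Ω^∞ (T ∧ G) = Ω^n Ω^∞ ((D(ξ)/S(ξ)) ∧ G)` for the desuspended Thom space
`T = Σ^{-n} (D(ξ)/S(ξ))`, with `n` the rank of `ξ`, the target is `Ω^{N-n}` of the homology of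
the quotient of (desuspended) Thom spaces. -/
structure IsDualityMap {N : ℕ} (G : Prespectrum.{u}) (p : C(W, B)) (d0 d1 : Set B)
    (ν : B → Submodule ℝ V) (δ : ℝ)
    (t : Disk (ContinuousMap.id B) ν δ → EuclideanSpace ℝ (Fin N))
    (φ : C(Sec G p Set.univ d0, Ω^ (Fin N) (RedHom G (ThomQuo p ν δ d1)) (pt _))) : Prop where
  apply_tube : ∀ (s : Sec G p Set.univ d0) (d : Disk (ContinuousMap.id B) ν δ) (z : Fin N → I),
    (∀ k, (z k : ℝ) = t d k) → φ s z = redMap G (fibToThom p ν δ d1 d) (s.val d.1.1)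
  apply_compl : ∀ (s : Sec G p Set.univ d0) (z : Fin N → I),
    (∀ d, ∃ k, (z k : ℝ) ≠ t d k) → φ s z = pt _

variable {L E : Type*} [TopologicalSpace L] [TopologicalSpace E]

/-- The map of disk bundles `D(lam^* ν) → D(ν)` that covers `lam : L → B`. -/
def diskCover (lam : C(L, B)) (ν : B → Submodule ℝ V) (δ : ℝ)
    (d : Disk (ContinuousMap.id L) (fun x => ν (lam x)) δ) : Disk (ContinuousMap.id B) ν δ :=
  ⟨(lam d.1.1, d.1.2), d.2⟩

theorem diskMap_mem (p : C(W, B)) (π : C(E, L)) (lam : C(L, B)) (lamT : C(E, W))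
    (comm : ∀ e, p (lamT e) = lam (π e)) (ν : B → Submodule ℝ V) (δ : ℝ)
    (x : Disk π (fun x => ν (lam x)) δ) :
    x.1.2 ∈ ν (p (lamT x.1.1)) ∧ ‖x.1.2‖ ≤ δ := by
  have h1 : x.1.2 ∈ ν (lam (π x.1.1)) ∧ ‖x.1.2‖ ≤ δ := x.2
  rwa [comm]

/-- The map of disk bundles `D(ξ_E) → D(ξ)`, `(e, v) ↦ (lamT e, v)`, where
`ξ_E = lamT^* ξ` is also the pull-back of `lam^* ν` to `E`. -/
def diskMap (p : C(W, B)) (π : C(E, L)) (lam : C(L, B)) (lamT : C(E, W))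
    (comm : ∀ e, p (lamT e) = lam (π e)) (ν : B → Submodule ℝ V) (δ : ℝ) :
    C(Disk π (fun x => ν (lam x)) δ, Disk p ν δ) where
  toFun x := ⟨(lamT x.1.1, x.1.2), diskMap_mem p π lam lamT comm ν δ x⟩
  continuous_toFun := Continuous.subtype_mk
    ((lamT.continuous.comp (continuous_fst.comp continuous_subtype_val)).prodMk
      (continuous_snd.comp continuous_subtype_val)) _

/-- The map of quotients of Thom spaces induced by `lamT : E → W`. -/
def thomMap (p : C(W, B)) (π : C(E, L)) (lam : C(L, B)) (lamT : C(E, W))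
    (comm : ∀ e, p (lamT e) = lam (π e)) (ν : B → Submodule ℝ V) (δ : ℝ)
    (d1B : Set B) (d1L : Set L) (hd : ∀ x ∈ d1L, lam x ∈ d1B) :
    BasedMap (ThomQuo π (fun x => ν (lam x)) δ d1L) (ThomQuo p ν δ d1B) :=
  Quo.map (diskMap p π lam lamT comm ν δ) (by
    rintro x (hx | hx)
    · exact Or.inl hx
    · refine Or.inr ?_
      change p (lamT x.1.1) ∈ d1B
      rw [comm]
      exact hd _ hx)

end Thom

section Normal

variable {q : ℕ} {HB : Type*} [TopologicalSpace HB]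
  (IB : ModelWithCorners ℝ (EuclideanSpace ℝ (Fin q)) HB)
  {B : Type*} [TopologicalSpace B] [ChartedSpace HB B] {N : ℕ}

/-- A smooth embedding of a compact manifold in `ℝᴺ`: a smooth injective immersion. -/
structure IsSmoothEmbedding (i : B → EuclideanSpace ℝ (Fin N)) : Prop where
  contMDiff : ContMDiff IB 𝓘(ℝ, EuclideanSpace ℝ (Fin N)) ∞ i
  injective : Function.Injective i
  injective_mfderiv :
    ∀ b, Function.Injective (mfderiv IB 𝓘(ℝ, EuclideanSpace ℝ (Fin N)) i b)

/-- The differential of `i` at `b`, with values in `ℝᴺ`. -/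
def differential (i : B → EuclideanSpace ℝ (Fin N)) (b : B) :
    EuclideanSpace ℝ (Fin q) →L[ℝ] EuclideanSpace ℝ (Fin N) :=
  mfderiv IB 𝓘(ℝ, EuclideanSpace ℝ (Fin N)) i b

/-- The normal bundle of an embedding in `ℝᴺ`: the orthogonal complements of the images of the
tangent spaces. -/
def normalBundle (i : B → EuclideanSpace ℝ (Fin N)) (b : B) :
    Submodule ℝ (EuclideanSpace ℝ (Fin N)) :=
  (LinearMap.range (differential IB i b : EuclideanSpace ℝ (Fin q) →ₗ[ℝ] _))ᗮ

/-- The map `(b, v) ↦ i b + v` on the disk bundle of radius `δ` of the normal bundle. -/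
def normalTube (i : B → EuclideanSpace ℝ (Fin N)) (δ : ℝ)
    (d : Disk (ContinuousMap.id B) (normalBundle IB i) δ) : EuclideanSpace ℝ (Fin N) :=
  i d.1.1 + d.1.2

end Normal

end StratHom

end

/-!
The values of sections are infinite loops, and the theorem comes down to moving their loop
coordinates.

Write `Z_m(W) = W₊ ∧ G_m`. Since the structure maps of `W₊ ∧ G` are injective with inducing adjoints
(`smashSusp_injective`, `isInducing_stab`), a compact family of classes in `Ω^∞ (W₊ ∧ G)` lifts
uniquely to a family of loops in `Ω^m Z_m(W)` at every late stage `m` (`exists_isRep`,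
`IsRep.unique`), and a class that comes from a subset of `W` is represented by loops over this
subset (`over_of_mem_range`). The spaces of sections are Delta-generated, so that maps out of
them and homotopies between these can be tested on families of sections parametrized by cubes
(`continuous_of_cube_families`, `homotopic_of_cube_families`). Hence everything may be defined on
representing loops, as long as it is compatible with stabilization (`IsRep.eq_of_rstab`).

The double points of the locally injective map `lam` form a compact set off the diagonal, so
finitely many functions `j₀, …, j_{k-1} : L → [0,1]` separate them by a uniform distance
(`exists_separating`). Dilating the loop coordinates `i < k` by a factor `4` about `j_i(x)` squeezes
the loops at the different points `x` of a fiber of `lam` into disjoint boxes, and the value of `μ γ` at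
`b` is the loop that is `γ(x)` on the box of `x ∈ lam⁻¹(b)` and trivial elsewhere. This is continuous,
since `lam` is open away from `∂₀L`, where `γ` vanishes (`continuous_fsum`,
`IsStratifiedEmbedding.isOpen_image`). The composition `ρ ∘ μ` sends `γ` to its squeezed form
(`rho_mu`), and decreasing the dilation factor to `1` is a homotopy to the identity.

For the relative lifting criterion (`isWeakEquiv_mu`) a cube of sections `b` over `B` has to be
deformed to `μ ρ b`. The sheets of the section `b` are disjoint in `W`, and they remain so when they
are dilated with different centres in new suspension coordinates, as these do not move
the point of `W`. Once they are squeezed there, they may be squeezed in the first `k` coordinates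
too, and released in the new ones.

The duality maps are sums of the same kind along the tube of the disk bundle in the cube
(`thomSum`). In the duality square, `φ_B ∘ ι ∘ μ` is the sum along the immersed tube
`(x, v) ↦ t_B(lam x, v)`, with the loop coordinates dilated about `j(x)` (`loopMap_thomSum`). A
regular homotopy from the embedding `t_L` to this immersion has a compact set of double points,
which further dilations separate: these are switched on before the regular homotopy and switched
off at its end, after the dilations about `j(x)` are in place
(`RegularlyHomotopic.exists_separatedTubes`).
-/

noncomputable section

open Topology

namespace StratHom

universe u

/-! ### Half-smash products -/

section HalfSmash

variable {W Q Γ : Type*} [HasBase Q] [HasBase Γ]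

theorem Smash.mk_eq_mk_iff {Y Z : Type*} [HasBase Y] [HasBase Z] {a b : Y × Z} :
    Smash.mk a = Smash.mk b ↔ a = b ∨ ((a.1 = pt Y ∨ a.2 = pt Z) ∧ (b.1 = pt Y ∨ b.2 = pt Z)) :=
  Quotient.eq (r := collapseSetoid _)

theorem Smash.mk_eq_pt_iff {Y Z : Type*} [HasBase Y] [HasBase Z] {a : Y × Z} :
    Smash.mk a = pt (Smash Y Z) ↔ a.1 = pt Y ∨ a.2 = pt Z := by
  refine ⟨fun h => ?_, Smash.mk_eq_pt⟩
  rcases Smash.mk_eq_mk_iff.1 (show Smash.mk a = Smash.mk (pt Y, pt Z) from h) with rfl | h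
  · exact Or.inl rfl
  · exact h.1

/-- The point `[w, g]` of the half-smash product `W₊ ∧ Γ`. -/
def el (w : W) (g : Γ) : Smash (Plus W) Γ := Smash.mk (Sum.inl w, g)

theorem el_eq_pt {w : W} {g : Γ} : el w g = pt _ ↔ g = pt Γ := by
  refine Smash.mk_eq_pt_iff.trans ⟨fun h => h.resolve_left ?_, Or.inr⟩
  exact Sum.inl_ne_inr

theorem el_inj {w w' : W} {g g' : Γ} (hg : g ≠ pt Γ) (h : el w g = el w' g') :
    w = w' ∧ g = g' := by
  rcases Smash.mk_eq_mk_iff.1 h with h | h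
  · simpa using h
  · rcases h.1 with h | h
    · exact absurd h Sum.inl_ne_inr
    · exact absurd h hg

theorem el_cases (ζ : Smash (Plus W) Γ) :
    ζ = pt _ ∨ ∃ w g, g ≠ pt Γ ∧ ζ = el w g := by
  obtain ⟨⟨a, g⟩, rfl⟩ : ∃ a, Smash.mk a = ζ := Quotient.exists_rep ζ
  by_cases hg : g = pt Γ
  · exact Or.inl (Smash.mk_eq_pt (Or.inr hg))
  rcases a with w | a
  · exact Or.inr ⟨w, g, hg, rfl⟩
  · exact Or.inl (Smash.mk_eq_pt (Or.inl rfl))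

/-- The map `W₊ ∧ Γ → Q ∧ Γ` of sets induced by a function `W → Q`, which need not be
continuous. -/
def zmap (v : W → Q) : Smash (Plus W) Γ → Smash Q Γ :=
  Quotient.lift (fun a : Plus W × Γ => (Smash.mk (Sum.elim v (fun _ => pt Q) a.1, a.2) : Smash Q Γ))
    (by
      have key : ∀ a : Plus W × Γ, (a.1 = pt (Plus W) ∨ a.2 = pt Γ) →
          (Smash.mk (Sum.elim v (fun _ => pt Q) a.1, a.2) : Smash Q Γ) = pt _ := by
        rintro ⟨a, g⟩ (h | h)
        · refine Smash.mk_eq_pt (Or.inl ?_)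
          change a = pt (Plus W) at h
          rw [h]
          rfl
        · exact Smash.mk_eq_pt (Or.inr h)
      rintro a b (rfl | ⟨ha, hb⟩)
      · rfl
      · exact (key a ha).trans (key b hb).symm)

theorem zmap_el (v : W → Q) (w : W) (g : Γ) : zmap v (el w g) = Smash.mk (v w, g) := rfl

theorem zmap_pt (v : W → Q) : zmap v (pt (Smash (Plus W) Γ)) = pt (Smash Q Γ) :=
  Smash.mk_eq_pt (Or.inl rfl)

theorem zmap_inl_el {V : Type*} (v : W → V) (w : W) (g : Γ) :
    zmap (fun w => (Sum.inl (v w) : Plus V)) (el w g) = el (v w) g := rfl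

/-- A point `[w, g]` of `W₊ ∧ Γ` lies over `A ⊆ W` if it is the base point or `w ∈ A`. -/
def Over (A : Set W) (ζ : Smash (Plus W) Γ) : Prop := ∀ w g, g ≠ pt Γ → ζ = el w g → w ∈ A

theorem over_pt (A : Set W) : Over A (pt (Smash (Plus W) Γ)) :=
  fun _ _ hg h => absurd (el_eq_pt.1 h.symm) hg

theorem over_el {A : Set W} {w : W} (hw : w ∈ A) (g : Γ) : Over A (el w g) := by
  intro w' g' hg h
  rw [← (el_inj hg h.symm).1] at hw
  exact hw

theorem Over.mono {A A' : Set W} (h : A ⊆ A') {ζ : Smash (Plus W) Γ} (hζ : Over A ζ) :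
    Over A' ζ := fun w g hg e => h (hζ w g hg e)

/-- `zmap v` depends only on the values of `v` on the support. -/
theorem zmap_congr {A : Set W} {v v' : W → Q} (h : ∀ w ∈ A, v w = v' w) {ζ : Smash (Plus W) Γ}
    (hζ : Over A ζ) : zmap v ζ = zmap v' ζ := by
  rcases el_cases ζ with rfl | ⟨w, g, hg, rfl⟩
  · rw [zmap_pt, zmap_pt]
  · rw [zmap_el, zmap_el, h w (hζ w g hg rfl)]

theorem zmap_zmap {V : Type*} (v : W → V) (v' : V → Q) (ζ : Smash (Plus W) Γ) :
    zmap v' (zmap (fun w => (Sum.inl (v w) : Plus V)) ζ) = zmap (fun w => v' (v w)) ζ := by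
  rcases el_cases ζ with rfl | ⟨w, g, hg, rfl⟩
  · simp only [zmap_pt]
  · rfl

theorem zmap_inl_id (ζ : Smash (Plus W) Γ) :
    zmap (fun w => (Sum.inl w : Plus W)) ζ = ζ := by
  rcases el_cases ζ with rfl | ⟨w, g, hg, rfl⟩
  · exact zmap_pt _
  · rfl

theorem zmap_eq_pt_of_forall {v : W → Q} (h : ∀ w, v w = pt Q) (ζ : Smash (Plus W) Γ) :
    zmap v ζ = pt _ := by
  rcases el_cases ζ with rfl | ⟨w, g, hg, rfl⟩
  · exact zmap_pt _
  · exact Smash.mk_eq_pt (Or.inl (h w))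

theorem over_zmap_inl {V : Type*} {A : Set V} {v : W → V} (h : ∀ w, v w ∈ A)
    (ζ : Smash (Plus W) Γ) : Over A (zmap (fun w => (Sum.inl (v w) : Plus V)) ζ) := by
  rcases el_cases ζ with rfl | ⟨w, g, hg, rfl⟩
  · rw [zmap_pt]; exact over_pt A
  · exact over_el (h w) g

theorem zmap_inl_injective {V : Type*} {v : W → V} (hv : Function.Injective v) :
    Function.Injective
      (zmap (fun w => (Sum.inl (v w) : Plus V)) : Smash (Plus W) Γ → Smash (Plus V) Γ) := by
  intro ζ ζ' h
  rcases el_cases ζ with rfl | ⟨w, g, hg, rfl⟩ <;> rcases el_cases ζ' with rfl | ⟨w', g', hg', rfl⟩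
  · rfl
  · rw [zmap_pt, zmap_inl_el, eq_comm, el_eq_pt] at h
    exact absurd h hg'
  · rw [zmap_pt, zmap_inl_el, el_eq_pt] at h
    exact absurd h hg
  · rw [zmap_inl_el, zmap_inl_el] at h
    obtain ⟨h1, h2⟩ := el_inj hg h
    rw [hv h1, h2]

theorem Over.exists_zmap_val {A : Set W} {ζ : Smash (Plus W) Γ} (hζ : Over A ζ) :
    ∃ ζ' : Smash (Plus A) Γ, zmap (fun w : A => (Sum.inl w.1 : Plus W)) ζ' = ζ := by
  rcases el_cases ζ with rfl | ⟨w, g, hg, rfl⟩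
  · exact ⟨pt _, zmap_pt _⟩
  · exact ⟨el ⟨w, hζ w g hg rfl⟩ g, rfl⟩

end HalfSmash

section HalfSmashTopology

variable {W Q Γ : Type*} [HasBase Q] [HasBase Γ] [TopologicalSpace W] [TopologicalSpace Q]
  [TopologicalSpace Γ]

theorem isClosed_smash_base [T1Space Γ] :
    IsClosed {a : Plus W × Γ | a.1 = pt (Plus W) ∨ a.2 = pt Γ} := by
  refine IsClosed.union ?_ ?_
  · have h : IsClosed ({pt (Plus W)} : Set (Plus W)) := by
      have : ({pt (Plus W)} : Set (Plus W)) = Set.range Sum.inr := by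
        ext x
        constructor
        · rintro rfl
          exact ⟨(), rfl⟩
        · rintro ⟨⟨⟩, rfl⟩
          rfl
      rw [this]
      exact isClosed_range_inr
    exact h.preimage continuous_fst
  · exact isClosed_singleton.preimage continuous_snd

theorem continuous_zmap {v : W → Q} (hv : Continuous v) :
    Continuous (zmap v : Smash (Plus W) Γ → Smash Q Γ) := by
  refine Continuous.quotient_lift ?_ _
  exact Smash.isQuotientMap_mk.continuous.comp
    (((hv.sumElim continuous_const).comp continuous_fst).prodMk continuous_snd)

theorem isClosedEmbedding_zmap [T1Space Γ] {V : Type*} [TopologicalSpace V] {j : V → W}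
    (hj : IsClosedEmbedding j) :
    IsClosedEmbedding
      (zmap (fun a => (Sum.inl (j a) : Plus W)) : Smash (Plus V) Γ → Smash (Plus W) Γ) := by
  refine IsClosedEmbedding.of_continuous_injective_isClosedMap
    (continuous_zmap (continuous_inl.comp hj.continuous)) (zmap_inl_injective hj.injective) ?_
  intro C hC
  have hs : IsClosedEmbedding (Sum.map j id : Plus V → Plus W) := by
    refine IsClosedEmbedding.of_continuous_injective_isClosedMap
      (hj.continuous.sumMap continuous_id)
      (Function.Injective.sumMap hj.injective Function.injective_id) ?_
    exact hj.isClosedMap.sumMap IsClosedMap.id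
  have hp : IsClosedEmbedding (Prod.map (Sum.map j id) id : Plus V × Γ → Plus W × Γ) :=
    hs.prodMap IsClosedEmbedding.id
  rw [← Smash.isQuotientMap_mk.isClosed_preimage]
  have h1 : IsClosed (Prod.map (Sum.map j id) id '' (Smash.mk ⁻¹' C : Set (Plus V × Γ))) :=
    hp.isClosedMap _ (hC.preimage Smash.isQuotientMap_mk.continuous)
  have hF : ∀ a : Plus V × Γ, zmap (fun a => (Sum.inl (j a) : Plus W)) (Smash.mk a) =
      Smash.mk (Prod.map (Sum.map j id) id a) := by
    rintro ⟨a | a, g⟩ <;> rfl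
  by_cases hpt : pt _ ∈ C
  · convert h1.union (isClosed_smash_base (W := W) (Γ := Γ)) using 1
    ext a
    constructor
    · rintro ⟨c, hc, hca⟩
      obtain ⟨c, rfl⟩ := Smash.isQuotientMap_mk.surjective c
      rw [hF] at hca
      rcases Smash.mk_eq_mk_iff.1 hca with h | h
      · exact Or.inl ⟨c, hc, h⟩
      · exact Or.inr h.2
    · rintro (⟨c, hc, rfl⟩ | h)
      · exact ⟨Smash.mk c, hc, hF c⟩
      · exact ⟨pt _, hpt, (zmap_pt _).trans (Smash.mk_eq_pt h).symm⟩
  · convert h1 using 1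
    ext a
    constructor
    · rintro ⟨c, hc, hca⟩
      obtain ⟨c, rfl⟩ := Smash.isQuotientMap_mk.surjective c
      rw [hF] at hca
      rcases Smash.mk_eq_mk_iff.1 hca with h | h
      · exact ⟨c, hc, h⟩
      · exfalso
        apply hpt
        have : Smash.mk c = pt (Smash (Plus V) Γ) := by
          refine zmap_inl_injective (v := j) hj.injective ?_
          rw [hF, zmap_pt]
          exact Smash.mk_eq_pt h.1
        rwa [← this]
    · rintro ⟨c, hc, rfl⟩
      exact ⟨Smash.mk c, hc, hF c⟩

theorem t1Space_halfSmash [T1Space Γ] [T1Space W] : T1Space (Smash (Plus W) Γ) := by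
  refine ⟨fun ζ => ?_⟩
  rw [← Smash.isQuotientMap_mk.isClosed_preimage]
  rcases el_cases ζ with rfl | ⟨w, g, hg, rfl⟩
  · convert isClosed_smash_base (W := W) (Γ := Γ) using 1
    ext a
    exact Smash.mk_eq_pt_iff
  · convert ((IsClosedEmbedding.inl (X := W) (Y := Unit)).isClosedMap {w} isClosed_singleton).prod
      (isClosed_singleton (x := g)) using 1
    · ext ⟨a, g'⟩
      constructor
      · intro h
        have h' : el w g = Smash.mk (a, g') := Eq.symm h
        rcases a with w' | a
        · obtain ⟨rfl, rfl⟩ := el_inj hg h'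
          exact ⟨⟨w, rfl, rfl⟩, rfl⟩
        · exact absurd (el_eq_pt.1 (h'.trans (Smash.mk_eq_pt (Or.inl rfl)))) hg
      · rintro ⟨⟨w', rfl, h1⟩, h2⟩
        change Sum.inl w' = a at h1
        change g' = g at h2
        subst h1 h2
        rfl

theorem continuous_halfSmash_prod {K : Type*} [TopologicalSpace K] [LocallyCompactSpace K] :
    Continuous (fun x : Smash (Plus W) Γ × K =>
      zmap (fun w => (Sum.inl (x.2, w) : Plus (K × W))) x.1) := by
  refine Smash.isQuotientMap_mk.continuous_lift_prod_left ?_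
  have hc : Continuous (fun x : Plus W × K =>
      (Sum.elim (fun w => (Sum.inl (x.2, w) : Plus (K × W))) (fun _ => pt (Plus (K × W))) x.1)) := by
    rw [← (Homeomorph.sumProdDistrib (X := W) (Y := Unit) (Z := K)).symm.comp_continuous_iff']
    refine continuous_sum_dom.2 ⟨?_, ?_⟩
    · exact continuous_inl.comp (continuous_snd.prodMk continuous_fst)
    · exact continuous_const
  exact Smash.isQuotientMap_mk.continuous.comp
    ((hc.comp ((continuous_fst.comp continuous_fst).prodMk continuous_snd)).prodMk
      (continuous_snd.comp continuous_fst))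

/-- Continuity of fiberwise functoriality: `v (k, ·)` need only be continuous on a closed subset `M`
of `K × W` that contains the supports. -/
theorem continuous_zmap_fiberwise [T1Space Γ] {K X : Type*} [TopologicalSpace K]
    [LocallyCompactSpace K] [TopologicalSpace X] {M : Set (K × W)} (hM : IsClosed M)
    {v : K × W → Q} (hv : ContinuousOn v M) {k : X → K} (hk : Continuous k)
    {ζ : X → Smash (Plus W) Γ} (hζ : Continuous ζ)
    (hover : ∀ x, Over {w | (k x, w) ∈ M} (ζ x)) :
    Continuous (fun x => zmap (fun w => v (k x, w)) (ζ x)) := by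
  have hJ := isClosedEmbedding_zmap (Γ := Γ) (hM.isClosedEmbedding_subtypeVal)
  let y : X → Smash (Plus (K × W)) Γ := fun x => zmap (fun w => Sum.inl (k x, w)) (ζ x)
  have hy : Continuous y := continuous_halfSmash_prod.comp (hζ.prodMk hk)
  have hex : ∀ x, ∃ z : Smash (Plus M) Γ, zmap (fun a : M => (Sum.inl a.1 : Plus (K × W))) z = y x := by
    intro x
    refine Over.exists_zmap_val ?_
    change Over M (zmap _ (ζ x))
    rcases el_cases (ζ x) with h | ⟨w, g, hg, h⟩
    · rw [h, zmap_pt]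
      exact over_pt M
    · rw [h]
      exact over_el (A := M) (w := (k x, w)) (hover x w g hg h) g
  choose z hz using hex
  have hzc : Continuous z := by
    rw [hJ.isInducing.continuous_iff]
    exact hy.congr fun x => (hz x).symm
  have hv' : Continuous (fun a : M => v a.1) := continuousOn_iff_continuous_domRestrict.1 hv
  refine ((continuous_zmap hv').comp hzc).congr fun x => ?_
  have : zmap v (zmap (fun a : M => (Sum.inl a.1 : Plus (K × W))) (z x)) = zmap v (y x) := by
    rw [hz]
  rw [zmap_zmap] at this
  change zmap (fun a : M => v a.1) (z x) = _
  rw [this]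
  exact zmap_zmap _ _ _

end HalfSmashTopology

/-! ### Sequential colimits of embeddings -/

section SeqColim

variable {X : ℕ → Type*} (sh : ∀ n, X n → X (n + 1))

/-- The shift on the disjoint union of a sequence of spaces. -/
def seqShift (a : Σ n, X n) : Σ n, X n := ⟨a.1 + 1, sh a.1 a.2⟩

/-- The colimit of a sequence of spaces. -/
abbrev SeqColim : Type _ := Quot (fun a b : (Σ n, X n) => b = seqShift sh a)

/-- The class in the colimit of a point of the `n`-th space. -/
def seqMk (n : ℕ) (x : X n) : SeqColim sh := Quot.mk _ ⟨n, x⟩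

theorem seqMk_succ (n : ℕ) (x : X n) : seqMk sh (n + 1) (sh n x) = seqMk sh n x :=
  (Quot.sound (r := fun a b : (Σ n, X n) => b = seqShift sh a) (a := ⟨n, x⟩) rfl).symm

theorem quot_mk_eq_iff (a b : Σ n, X n) :
    (Quot.mk _ a : SeqColim sh) = Quot.mk _ b ↔ ∃ i j, (seqShift sh)^[i] a = (seqShift sh)^[j] b := by
  constructor
  · intro h
    have h' := Quot.eqvGen_exact h
    clear h
    induction h' with
    | rel a b h => exact ⟨1, 0, h.symm⟩
    | refl a => exact ⟨0, 0, rfl⟩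
    | symm a b _ ih =>
      obtain ⟨i, j, h⟩ := ih
      exact ⟨j, i, h.symm⟩
    | trans a b c _ _ ih1 ih2 =>
      obtain ⟨i, j, h⟩ := ih1
      obtain ⟨k, l, h'⟩ := ih2
      refine ⟨k + i, j + l, ?_⟩
      rw [Function.iterate_add_apply, h, ← Function.iterate_add_apply, add_comm k j,
        Function.iterate_add_apply, h', ← Function.iterate_add_apply]
  · have key : ∀ i a, (Quot.mk _ ((seqShift sh)^[i] a) : SeqColim sh) = Quot.mk _ a := by
      intro i
      induction i with
      | zero => exact fun _ => rfl
      | succ i ih =>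
        intro a
        rw [Function.iterate_succ_apply, ih]
        exact (seqMk_succ sh a.1 a.2)
    rintro ⟨i, j, h⟩
    rw [← key i a, h, key]

theorem seqShift_injective (h : ∀ n, Function.Injective (sh n)) :
    Function.Injective (seqShift sh) := by
  rintro ⟨n, x⟩ ⟨m, y⟩ hxy
  obtain rfl : n = m := by
    have := congrArg Sigma.fst hxy
    simpa [seqShift] using this
  have h2 : sh n x = sh n y := eq_of_heq (Sigma.mk.inj hxy).2
  rw [h n h2]

theorem seqShift_iterate_fst (i : ℕ) (a : Σ n, X n) : ((seqShift sh)^[i] a).1 = a.1 + i := by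
  induction i generalizing a with
  | zero => rfl
  | succ i ih =>
    rw [Function.iterate_succ_apply, ih]
    simp only [seqShift]
    omega

theorem seqMk_injective (h : ∀ n, Function.Injective (sh n)) (n : ℕ) :
    Function.Injective (seqMk sh n) := by
  intro x y hxy
  obtain ⟨i, j, hij⟩ := (quot_mk_eq_iff sh _ _).1 hxy
  obtain rfl : i = j := by
    have := congrArg Sigma.fst hij
    rw [seqShift_iterate_fst, seqShift_iterate_fst] at this
    simpa using this
  have := (seqShift_injective sh h).iterate i hij
  exact eq_of_heq (Sigma.mk.inj this).2

theorem exists_seqMk (q : SeqColim sh) : ∃ n x, seqMk sh n x = q := by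
  obtain ⟨⟨n, x⟩, rfl⟩ := Quot.exists_rep q
  exact ⟨n, x, rfl⟩

theorem exists_seqMk_of_le {n m : ℕ} (h : n ≤ m) (x : X n) : ∃ y, seqMk sh m y = seqMk sh n x := by
  induction m, h using Nat.le_induction with
  | base => exact ⟨x, rfl⟩
  | succ m _ ih =>
    obtain ⟨y, hy⟩ := ih
    exact ⟨sh m y, (seqMk_succ sh m y).trans hy⟩

variable [∀ n, TopologicalSpace (X n)]

theorem continuous_seqMk (n : ℕ) : Continuous (seqMk sh n) :=
  continuous_quot_mk.comp continuous_sigmaMk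

theorem isOpen_seqColim_iff (V : Set (SeqColim sh)) :
    IsOpen V ↔ ∀ n, IsOpen (seqMk sh n ⁻¹' V) := by
  rw [← isQuotientMap_quot_mk.isOpen_preimage, isOpen_sigma_iff]
  rfl

theorem isClosed_seqColim_iff (V : Set (SeqColim sh)) :
    IsClosed V ↔ ∀ n, IsClosed (seqMk sh n ⁻¹' V) := by
  rw [← isQuotientMap_quot_mk.isClosed_preimage, isClosed_sigma_iff]
  rfl

/-- It suffices to check openness at arbitrarily late stages. -/
theorem isOpen_seqColim_of_frequently (hc : ∀ n, Continuous (sh n)) (V : Set (SeqColim sh))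
    (h : ∀ n, ∃ m, n ≤ m ∧ IsOpen (seqMk sh m ⁻¹' V)) : IsOpen V := by
  rw [isOpen_seqColim_iff]
  intro n
  obtain ⟨m, hnm, hm⟩ := h n
  induction m, hnm using Nat.le_induction with
  | base => exact hm
  | succ m _ ih =>
    apply ih
    convert hm.preimage (hc m) using 1
    ext x
    simp only [Set.mem_preimage, seqMk_succ]

/-- The stages of a sequence of embeddings are embedded in the colimit. -/
theorem isInducing_seqMk (hi : ∀ n, Function.Injective (sh n)) (hs : ∀ n, IsInducing (sh n))
    (n : ℕ) : IsInducing (seqMk sh n) := by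
  refine ⟨le_antisymm (continuous_seqMk sh n).le_induced ?_⟩
  intro U hU
  have hext : ∀ m (A : Set (X m)), ∃ A' : Set (X (m + 1)), IsOpen A → IsOpen A' ∧ sh m ⁻¹' A' = A := by
    intro m A
    by_cases hA : IsOpen A
    · obtain ⟨A', h1, h2⟩ := (hs m).isOpen_iff.1 hA
      exact ⟨A', fun _ => ⟨h1, h2⟩⟩
    · exact ⟨∅, fun h => absurd h hA⟩
  choose nxt hnxt using hext
  let A : ∀ j, Set (X (n + j)) := fun j => Nat.rec U (fun j B => nxt (n + j) B) j
  have hA : ∀ j, IsOpen (A j) := by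
    intro j
    induction j with
    | zero => exact hU
    | succ j ih => exact (hnxt _ _ ih).1
  have hA' : ∀ j x, sh (n + j) x ∈ A (j + 1) ↔ x ∈ A j := fun j x =>
    Set.ext_iff.1 (hnxt _ _ (hA j)).2 x
  -- the open set is the union of the images of the successive extensions of `U`
  let V : Set (SeqColim sh) := {q | ∃ j, ∃ x ∈ A j, seqMk sh (n + j) x = q}
  have hup : ∀ j (x : X (n + j)) k, ∃ y : X (n + (j + k)),
      seqMk sh _ y = seqMk sh _ x ∧ (x ∈ A j ↔ y ∈ A (j + k)) := by
    intro j x k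
    induction k with
    | zero => exact ⟨x, rfl, Iff.rfl⟩
    | succ k ih =>
      obtain ⟨y, h1, h2⟩ := ih
      exact ⟨sh _ y, (seqMk_succ sh _ y).trans h1, h2.trans (hA' (j + k) y).symm⟩
  have hV : ∀ j, seqMk sh (n + j) ⁻¹' V = A j := by
    intro j
    ext x
    constructor
    · rintro ⟨i, y, hy, hxy⟩
      obtain ⟨x', hx1, hx2⟩ := hup j x i
      obtain ⟨y', hy1, hy2⟩ := hup i y j
      rw [hx2]
      have key : ∀ a b (u : X (n + a)) (v : X (n + b)), a = b →
          seqMk sh _ u = seqMk sh _ v → v ∈ A b → u ∈ A a := by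
        rintro a _ u v rfl huv hv
        rwa [seqMk_injective sh hi _ huv]
      exact key _ _ x' y' (add_comm j i) (by rw [hx1, hy1, hxy]) (hy2.1 hy)
    · exact fun hx => ⟨j, x, hx, rfl⟩
  refine ⟨V, isOpen_seqColim_of_frequently sh (fun m => (hs m).continuous) V fun m => ?_, hV 0⟩
  refine ⟨n + m, by omega, ?_⟩
  rw [hV m]
  exact hA m

/-- A compact family in the colimit lies in a stage: otherwise there is a sequence of points of the
family of which only finitely many lie in each stage, and such a sequence is an infinite closed
discrete subset. -/
theorem exists_forall_mem_range_seqMk (hi : ∀ n, Function.Injective (sh n)) [∀ n, T1Space (X n)]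
    {K : Type*} [TopologicalSpace K] [CompactSpace K] {s : K → SeqColim sh} (hs : Continuous s) :
    ∃ n, ∀ k, s k ∈ Set.range (seqMk sh n) := by
  by_contra! hcon
  choose k hk using hcon
  have hmono : ∀ {m n} (x : X m), m ≤ n → seqMk sh m x ∈ Set.range (seqMk sh n) :=
    fun x h => exists_seqMk_of_le sh h x
  have hcl : ∀ A : Set ℕ, IsClosed ((fun n => s (k n)) '' A) := by
    intro A
    rw [isClosed_seqColim_iff]
    intro m
    have hfin : ((fun n => s (k n)) '' (A ∩ Set.Iio m)).Finite :=
      ((Set.finite_Iio m).subset Set.inter_subset_right).image _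
    refine ((hfin.preimage (seqMk_injective sh hi m).injOn).subset ?_).isClosed
    rintro x ⟨n, hn, hnx⟩
    refine ⟨n, ⟨hn, ?_⟩, hnx⟩
    by_contra hmn
    have hnx' : s (k n) = seqMk sh m x := hnx
    exact hk n (hnx' ▸ hmono x (not_lt.1 hmn))
  have hcpt : IsCompact (Set.range fun n => s (k n)) := by
    refine (isCompact_range hs).of_isClosed_subset ?_ ?_
    · simpa using hcl Set.univ
    · rintro _ ⟨n, rfl⟩
      exact ⟨k n, rfl⟩
  have hdisc : DiscreteTopology (Set.range fun n => s (k n)) := by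
    rw [discreteTopology_iff_forall_isClosed]
    intro T
    refine isClosed_induced_iff.2 ⟨_, hcl {n | ∃ h, (⟨s (k n), h⟩ : Set.range fun n => s (k n)) ∈ T},
      ?_⟩
    ext ⟨y, n, rfl⟩
    constructor
    · rintro ⟨n', ⟨h1, h2⟩, h3⟩
      have h4 : (⟨s (k n'), h1⟩ : Set.range fun n => s (k n)) = ⟨s (k n), n, rfl⟩ := Subtype.ext h3
      exact h4 ▸ h2
    · exact fun h => ⟨n, ⟨_, h⟩, rfl⟩
  have hfin := hcpt.finite (isDiscrete_iff_discreteTopology.2 hdisc)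
  have hall : ∀ q : SeqColim sh, ∃ n, q ∈ Set.range (seqMk sh n) := by
    intro q
    obtain ⟨n, x, rfl⟩ := exists_seqMk sh q
    exact ⟨n, x, rfl⟩
  choose N hN using hall
  obtain ⟨m, hm⟩ := (hfin.image N).bddAbove
  obtain ⟨x, hx⟩ := hN (s (k m))
  apply hk m
  rw [← hx]
  exact hmono x (hm ⟨_, ⟨m, rfl⟩, rfl⟩)

end SeqColim

/-! ### Stages of reduced homology -/

section Stages

variable (G : Prespectrum.{u})

theorem exists_susp_ne {m : ℕ} {g : G.space m} (hg : g ≠ pt _) :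
    ∃ t, G.susp m (g, t) ≠ pt _ := by
  by_contra! h
  apply hg
  apply (G.isEmbedding_adjoint m).injective
  ext t
  exact (h t).trans (G.susp_pt m t).symm

variable {W : Type*} [TopologicalSpace W]

theorem smashSusp_el {m : ℕ} (w : W) (g : G.space m) (t : I) :
    smashSusp G (Plus W) m (el w g, t) = el w (G.susp m (g, t)) := rfl

theorem zmap_smashSusp {Q : Type*} [HasBase Q] [TopologicalSpace Q] {m : ℕ} (v : W → Q)
    (ζ : Smash (Plus W) (G.space m)) (t : I) :
    zmap v (smashSusp G (Plus W) m (ζ, t)) = smashSusp G Q m (zmap v ζ, t) := by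
  rcases el_cases ζ with rfl | ⟨w, g, hg, rfl⟩
  · rw [smashSusp_pt, zmap_pt, zmap_pt, smashSusp_pt]
  · rfl

theorem Over.smashSusp {m : ℕ} {A : Set W} {ζ : Smash (Plus W) (G.space m)} (h : Over A ζ) (t : I) :
    Over A (smashSusp G (Plus W) m (ζ, t)) := by
  rcases el_cases ζ with rfl | ⟨w, g, hg, rfl⟩
  · rw [smashSusp_pt]
    exact over_pt A
  · exact over_el (h w g hg rfl) _

theorem over_of_forall_smashSusp {m : ℕ} {A : Set W} {ζ : Smash (Plus W) (G.space m)}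
    (h : ∀ t, Over A (StratHom.smashSusp G (Plus W) m (ζ, t))) : Over A ζ := by
  rintro w g hg rfl
  obtain ⟨t, ht⟩ := exists_susp_ne G hg
  exact h t w _ ht rfl

theorem smashSusp_injective {m : ℕ} {ζ ζ' : Smash (Plus W) (G.space m)}
    (h : ∀ t, smashSusp G (Plus W) m (ζ, t) = smashSusp G (Plus W) m (ζ', t)) : ζ = ζ' := by
  have key : ∀ {ζ ζ' : Smash (Plus W) (G.space m)},
      (∀ t, smashSusp G (Plus W) m (ζ, t) = smashSusp G (Plus W) m (ζ', t)) → ζ ≠ pt _ →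
        ζ = ζ' := by
    intro ζ ζ' h hζ
    rcases el_cases ζ with rfl | ⟨w, g, hg, rfl⟩
    · exact absurd rfl hζ
    obtain ⟨t, ht⟩ := exists_susp_ne G hg
    rcases el_cases ζ' with rfl | ⟨w', g', hg', rfl⟩
    · have := h t
      rw [smashSusp_pt, smashSusp_el, el_eq_pt] at this
      exact absurd this ht
    · have hw := (el_inj ht (h t)).1
      subst hw
      congr 1
      apply (G.isEmbedding_adjoint m).injective
      ext s
      change G.susp m (g, s) = G.susp m (g', s)
      by_cases hs : G.susp m (g, s) = pt _
      · have := h s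
        rw [smashSusp_el, smashSusp_el, hs, el_eq_pt.2 rfl, eq_comm, el_eq_pt] at this
        rw [hs, this]
      · exact (el_inj hs (h s)).2
  by_cases hζ : ζ = pt _
  · by_cases hζ' : ζ' = pt _
    · rw [hζ, hζ']
    · exact (key (fun t => (h t).symm) hζ').symm
  · exact key h hζ

/-- The adjoint of the structure map of `W₊ ∧ G` is an embedding if `W` is compact. At the base
point this uses that every neighbourhood of `W × {pt}` contains a tube. -/
theorem isInducing_smashSusp_adjoint [CompactSpace W] (m : ℕ) :
    IsInducing (fun ζ => (smashSusp G (Plus W) m).curry ζ) := by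
  rw [isInducing_iff_nhds]
  intro ζ
  refine le_antisymm (Filter.map_le_iff_le_comap.1 (ContinuousMap.continuous _).continuousAt) ?_
  intro O hO
  -- the projection `W₊ ∧ Gₘ₊₁ → Gₘ₊₁`
  let pr : ∀ n, Smash (Plus W) (G.space n) → G.space n := fun n => Quotient.lift
    (fun a : Plus W × G.space n => Sum.elim (fun _ => a.2) (fun _ => pt (G.space n)) a.1) (by
      have key : ∀ a : Plus W × G.space n, (a.1 = pt (Plus W) ∨ a.2 = pt _) →
          Sum.elim (fun _ => a.2) (fun _ => pt (G.space n)) a.1 = pt _ := by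
        rintro ⟨a | a, g⟩ (h | h)
        · exact absurd h Sum.inl_ne_inr
        · exact h
        · rfl
        · rfl
      rintro a b (rfl | ⟨ha, hb⟩)
      · rfl
      · exact (key a ha).trans (key b hb).symm)
  have hpr : Continuous (pr (m + 1)) := by
    refine Continuous.quotient_lift ?_ _
    rw [← (Homeomorph.sumProdDistrib (X := W) (Y := Unit)
      (Z := G.space (m + 1))).symm.comp_continuous_iff']
    exact continuous_sum_dom.2 ⟨continuous_snd, continuous_const⟩
  have hprsusp : ∀ (ζ : Smash (Plus W) (G.space m)) t,
      pr (m + 1) (smashSusp G (Plus W) m (ζ, t)) = G.susp m (pr m ζ, t) := by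
    intro ζ t
    rcases el_cases ζ with rfl | ⟨w, g, hg, rfl⟩
    · rw [smashSusp_pt]
      exact (G.susp_pt m t).symm
    · rfl
  have hU : ∀ U ∈ 𝓝 (pr m ζ), ∃ N ∈ 𝓝 ((smashSusp G (Plus W) m).curry ζ),
      ∀ ζ', (smashSusp G (Plus W) m).curry ζ' ∈ N → pr m ζ' ∈ U := by
    intro U hU
    rw [(G.isEmbedding_adjoint m).isInducing.nhds_eq_comap] at hU
    obtain ⟨N, hN, hNU⟩ := hU
    have hP := ContinuousMap.continuous_postcomp (X := I) ⟨pr (m + 1), hpr⟩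
    have hPe : ∀ ζ', ContinuousMap.comp ⟨pr (m + 1), hpr⟩ ((smashSusp G (Plus W) m).curry ζ') =
        (G.susp m).curry (pr m ζ') := fun ζ' => ContinuousMap.ext fun t => hprsusp ζ' t
    refine ⟨_, hP.continuousAt (by rw [hPe]; exact hN), fun ζ' hζ' => hNU ?_⟩
    change _ ∈ N at hζ'
    rwa [hPe] at hζ'
  rw [Filter.mem_comap]
  rcases el_cases ζ with rfl | ⟨w, g, hg, rfl⟩
  · have hU0 : {g : G.space m | ∀ w : W, el w g ∈ O} ∈ 𝓝 (pt (G.space m)) := by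
      have := isCompact_univ.eventually_forall_of_forall_eventually (X := G.space m)
        (x₀ := pt (G.space m)) (P := fun g w => el w g ∈ O) (fun w _ => by
          have hc : Continuous (fun z : G.space m × W => el z.2 z.1) :=
            Smash.isQuotientMap_mk.continuous.comp
              ((continuous_inl.comp continuous_snd).prodMk continuous_fst)
          refine hc.continuousAt ?_
          rwa [show el w (pt (G.space m)) = pt _ from el_eq_pt.2 rfl])
      filter_upwards [this] with g hg w
      exact hg w trivial
    obtain ⟨N, hN, hNU⟩ := hU _ hU0
    refine ⟨N, hN, fun ζ' hζ' => ?_⟩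
    have h2 := hNU ζ' hζ'
    rcases el_cases ζ' with rfl | ⟨w, g, hg, rfl⟩
    · exact mem_of_mem_nhds hO
    · exact h2 w
  · have hmk : Continuous (fun z : W × G.space m => el z.1 z.2) :=
      Smash.isQuotientMap_mk.continuous.comp
        ((continuous_inl.comp continuous_fst).prodMk continuous_snd)
    have hO' := hmk.continuousAt (x := (w, g)) hO
    rw [nhds_prod_eq, Filter.mem_map, Filter.mem_prod_iff] at hO'
    obtain ⟨A, hA, U, hUg, hAU⟩ := hO'
    obtain ⟨t, ht⟩ := exists_susp_ne G hg
    obtain ⟨N, hN, hNU⟩ := hU U hUg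
    obtain ⟨A', hAA', hA', hwA'⟩ := mem_nhds_iff.1 hA
    have hV : IsOpen {η : Smash (Plus W) (G.space (m + 1)) |
        ∃ w ∈ A', ∃ g, g ≠ pt _ ∧ η = el w g} := by
      rw [← Smash.isQuotientMap_mk.isOpen_preimage]
      convert (isOpenMap_inl A' hA').prod (isOpen_compl_singleton (x := pt (G.space (m + 1)))) using 1
      ext ⟨a, g'⟩
      constructor
      · rintro ⟨w', hw', g'', hg'', h⟩
        have h' : el w' g'' = Smash.mk (a, g') := Eq.symm h
        rcases a with w₀ | a
        · obtain ⟨rfl, rfl⟩ := el_inj hg'' h'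
          exact ⟨⟨w', hw', rfl⟩, hg''⟩
        · exact absurd (el_eq_pt.1 (h'.trans (Smash.mk_eq_pt (Or.inl rfl)))) hg''
      · rintro ⟨⟨w', hw', h1⟩, h2⟩
        change Sum.inl w' = a at h1
        subst h1
        exact ⟨w', hw', g', h2, rfl⟩
    refine ⟨_, Filter.inter_mem hN ((continuous_eval_const t).continuousAt
      (hV.mem_nhds ⟨w, hwA', _, ht, rfl⟩)), ?_⟩
    rintro ζ' ⟨h1, w', hw', g', hg', h2⟩
    have h3 := hNU ζ' h1
    change smashSusp G (Plus W) m (ζ', t) = _ at h2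
    rcases el_cases ζ' with rfl | ⟨w₀, g₀, hg₀, rfl⟩
    · rw [smashSusp_pt, eq_comm, el_eq_pt] at h2
      exact absurd h2 hg'
    · rw [smashSusp_el, eq_comm] at h2
      obtain ⟨rfl, -⟩ := el_inj hg' h2
      exact hAU (show (w', g₀) ∈ A ×ˢ U from ⟨hAA' hw', h3⟩)

theorem stab_injective (m : ℕ) :
    Function.Injective (fun f : Stage G (Plus W) m => stab G f) := by
  intro f f' h
  ext t
  refine smashSusp_injective G fun s => ?_
  have := congrArg (fun e : Stage G (Plus W) (m + 1) => e (Fin.snoc (α := fun _ => I) t s)) h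
  change smashSusp G (Plus W) m (f (fun k => Fin.snoc (α := fun _ => I) t s k.castSucc),
      Fin.snoc (α := fun _ => I) t s (Fin.last m)) =
    smashSusp G (Plus W) m (f' (fun k => Fin.snoc (α := fun _ => I) t s k.castSucc),
      Fin.snoc (α := fun _ => I) t s (Fin.last m)) at this
  simpa only [Fin.snoc_castSucc, Fin.snoc_last] using this

theorem isInducing_stab [CompactSpace W] (m : ℕ) :
    IsInducing (fun f : Stage G (Plus W) m => stab G f) := by
  let e : (Fin (m + 1) → I) → (Fin m → I) × I := fun t => (fun k => t k.castSucc, t (Fin.last m))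
  have he : Continuous e := (continuous_pi fun k : Fin m =>
    continuous_apply k.castSucc).prodMk (continuous_apply (Fin.last m))
  let e' : (Fin m → I) × I → (Fin (m + 1) → I) := fun z => Fin.snoc (α := fun _ => I) z.1 z.2
  have he' : Continuous e' := by
    refine continuous_pi fun k => ?_
    induction k using Fin.lastCases with
    | last => simpa only [e', Fin.snoc_last] using continuous_snd
    | cast k =>
      simp only [e', Fin.snoc_castSucc]
      fun_prop
  have hee : ∀ t, e' (e t) = t := fun t => by
    funext k
    induction k using Fin.lastCases with
    | last => simp [e, e']
    | cast k => simp [e, e']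
  have hee' : ∀ z, e (e' z) = z := fun z => by simp [e, e']
  have h1 : IsInducing (fun f : C(Fin m → I, Smash (Plus W) (G.space m)) =>
      ContinuousMap.comp ⟨_, (smashSusp G (Plus W) m).curry.continuous⟩ f) :=
    ContinuousMap.isInducing_postcomp _ (isInducing_smashSusp_adjoint G m)
  have h2 := ((Homeomorph.curry (X := Fin m → I) (Y := I)
    (Z := Smash (Plus W) (G.space (m + 1)))).symm).isInducing.comp
      (h1.comp (IsInducing.subtypeVal (t := Ω^ (Fin m) (Smash (Plus W) (G.space m)) (pt _))))
  have h3 : IsInducing (fun f : C((Fin m → I) × I, Smash (Plus W) (G.space (m + 1))) =>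
      f.comp ⟨e, he⟩) := by
    refine IsInducing.of_comp (ContinuousMap.continuous_precomp _)
      (g := fun f => f.comp ⟨e', he'⟩) (ContinuousMap.continuous_precomp _) ?_
    convert IsInducing.id using 1
    funext f
    ext z
    exact congrArg f (hee' z)
  refine IsInducing.of_comp ?_ continuous_subtype_val (h3.comp h2)
  refine Continuous.subtype_mk ((h3.comp h2).continuous) _

theorem t1Space_stage [T1Space W] (m : ℕ) : T1Space (Stage G (Plus W) m) := by
  have := t1Space_halfSmash (W := W) (Γ := G.space m)
  infer_instance

end Stages

/-! ### Classes of loops -/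

section Classes

variable (G : Prespectrum.{u}) {Y Y' : Type*} [TopologicalSpace Y] [HasBase Y]
  [TopologicalSpace Y'] [HasBase Y']

/-- A function on the cube represents an element of a stage if it is continuous and sends the
boundary to the base point. -/
def IsLoop {m : ℕ} {Z : Type*} [TopologicalSpace Z] [HasBase Z] (f : (Fin m → I) → Z) : Prop :=
  Continuous f ∧ ∀ t ∈ Cube.boundary (Fin m), f t = pt Z

/-- A loop as an element of a stage. -/
def IsLoop.toStage {m : ℕ} {f : (Fin m → I) → Smash Y (G.space m)} (h : IsLoop f) :
    Stage G Y m := ⟨⟨f, h.1⟩, h.2⟩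

open Classical in
/-- The class in reduced homology of a function on the cube; by convention it is the base point if
the function does not represent an element of a stage. -/
def cls (m : ℕ) (f : (Fin m → I) → Smash Y (G.space m)) : RedHom G Y :=
  if h : IsLoop f then Quot.mk _ ⟨m, h.toStage G⟩ else pt _

/-- The stabilization of a function on the cube. -/
def rstab {m : ℕ} (f : (Fin m → I) → Smash Y (G.space m)) (t : Fin (m + 1) → I) :
    Smash Y (G.space (m + 1)) :=
  smashSusp G Y m (f (fun k => t k.castSucc), t (Fin.last m))

variable {G}

theorem cls_eq {m : ℕ} {f : (Fin m → I) → Smash Y (G.space m)} (h : IsLoop f) :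
    cls G m f = seqMk (X := Stage G Y) (fun _ => stab G) m (h.toStage G) := dif_pos h

theorem Stage.isLoop {m : ℕ} (f : Stage G Y m) : IsLoop (f : (Fin m → I) → _) := ⟨f.1.2, f.2⟩

theorem cls_stage {m : ℕ} (f : Stage G Y m) :
    cls G m f = seqMk (X := Stage G Y) (fun _ => stab G) m f := cls_eq (Stage.isLoop f)

theorem isLoop_rstab {m : ℕ} {f : (Fin m → I) → Smash Y (G.space m)} (h : IsLoop f) :
    IsLoop (rstab G f) := Stage.isLoop (stab G (h.toStage G))

theorem cls_rstab {m : ℕ} {f : (Fin m → I) → Smash Y (G.space m)} (h : IsLoop f) :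
    cls G (m + 1) (rstab G f) = cls G m f :=
  (cls_stage (stab G (h.toStage G))).trans ((seqMk_succ _ m _).trans (cls_eq h).symm)

theorem isLoop_pt (m : ℕ) : IsLoop (fun _ : Fin m → I => pt (Smash Y (G.space m))) :=
  ⟨continuous_const, fun _ _ => rfl⟩

theorem rstab_pt (m : ℕ) :
    rstab G (fun _ : Fin m → I => pt (Smash Y (G.space m))) = fun _ => pt _ :=
  funext fun _ => smashSusp_pt G m _

theorem cls_pt (m : ℕ) : cls G m (fun _ => pt (Smash Y (G.space m))) = pt (RedHom G Y) := by
  induction m with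
  | zero => exact cls_eq (isLoop_pt 0)
  | succ m ih =>
    rw [← ih, ← cls_rstab (isLoop_pt m), rstab_pt]

theorem redMap_cls' (c : BasedMap Y Y') {m : ℕ} {f : (Fin m → I) → Smash Y (G.space m)}
    (h : IsLoop f) :
    redMap G c (cls G m f) = cls G m (fun t => (Smash.map (G.space m) c).toMap (f t)) := by
  rw [cls_eq h]
  exact (cls_stage (stageMap G c (h.toStage G))).symm

theorem exists_cls (y : RedHom G Y) : ∃ m₀, ∀ m ≥ m₀, ∃ f : (Fin m → I) → Smash Y (G.space m),
    IsLoop f ∧ cls G m f = y := by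
  obtain ⟨n, x, rfl⟩ := exists_seqMk (X := Stage G Y) (fun _ => stab G) y
  refine ⟨n, fun m hm => ?_⟩
  obtain ⟨f, hf⟩ := exists_seqMk_of_le (X := Stage G Y) (fun _ => stab G) hm x
  exact ⟨f, Stage.isLoop f, (cls_stage f).trans hf⟩

theorem continuous_toStage {X : Type*} [TopologicalSpace X] {m : ℕ}
    {f : X → (Fin m → I) → Smash Y (G.space m)}
    (hf : Continuous fun z : X × (Fin m → I) => f z.1 z.2) (h : ∀ x, IsLoop (f x)) :
    Continuous (fun x => (h x).toStage G) :=
  Continuous.subtype_mk (ContinuousMap.continuous_of_continuous_uncurry _ hf) _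

/-- A continuous family of loops has a continuous family of classes. -/
theorem continuous_cls {X : Type*} [TopologicalSpace X] {m : ℕ}
    {f : X → (Fin m → I) → Smash Y (G.space m)}
    (hf : Continuous fun z : X × (Fin m → I) => f z.1 z.2)
    (h : ∀ x, ∀ t ∈ Cube.boundary (Fin m), f x t = pt _) :
    Continuous (fun x => cls G m (f x)) := by
  have hl : ∀ x, IsLoop (f x) := fun x => ⟨hf.comp (continuous_const.prodMk continuous_id), h x⟩
  refine ((continuous_seqMk (X := Stage G Y) (fun _ => stab G) m).comp
    (continuous_toStage hf hl)).congr fun x => ?_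
  exact (cls_eq (hl x)).symm

variable {W Q : Type*} [TopologicalSpace W] [TopologicalSpace Q] [HasBase Q]

theorem smash_map_eq_zmap {m : ℕ} (c : BasedMap (Plus W) Q) (ζ : Smash (Plus W) (G.space m)) :
    (Smash.map (G.space m) c).toMap ζ = zmap (fun w => c.toMap (Sum.inl w)) ζ := by
  rcases el_cases ζ with rfl | ⟨w, g, hg, rfl⟩
  · rw [zmap_pt]
    exact (Smash.map (G.space m) c).map_pt
  · rfl

theorem redMap_cls (c : BasedMap (Plus W) Q) {m : ℕ}
    {f : (Fin m → I) → Smash (Plus W) (G.space m)} (h : IsLoop f) :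
    redMap G c (cls G m f) = cls G m (fun t => zmap (fun w => c.toMap (Sum.inl w)) (f t)) := by
  rw [redMap_cls' c h]
  simp only [smash_map_eq_zmap]

theorem IsLoop.zmap {m : ℕ} {f : (Fin m → I) → Smash (Plus W) (G.space m)} (h : IsLoop f)
    {v : W → Q} (hv : Continuous v) : IsLoop (fun t => StratHom.zmap v (f t)) :=
  ⟨(continuous_zmap hv).comp h.1, fun t ht => by simp only [h.2 t ht, zmap_pt]⟩

theorem cls_injective {m : ℕ} {f f' : (Fin m → I) → Smash (Plus W) (G.space m)} (h : IsLoop f)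
    (h' : IsLoop f') (hff : cls G m f = cls G m f') : f = f' := by
  rw [cls_eq h, cls_eq h'] at hff
  have := seqMk_injective _ (fun n => stab_injective G n) m hff
  funext t
  exact congrArg (fun e : Stage G (Plus W) m => e t) this

/-- Two loops with the same class agree after stabilization; in particular a loop lies over a
subset if its class comes from that subset. -/
theorem over_of_mem_range {A : Set W} {m : ℕ} {f : (Fin m → I) → Smash (Plus W) (G.space m)}
    (h : IsLoop f)
    (hf : cls G m f ∈ Set.range (redMap G (plusMap ⟨Subtype.val, continuous_subtype_val (p := (· ∈ A))⟩)))
    (t : Fin m → I) : Over A (f t) := by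
  obtain ⟨y, hy⟩ := hf
  obtain ⟨n, hn⟩ := exists_cls y
  obtain ⟨f', hf', rfl⟩ := hn (max n m) (le_max_left _ _)
  rw [redMap_cls _ hf'] at hy
  have key : ∀ k (g : (Fin k → I) → Smash (Plus W) (G.space k)), m ≤ k → IsLoop g →
      (∀ t, Over A (g t)) → cls G k g = cls G m f → ∀ t, Over A (f t) := by
    intro k g hmk
    induction k, hmk using Nat.le_induction with
    | base =>
      intro hg hog hgf
      rwa [← cls_injective hg h hgf]
    | succ k hmk ih =>
      intro hg hog hgf
      obtain ⟨e, he⟩ := exists_seqMk_of_le (X := Stage G (Plus W)) (fun _ => stab G) hmk (h.toStage G)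
      rw [← cls_eq h, ← cls_stage e] at he
      refine ih e (Stage.isLoop e) (fun t => ?_) he
      have : g = rstab G e := cls_injective hg (isLoop_rstab (Stage.isLoop e)) (by
        rw [hgf, cls_rstab (Stage.isLoop e), he])
      refine over_of_forall_smashSusp G fun s => ?_
      have h2 := hog (Fin.snoc (α := fun _ => I) t s)
      rw [this] at h2
      simpa only [rstab, Fin.snoc_castSucc, Fin.snoc_last] using h2
  refine key _ _ (le_max_right n m) (hf'.zmap ?_) (fun t => ?_) hy t
  · exact continuous_inl.comp continuous_subtype_val
  · exact over_zmap_inl (v := Subtype.val) (fun w : A => w.2) _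

/-- A loop over a closed subset lifts to that subset. -/
theorem exists_isLoop_lift {A : Set W} (hA : IsClosed A) {m : ℕ}
    {f : (Fin m → I) → Smash (Plus W) (G.space m)} (h : IsLoop f) (ho : ∀ t, Over A (f t)) :
    ∃ f' : (Fin m → I) → Smash (Plus A) (G.space m), IsLoop f' ∧
      ∀ t, zmap (fun w : A => (Sum.inl w.1 : Plus W)) (f' t) = f t := by
  choose f' hf' using fun t => (ho t).exists_zmap_val
  have hJ := isClosedEmbedding_zmap (Γ := G.space m) hA.isClosedEmbedding_subtypeVal
  refine ⟨f', ⟨?_, fun t ht => ?_⟩, hf'⟩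
  · rw [hJ.isInducing.continuous_iff]
    exact h.1.congr fun t => (hf' t).symm
  · apply zmap_inl_injective (v := (Subtype.val : A → W)) Subtype.val_injective
    rw [hf', h.2 t ht, zmap_pt]

theorem redMap_plusMap_injective {V : Type*} [TopologicalSpace V] {j : C(V, W)}
    (hj : Function.Injective j) : Function.Injective (redMap G (plusMap j)) := by
  intro y y' hyy
  obtain ⟨n, hn⟩ := exists_cls y
  obtain ⟨n', hn'⟩ := exists_cls y'
  obtain ⟨f, hf, rfl⟩ := hn (max n n') (le_max_left _ _)
  obtain ⟨f', hf', rfl⟩ := hn' (max n n') (le_max_right _ _)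
  have hc : Continuous fun w => (Sum.inl (j w) : Plus W) := continuous_inl.comp j.continuous
  rw [redMap_cls _ hf, redMap_cls _ hf'] at hyy
  have := cls_injective (hf.zmap hc) (hf'.zmap hc) hyy
  congr 1
  funext t
  exact zmap_inl_injective hj (congrFun this t)

/-- `f` is a family of loops at stage `m` that represents the family `q` of homology classes. -/
structure IsRep {K : Type*} [TopologicalSpace K] (q : K → RedHom G (Plus W)) (m : ℕ)
    (f : K → (Fin m → I) → Smash (Plus W) (G.space m)) : Prop where
  cont : Continuous fun z : K × (Fin m → I) => f z.1 z.2
  bdry : ∀ k, ∀ t ∈ Cube.boundary (Fin m), f k t = pt _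
  cls : ∀ k, StratHom.cls G m (f k) = q k

namespace IsRep

variable {K : Type*} [TopologicalSpace K] {q : K → RedHom G (Plus W)} {m : ℕ}
    {f : K → (Fin m → I) → Smash (Plus W) (G.space m)}

theorem isLoop (h : IsRep q m f) (k : K) : IsLoop (f k) :=
  ⟨h.cont.comp (continuous_const.prodMk continuous_id), h.bdry k⟩

theorem rstab (h : IsRep q m f) : IsRep q (m + 1) (fun k => StratHom.rstab G (f k)) where
  cont := by
    refine (smashSusp G (Plus W) m).continuous.comp ((h.cont.comp (continuous_fst.prodMk
      (continuous_pi fun k : Fin m => (continuous_apply k.castSucc).comp continuous_snd))).prodMk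
        ((continuous_apply (Fin.last m)).comp continuous_snd))
  bdry k := (isLoop_rstab (h.isLoop k)).2
  cls k := (cls_rstab (h.isLoop k)).trans (h.cls k)

theorem unique (h : IsRep q m f) {f' : K → (Fin m → I) → Smash (Plus W) (G.space m)}
    (h' : IsRep q m f') : f = f' :=
  funext fun k => cls_injective (h.isLoop k) (h'.isLoop k) ((h.cls k).trans (h'.cls k).symm)

theorem continuous (h : IsRep q m f) : Continuous q :=
  (continuous_cls h.cont h.bdry).congr h.cls

theorem eq_pt (h : IsRep q m f) {k : K} (hk : q k = pt _) (t : Fin m → I) : f k t = pt _ :=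
  congrFun (cls_injective (h.isLoop k) (isLoop_pt m) (by rw [h.cls, hk, cls_pt])) t

theorem comp (h : IsRep q m f) {K' : Type*} [TopologicalSpace K'] {g : K' → K}
    (hg : Continuous g) : IsRep (fun k => q (g k)) m (fun k => f (g k)) where
  cont := h.cont.comp ((hg.comp continuous_fst).prodMk continuous_snd)
  bdry k := h.bdry (g k)
  cls k := h.cls (g k)

/-- A construction on representatives that is compatible with stabilization does not depend on the
representative. -/
theorem eq_of_rstab {α : Sort*} (Φ : ∀ m, (K → (Fin m → I) → Smash (Plus W) (G.space m)) → α)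
    (k : ℕ) (hΦ : ∀ m ≥ k, ∀ f, IsRep q m f → Φ (m + 1) (fun x => StratHom.rstab G (f x)) = Φ m f)
    {m m' : ℕ} (hm : k ≤ m) (hm' : k ≤ m') {f : K → (Fin m → I) → Smash (Plus W) (G.space m)}
    {f' : K → (Fin m' → I) → Smash (Plus W) (G.space m')} (hf : IsRep q m f)
    (hf' : IsRep q m' f') : Φ m f = Φ m' f' := by
  have key : ∀ {m m' : ℕ}, k ≤ m → m ≤ m' → ∀ {f f'}, IsRep q m f → IsRep q m' f' →
      Φ m f = Φ m' f' := by
    intro m m' hm hmm f f' hf hf'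
    have : ∃ f'', IsRep q m' f'' ∧ Φ m f = Φ m' f'' := by
      clear hf' f'
      induction m', hmm using Nat.le_induction with
      | base => exact ⟨f, hf, rfl⟩
      | succ m' hmm ih =>
        obtain ⟨f'', h1, h2⟩ := ih
        exact ⟨_, h1.rstab, h2.trans (hΦ m' (hm.trans hmm) f'' h1).symm⟩
    obtain ⟨f'', h1, h2⟩ := this
    rw [h2, h1.unique hf']
  rcases le_total m m' with h | h
  · exact key hm h hf hf'
  · exact (key hm' h hf' hf).symm

/-- A stabilization of a representative whose values lie over the same points. -/
theorem exists_rstab_iterate (h : IsRep q m f) (k : ℕ) :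
    ∃ F, IsRep q (m + k) F ∧ ∀ x t A, Over A (f x (fun i => t (Fin.castAdd k i))) →
      Over A (F x t) := by
  induction k with
  | zero => exact ⟨f, h, fun x t A ho => ho⟩
  | succ k ih =>
    obtain ⟨F, hF, ho⟩ := ih
    exact ⟨_, hF.rstab, fun x t A hA => (ho x (fun i => t i.castSucc) A hA).smashSusp _ _⟩

end IsRep

/-- A compact family of homology classes of a compact space is represented at all late stages. -/
theorem exists_isRep [CompactSpace W] [T2Space W] {K : Type*} [TopologicalSpace K] [CompactSpace K]
    {q : K → RedHom G (Plus W)} (hq : Continuous q) :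
    ∃ m₀, ∀ m ≥ m₀, ∃ f, IsRep q m f := by
  have := fun n => t1Space_stage G (W := W) n
  obtain ⟨n, hn⟩ := exists_forall_mem_range_seqMk (X := Stage G (Plus W)) (fun _ => stab G)
    (fun n => stab_injective G n) hq
  refine ⟨n, fun m hm => ?_⟩
  have hn' : ∀ k, ∃ x, seqMk (X := Stage G (Plus W)) (fun _ => stab G) m x = q k := by
    intro k
    obtain ⟨x, hx⟩ := hn k
    obtain ⟨y, hy⟩ := exists_seqMk_of_le (X := Stage G (Plus W)) (fun _ => stab G) hm x
    exact ⟨y, hy.trans hx⟩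
  choose x hx using hn'
  have hxc : Continuous x := by
    rw [(isInducing_seqMk (X := Stage G (Plus W)) (fun _ => stab G)
      (fun n => stab_injective G n) (fun n => isInducing_stab G n) m).continuous_iff]
    exact hq.congr fun k => (hx k).symm
  refine ⟨fun k => x k, ?_, fun k => (x k).2, fun k => (cls_stage (x k)).trans (hx k)⟩
  exact ContinuousMap.continuous_uncurry_of_continuous
    ⟨_, continuous_subtype_val.comp hxc⟩

end Classes

/-! ### Families of sections -/

section DeltaTest

/-- A space is a Euclidean retract if it is a retract of some `ℝⁿ`. -/
def IsEuclideanRetract (X : Type*) [TopologicalSpace X] : Prop :=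
  ∃ (n : ℕ) (i : C(X, Fin n → ℝ)) (r : C(Fin n → ℝ, X)), ∀ x, r (i x) = x

theorem isEuclideanRetract_cube (n : ℕ) : IsEuclideanRetract (Fin n → I) := by
  refine ⟨n, ⟨fun x k => x k, by fun_prop⟩,
    ⟨fun y k => Set.projIcc 0 1 zero_le_one (y k), ?_⟩, fun x => ?_⟩
  · exact continuous_pi fun k => continuous_projIcc.comp (continuous_apply k)
  · funext k
    exact Set.projIcc_val zero_le_one (x k)

theorem isEuclideanRetract_prod_cube (n : ℕ) : IsEuclideanRetract (I × (Fin n → I)) := by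
  refine ⟨n + 1, ⟨fun x => Fin.cons (x.1 : ℝ) (fun k => (x.2 k : ℝ)), ?_⟩,
    ⟨fun y => (Set.projIcc 0 1 zero_le_one (y 0),
      fun k => Set.projIcc 0 1 zero_le_one (y k.succ)), ?_⟩, fun x => ?_⟩
  · refine continuous_pi fun k => ?_
    induction k using Fin.cases with
    | zero => simp only [Fin.cons_zero]; fun_prop
    | succ k => simp only [Fin.cons_succ]; fun_prop
  · exact (continuous_projIcc.comp (continuous_apply 0)).prodMk
      (continuous_pi fun k => continuous_projIcc.comp (continuous_apply k.succ))
  · refine Prod.ext (Set.projIcc_val zero_le_one x.1) (funext fun k => ?_)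
    exact Set.projIcc_val zero_le_one (x.2 k)

end DeltaTest

section SecTopology

variable {G : Prespectrum.{u}} {B W : Type*} [TopologicalSpace B] [TopologicalSpace W]
  {p : C(W, B)} {S : Set W} {A : Set B}

/-- The section `s`, with values in the homology of the total space. -/
def Sec.tot (s : Sec G p S A) (b : B) : RedHom G (Plus W) := redMap G (fibIncl p S b) (s.val b)

theorem redMap_fibIncl_injective (b : B) : Function.Injective (redMap G (fibIncl p S b)) :=
  redMap_plusMap_injective Subtype.val_injective

theorem Sec.ext_val {s s' : Sec G p S A} (h : ∀ b, s.val b = s'.val b) : s = s' := by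
  obtain ⟨v, _, _⟩ := s
  obtain ⟨v', _, _⟩ := s'
  obtain rfl : v = v' := funext h
  rfl

theorem Sec.ext_tot {s s' : Sec G p S A} (h : ∀ b, s.tot b = s'.tot b) : s = s' :=
  Sec.ext_val fun b => redMap_fibIncl_injective b (h b)

theorem Sec.continuous_tot (s : Sec G p S A) : Continuous s.tot :=
  continuous_snd.comp (continuous_induced_dom.comp s.continuous_val)

theorem Sec.tot_eq_pt (s : Sec G p S A) {b : B} (hb : b ∈ A) : s.tot b = pt _ := by
  rw [Sec.tot, s.eq_pt b hb, redMap_pt]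

/-- The section with given values in the homology of the total space. -/
def Sec.ofTot (q : B → RedHom G (Plus W)) (hq : Continuous q)
    (hr : ∀ b, q b ∈ Set.range (redMap G (fibIncl p S b))) (hA : ∀ b ∈ A, q b = pt _) :
    Sec G p S A where
  val b := (hr b).choose
  continuous_val := by
    refine continuous_induced_rng.2 (continuous_id.prodMk (hq.congr fun b => ?_))
    exact (hr b).choose_spec.symm
  eq_pt b hb := by
    apply redMap_fibIncl_injective b
    rw [(hr b).choose_spec, hA b hb, redMap_pt]

theorem Sec.tot_ofTot {q : B → RedHom G (Plus W)} {hq : Continuous q}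
    {hr : ∀ b, q b ∈ Set.range (redMap G (fibIncl p S b))} {hA : ∀ b ∈ A, q b = pt _} (b : B) :
    (Sec.ofTot q hq hr hA).tot b = q b := (hr b).choose_spec

variable (G p S A) in
/-- The compact-open topology on sections. -/
abbrev secCompactOpen : TopologicalSpace (Sec G p S A) :=
  TopologicalSpace.induced Sec.toMap inferInstance

theorem continuous_secCompactOpen_of_tot {X : Type*} [TopologicalSpace X] {F : X → Sec G p S A}
    (hF : Continuous fun z : X × B => (F z.1).tot z.2) :
    @Continuous _ _ _ (secCompactOpen G p S A) F := by
  refine continuous_induced_rng.2 (ContinuousMap.continuous_of_continuous_uncurry _ ?_)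
  exact continuous_induced_rng.2 (continuous_snd.prodMk hF)

theorem continuous_tot_family [LocallyCompactSpace B] {X : Type*} [TopologicalSpace X]
    {F : X → Sec G p S A} (hF : Continuous F) :
    Continuous fun z : X × B => (F z.1).tot z.2 := by
  have h1 : @Continuous _ _ _ (secCompactOpen G p S A) F :=
    continuous_le_rng (@TopologicalSpace.generatedBy_le _ _ _ _ (secCompactOpen G p S A)) hF
  have h2 : Continuous (fun x => (F x).toMap) := continuous_induced_rng.1 h1
  have h3 := ContinuousMap.continuous_uncurry_of_continuous ⟨_, h2⟩
  exact continuous_snd.comp (continuous_induced_dom.comp h3)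

theorem continuous_sec_of_tot {X : Type*} [TopologicalSpace X] (hX : IsEuclideanRetract X)
    {F : X → Sec G p S A} (hF : Continuous fun z : X × B => (F z.1).tot z.2) : Continuous F := by
  obtain ⟨n, i, r, hir⟩ := hX
  have h1 : @Continuous _ _ _ (secCompactOpen G p S A) (F ∘ r) :=
    continuous_secCompactOpen_of_tot
      (hF.comp ((r.continuous.comp continuous_fst).prodMk continuous_snd))
  have h2 : Continuous (F ∘ r) := by
    refine continuous_iff_coinduced_le.2 ?_
    let f : @ContinuousMap (Fin n → ℝ) (Sec G p S A) _ (secCompactOpen G p S A) :=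
      @ContinuousMap.mk _ _ _ (secCompactOpen G p S A) (F ∘ r) h1
    exact le_iSup_of_le n (le_iSup_of_le f le_rfl)
  refine (h2.comp i.continuous).congr fun x => ?_
  exact congrArg F (hir x)

/-- Continuity of a map out of a space of sections can be checked on families parametrized by
cubes. -/
theorem continuous_of_cube_families {T : Type*} [TopologicalSpace T] {F : Sec G p S A → T}
    (h : ∀ (n : ℕ) (s : (Fin n → I) → Sec G p S A), Continuous s → Continuous fun z => F (s z)) :
    Continuous F := by
  refine continuous_iSup_dom.2 fun n => continuous_iSup_dom.2 fun f => ?_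
  refine continuous_coinduced_dom.2 ?_
  have hf : Continuous (fun x => f x) := by
    refine continuous_iff_coinduced_le.2 ?_
    exact le_iSup_of_le n (le_iSup_of_le f le_rfl)
  rw [continuous_iff_continuousAt]
  intro x₀
  -- a chart of `ℝⁿ` around `x₀` with values in the cube
  let c : (Fin n → I) → Fin n → ℝ := fun t k => x₀ k - 1 + 2 * t k
  let r : (Fin n → ℝ) → Fin n → I := fun x k => Set.projIcc 0 1 zero_le_one ((x k - x₀ k + 1) / 2)
  have hc : Continuous c := by fun_prop
  have hr : Continuous r := continuous_pi fun k => continuous_projIcc.comp (by fun_prop)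
  have hcr : ∀ᶠ x in 𝓝 x₀, c (r x) = x := by
    filter_upwards [Metric.ball_mem_nhds x₀ one_pos] with x hx
    funext k
    have h1 : |x k - x₀ k| < 1 := by
      have := (dist_le_pi_dist x x₀ k).trans_lt hx
      rwa [Real.dist_eq] at this
    rw [abs_lt] at h1
    simp only [c, r]
    rw [Set.projIcc_of_mem zero_le_one (show (x k - x₀ k + 1) / 2 ∈ Set.Icc (0 : ℝ) 1 from
      ⟨by linarith, by linarith⟩)]
    simp only
    ring
  have h1 := (h n (fun t => f (c t)) (hf.comp hc)).comp hr
  refine h1.continuousAt.congr ?_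
  filter_upwards [hcr] with x hx
  simp only [Function.comp_apply, hx]

/-- Continuity of a family of maps out of a space of sections can be checked on families of sections
parametrized by cubes. -/
theorem continuous_uncurry_of_cube_families {T : Type*} [TopologicalSpace T]
    (H : I → Sec G p S A → T)
    (h : ∀ (n : ℕ) (s : (Fin n → I) → Sec G p S A), Continuous s →
      Continuous fun z : I × (Fin n → I) => H z.1 (s z.2)) :
    Continuous fun z : I × Sec G p S A => H z.1 z.2 := by
  have hI : ∀ s, Continuous fun t => H t s := fun s =>
    (h 0 (fun _ => s) continuous_const).comp (continuous_id.prodMk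
      (continuous_const (y := fun k : Fin 0 => k.elim0)))
  have hc : Continuous (fun s => (⟨fun t => H t s, hI s⟩ : C(I, T))) := by
    refine continuous_of_cube_families fun n s hs => ?_
    exact ContinuousMap.continuous_of_continuous_uncurry _
      ((h n s hs).comp (continuous_snd.prodMk continuous_fst))
  have hu := ContinuousMap.continuous_uncurry_of_continuous ⟨_, hc⟩
  exact hu.comp (continuous_snd.prodMk continuous_fst)

/-- Homotopies of maps out of a space of sections can be checked on families parametrized by
cubes. -/
theorem homotopic_of_cube_families {T : Type*} [TopologicalSpace T] {f g : C(Sec G p S A, T)}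
    (H : I → Sec G p S A → T) (h0 : ∀ s, H 0 s = f s) (h1 : ∀ s, H 1 s = g s)
    (h : ∀ (n : ℕ) (s : (Fin n → I) → Sec G p S A), Continuous s →
      Continuous fun z : I × (Fin n → I) => H z.1 (s z.2)) :
    f.Homotopic g :=
  ⟨⟨⟨_, continuous_uncurry_of_cube_families H h⟩, h0, h1⟩⟩

/-- A loop over a closed fiber has a class that comes from that fiber. -/
theorem cls_mem_range_fibIncl {b : B} (hc : IsClosed {w | w ∈ S ∧ p w = b}) {m : ℕ}
    {f : (Fin m → I) → Smash (Plus W) (G.space m)} (h : IsLoop f)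
    (ho : ∀ t, Over {w | w ∈ S ∧ p w = b} (f t)) :
    cls G m f ∈ Set.range (redMap G (fibIncl p S b)) := by
  obtain ⟨f', hf', hff⟩ := exists_isLoop_lift hc h ho
  refine ⟨cls G m f', ?_⟩
  exact (redMap_cls (fibIncl p S b) hf').trans (congrArg (cls G m) (funext hff))

theorem Sec.over (s : Sec G p S A) {m : ℕ} {b : B}
    {f : (Fin m → I) → Smash (Plus W) (G.space m)} (h : IsLoop f) (hf : cls G m f = s.tot b)
    (t : Fin m → I) : Over {w | w ∈ S ∧ p w = b} (f t) :=
  over_of_mem_range h ⟨s.val b, hf.symm⟩ t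

/-- The value of a section under a map from its fiber, in terms of a representing loop. -/
theorem Sec.redMap_val {Q : Type*} [TopologicalSpace Q] [HasBase Q] (s : Sec G p S A) {b : B}
    (hc : IsClosed {w | w ∈ S ∧ p w = b}) {m : ℕ}
    {f : (Fin m → I) → Smash (Plus W) (G.space m)} (h : IsLoop f) (hf : cls G m f = s.tot b)
    (c : BasedMap (Plus (Fib p S b)) Q) (v : W → Q)
    (hv : ∀ w : Fib p S b, c.toMap (Sum.inl w) = v w.1) :
    redMap G c (s.val b) = cls G m (fun t => zmap v (f t)) := by
  obtain ⟨f', hf', hff⟩ := exists_isLoop_lift hc h (s.over h hf)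
  have h1 : s.val b = cls G m f' := by
    apply redMap_fibIncl_injective b
    refine hf.symm.trans ?_
    exact ((redMap_cls (fibIncl p S b) hf').trans (congrArg (cls G m) (funext hff))).symm
  rw [h1, redMap_cls c hf']
  congr 1
  funext t
  rw [← hff t, zmap_zmap]
  congr 1
  funext w
  exact hv w

/-- A continuous family of loops over the fibers is represented by a family of sections. -/
theorem exists_sec_of_loops (hc : ∀ b, IsClosed {w | w ∈ S ∧ p w = b}) {P : Type*}
    [TopologicalSpace P] {m : ℕ} {g : P × B → (Fin m → I) → Smash (Plus W) (G.space m)}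
    (hg : Continuous fun z : (P × B) × (Fin m → I) => g z.1 z.2)
    (hbd : ∀ z, ∀ t ∈ Cube.boundary (Fin m), g z t = pt _)
    (hA : ∀ x, ∀ b ∈ A, ∀ t, g (x, b) t = pt _)
    (ho : ∀ z t, Over {w | w ∈ S ∧ p w = z.2} (g z t)) :
    ∃ F : P → Sec G p S A, IsRep (fun z : P × B => (F z.1).tot z.2) m g := by
  have hl : ∀ z, IsLoop (g z) := fun z => ⟨hg.comp (continuous_const.prodMk continuous_id), hbd z⟩
  have hq : Continuous fun z => cls G m (g z) := continuous_cls hg hbd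
  refine ⟨fun x => Sec.ofTot (fun b => cls G m (g (x, b)))
    (hq.comp (continuous_const.prodMk continuous_id))
    (fun b => cls_mem_range_fibIncl (hc b) (hl _) (ho _)) (fun b hb => ?_), hg, hbd, fun z => ?_⟩
  · rw [← cls_pt m]
    exact congrArg (cls G m) (funext (hA x b hb))
  · exact (Sec.tot_ofTot (q := fun b => cls G m (g (z.1, b))) z.2).symm

end SecTopology

/-! ### Dilations of the cube -/

section Dilation

/-- The dilation of the cube with centre `a` and factors `S`, truncated to the cube. Precomposition
with it squeezes a loop into the box with sides `1 / S` around (a point near) `a`. Factors and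
centre are indexed by `ℕ`, so that they make sense at all stages. -/
def dil (S : ℕ → ℝ) (a : ℕ → I) {m : ℕ} (t : Fin m → I) : Fin m → I := fun i =>
  Set.projIcc 0 1 zero_le_one (a i + S i * (t i - a i))

variable {S S' : ℕ → ℝ} {a a' : ℕ → I} {m : ℕ}

theorem dil_one (h : ∀ i < m, S i = 1) (t : Fin m → I) : dil S a t = t := by
  funext i
  rw [dil, h i i.2]
  convert Set.projIcc_val zero_le_one (t i) using 2
  ring

theorem dil_apply_eq_zero {t : Fin m → I} {i : Fin m} (hS : 1 ≤ S i) (h : t i = 0) :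
    dil S a t i = 0 := by
  refine Set.projIcc_of_le_left zero_le_one ?_
  have h1 := (a i).2.1
  rw [h]
  simp only [Set.Icc.coe_zero]
  nlinarith

theorem dil_apply_eq_one {t : Fin m → I} {i : Fin m} (hS : 1 ≤ S i) (h : t i = 1) :
    dil S a t i = 1 := by
  refine Set.projIcc_of_right_le zero_le_one ?_
  have h1 := (a i).2.2
  rw [h]
  simp only [Set.Icc.coe_one]
  nlinarith

theorem dil_mem_boundary (hS : ∀ i, 1 ≤ S i) {t : Fin m → I} (ht : t ∈ Cube.boundary (Fin m)) :
    dil S a t ∈ Cube.boundary (Fin m) := by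
  obtain ⟨i, h | h⟩ := ht
  · exact ⟨i, Or.inl (dil_apply_eq_zero (hS i) h)⟩
  · exact ⟨i, Or.inr (dil_apply_eq_one (hS i) h)⟩

theorem dil_dil (hS : ∀ i, 1 ≤ S i) (t : Fin m → I) :
    dil S a (dil S' a t) = dil (fun i => S i * S' i) a t := by
  funext i
  simp only [dil]
  have h0 := (a i).2.1
  have h1 := (a i).2.2
  have hs := hS i
  generalize (a i : ℝ) = x at h0 h1
  generalize (t i : ℝ) = y
  rw [Set.coe_projIcc]
  rcases le_total (x + S' i * (y - x)) 0 with h | h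
  · rw [min_eq_right (h.trans zero_le_one), max_eq_left h, Set.projIcc_of_le_left,
      Set.projIcc_of_le_left]
    · nlinarith
    · nlinarith
  rcases le_total 1 (x + S' i * (y - x)) with h' | h'
  · rw [min_eq_left h', max_eq_right zero_le_one, Set.projIcc_of_right_le,
      Set.projIcc_of_right_le]
    · nlinarith
    · nlinarith
  · rw [min_eq_right h', max_eq_right h]
    congr 1
    ring

theorem lt_of_dil_notMem_boundary {t : Fin m → I} (h : dil S a t ∉ Cube.boundary (Fin m))
    (i : Fin m) : 0 < a i + S i * (t i - a i) ∧ (a i : ℝ) + S i * (t i - a i) < 1 := by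
  constructor
  · by_contra! hle
    exact h ⟨i, Or.inl (Set.projIcc_of_le_left zero_le_one hle)⟩
  · by_contra! hle
    exact h ⟨i, Or.inr (Set.projIcc_of_right_le zero_le_one hle)⟩

/-- The boxes of dilations with factor at least `4` and centres of distance at least `1 / 2` are
disjoint. -/
theorem dil_mem_boundary_or {t : Fin m → I} (i : Fin m) (hS : 4 ≤ S i)
    (hi : 1 / 2 ≤ |(a i : ℝ) - a' i|) :
    dil S a t ∈ Cube.boundary (Fin m) ∨ dil S a' t ∈ Cube.boundary (Fin m) := by
  by_contra! h
  obtain ⟨h1, h2⟩ := lt_of_dil_notMem_boundary h.1 i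
  obtain ⟨h3, h4⟩ := lt_of_dil_notMem_boundary h.2 i
  have h5 := (a i).2.1
  have h6 := (a i).2.2
  have h7 := (a' i).2.1
  have h8 := (a' i).2.2
  rcases le_abs'.1 hi with h | h <;> nlinarith

theorem continuous_dil {X : Type*} [TopologicalSpace X] {S : X → ℕ → ℝ} {a : X → ℕ → I}
    {t : X → Fin m → I} (hS : Continuous S) (ha : Continuous a) (ht : Continuous t) :
    Continuous fun x => dil (S x) (a x) (t x) := by
  refine continuous_pi fun i => continuous_projIcc.comp ?_
  fun_prop

theorem rstab_dil {G : Prespectrum.{u}} {Y : Type*} [TopologicalSpace Y] [HasBase Y]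
    (f : (Fin m → I) → Smash Y (G.space m)) (hS : S m = 1) (t : Fin (m + 1) → I) :
    rstab G f (dil S a t) = rstab G (fun t => f (dil S a t)) t := by
  have h : dil S a t (Fin.last m) = t (Fin.last m) := by
    simp only [dil, Fin.val_last, hS]
    convert Set.projIcc_val zero_le_one (t (Fin.last m)) using 2
    ring
  rw [rstab, h]
  rfl

end Dilation

/-! ### Extension by zero along a map -/

section FiberSum

variable {X Y Z Z' : Type*} [HasBase Z] [HasBase Z']

open Classical in
/-- The push-forward of a function `g` along `e`, for functions `g` with at most one value different
from the base point on each fiber of `e`. -/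
def fsum (e : X → Y) (g : X → Z) (y : Y) : Z :=
  if h : ∃ x, e x = y ∧ g x ≠ pt Z then g h.choose else pt Z

theorem fsum_cases (e : X → Y) (g : X → Z) (y : Y) :
    (fsum e g y = pt Z ∧ ∀ x, e x = y → g x = pt Z) ∨
      ∃ x, e x = y ∧ g x ≠ pt Z ∧ fsum e g y = g x := by
  by_cases h : ∃ x, e x = y ∧ g x ≠ pt Z
  · exact Or.inr ⟨h.choose, h.choose_spec.1, h.choose_spec.2, dif_pos h⟩
  · refine Or.inl ⟨dif_neg h, fun x hx => ?_⟩
    by_contra hg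
    exact h ⟨x, hx, hg⟩

theorem fsum_eq_pt {e : X → Y} {g : X → Z} {y : Y} (h : ∀ x, e x = y → g x = pt Z) :
    fsum e g y = pt Z := by
  rcases fsum_cases e g y with h' | ⟨x, hx, hg, _⟩
  · exact h'.1
  · exact absurd (h x hx) hg

theorem fsum_eq {e : X → Y} {g : X → Z} {y : Y} {x : X} (hx : e x = y)
    (h : ∀ x', e x' = y → g x' ≠ pt Z → g x' = g x) : fsum e g y = g x := by
  rcases fsum_cases e g y with h' | ⟨x', hx', hg, h'⟩
  · rw [h'.1, h'.2 x hx]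
  · rw [h', h x' hx' hg]

/-- `g` has at most one value different from the base point on each fiber of `e`. -/
def UniqueOver (e : X → Y) (g : X → Z) : Prop :=
  ∀ x x', e x = e x' → g x ≠ pt Z → g x' ≠ pt Z → g x = g x'

theorem UniqueOver.fsum_eq {e : X → Y} {g : X → Z} (h : UniqueOver e g) {x : X}
    (hg : g x ≠ pt Z) : fsum e g (e x) = g x :=
  StratHom.fsum_eq rfl fun x' hx' hg' => h x' x hx' hg' hg

theorem UniqueOver.map {e : X → Y} {g : X → Z} (h : UniqueOver e g) {φ : Z → Z'}
    (hφ : φ (pt Z) = pt Z') : UniqueOver e (fun x => φ (g x)) := by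
  intro x x' hx hg hg'
  change φ (g x) = φ (g x')
  rw [h x x' hx (fun h' => hg (by simp only [h', hφ])) (fun h' => hg' (by simp only [h', hφ]))]

theorem UniqueOver.fsum_map {e : X → Y} {g : X → Z} (h : UniqueOver e g) {φ : Z → Z'}
    (hφ : φ (pt Z) = pt Z') (y : Y) : fsum e (fun x => φ (g x)) y = φ (fsum e g y) := by
  rcases fsum_cases e g y with h' | ⟨x, rfl, hg, h'⟩
  · rw [h'.1, hφ]
    exact fsum_eq_pt fun x hx => by simp only [h'.2 x hx, hφ]
  · rw [h']
    refine StratHom.fsum_eq (g := fun x => φ (g x)) rfl fun x' hx' hg' => ?_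
    rw [h x' x hx' (fun h' => hg' (by simp only [h', hφ])) hg]

/-- Continuity of extension by zero in families: `V` is the part of `X` on which the maps `e τ` are
open, and the functions `g τ` vanish outside of it. -/
theorem continuous_fsum {T : Type*} [TopologicalSpace T] [CompactSpace T] [T2Space T]
    [TopologicalSpace X] [CompactSpace X] [TopologicalSpace Y] [T2Space Y] [TopologicalSpace Z]
    {e : T × X → Y} {g : T × X → Z} (he : Continuous e) (hg : Continuous g) (V : Set X)
    (hV : ∀ τ x, x ∉ V → g (τ, x) = pt Z)
    (hopen : ∀ U : Set X, IsOpen U → U ⊆ V → IsOpen {z : T × Y | ∃ x ∈ U, e (z.1, x) = z.2})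
    (hu : ∀ τ, UniqueOver (fun x => e (τ, x)) (fun x => g (τ, x))) :
    Continuous fun z : T × Y => fsum (fun x => e (z.1, x)) (fun x => g (z.1, x)) z.2 := by
  have htrack : Continuous (fun z : T × X => (z.1, e z)) := continuous_fst.prodMk he
  rw [continuous_def]
  intro O hO
  by_cases hpt : pt Z ∈ O
  · rw [← isClosed_compl_iff]
    convert htrack.isClosedMap _ (hO.isClosed_compl.preimage hg) using 1
    ext ⟨τ, y⟩
    constructor
    · intro h
      rcases fsum_cases (fun x => e (τ, x)) (fun x => g (τ, x)) y with h' | ⟨x, hx, hgx, h'⟩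
      · refine absurd ?_ h
        change fsum _ _ y ∈ O
        rw [h'.1]
        exact hpt
      · refine ⟨(τ, x), ?_, Prod.ext rfl hx⟩
        change g (τ, x) ∉ O
        rw [← h']
        exact h
    · rintro ⟨⟨τ', x⟩, hx, hxy⟩
      obtain ⟨rfl, rfl⟩ := Prod.mk.inj hxy
      have hgx : g (τ', x) ≠ pt Z := fun h => hx (by rw [h]; exact hpt)
      change fsum _ _ (e (τ', x)) ∉ O
      rw [(hu τ').fsum_eq hgx]
      exact hx
  · have h1 : IsOpen ((fun z : T × X => (z.1, e z)) '' (g ⁻¹' O)) := by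
      rw [isOpen_iff_mem_nhds]
      rintro _ ⟨⟨τ, x⟩, hx, rfl⟩
      obtain ⟨N, U, hN, hU, hτ, hxU, hNU⟩ := isOpen_prod_iff.1 (hO.preimage hg) τ x hx
      have hUV : U ⊆ V := by
        intro x' hx'
        by_contra hV'
        have : g (τ, x') ∈ O := hNU (show (τ, x') ∈ N ×ˢ U from ⟨hτ, hx'⟩)
        rw [hV τ x' hV'] at this
        exact hpt this
      refine Filter.mem_of_superset (((hopen U hU hUV).inter (hN.preimage continuous_fst)).mem_nhds
        ⟨⟨x, hxU, rfl⟩, hτ⟩) ?_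
      rintro ⟨τ', y'⟩ ⟨⟨x', hx', hxy'⟩, hτ'⟩
      exact ⟨(τ', x'), hNU ⟨hτ', hx'⟩, Prod.ext rfl hxy'⟩
    convert h1 using 1
    ext ⟨τ, y⟩
    constructor
    · intro h
      rcases fsum_cases (fun x => e (τ, x)) (fun x => g (τ, x)) y with h' | ⟨x, hx, hgx, h'⟩
      · refine absurd ?_ hpt
        rw [← h'.1]
        exact h
      · refine ⟨(τ, x), ?_, Prod.ext rfl hx⟩
        change g (τ, x) ∈ O
        rw [← h']
        exact h
    · rintro ⟨⟨τ', x⟩, hx, hxy⟩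
      obtain ⟨rfl, rfl⟩ := Prod.mk.inj hxy
      have hgx : g (τ', x) ≠ pt Z := fun h => hpt (by rw [← h]; exact hx)
      change fsum _ _ (e (τ', x)) ∈ O
      rw [(hu τ').fsum_eq hgx]
      exact hx

end FiberSum

/-! ### Separating functions -/

/-- Finitely many functions on a compact space separate the pairs in a closed relation that is
disjoint from the diagonal, by a uniform distance. -/
theorem exists_separating {X : Type*} [TopologicalSpace X] [CompactSpace X] [T2Space X]
    {R : Set (X × X)} (hR : IsClosed R) (hd : ∀ x, (x, x) ∉ R) :
    ∃ (k : ℕ) (j : X → ℕ → I), Continuous j ∧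
      ∀ x x', (x, x') ∈ R → ∃ i < k, 1 / 2 ≤ |(j x i : ℝ) - j x' i| := by
  have hsep : ∀ z : R, ∃ φ : C(X, ℝ), (∀ x, φ x ∈ Set.Icc (0 : ℝ) 1) ∧ φ z.1.1 = 0 ∧ φ z.1.2 = 1 := by
    rintro ⟨⟨x, x'⟩, hx⟩
    obtain ⟨φ, h0, h1, h2⟩ := exists_continuous_zero_one_of_isClosed (X := X)
      (isClosed_singleton (x := x)) (isClosed_singleton (x := x'))
      (by
        rw [Set.disjoint_singleton]
        rintro rfl
        exact hd x hx)
    exact ⟨φ, h2, h0 rfl, h1 rfl⟩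
  choose φ hφ h0 h1 using hsep
  obtain ⟨F, hF⟩ := hR.isCompact.elim_finite_subcover
    (fun z : R => {w : X × X | 1 / 2 < |φ z w.1 - φ z w.2|})
    (fun z => isOpen_lt continuous_const (by fun_prop))
    (fun z hz => Set.mem_iUnion.2 ⟨⟨z, hz⟩, by
      simp only [Set.mem_ofPred_eq, h0 ⟨z, hz⟩, h1 ⟨z, hz⟩]
      norm_num⟩)
  let en := F.equivFin
  let j : X → ℕ → I := fun x i =>
    if h : i < F.card then ⟨φ (en.symm ⟨i, h⟩).1 x, hφ _ x⟩ else 0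
  refine ⟨F.card, j, ?_, fun x x' hx => ?_⟩
  · refine continuous_pi fun i => ?_
    by_cases h : i < F.card
    · simp only [j, dif_pos h]
      exact (ContinuousMap.continuous _).subtype_mk _
    · simp only [j, dif_neg h]
      exact continuous_const
  · obtain ⟨z, hz, hzx⟩ := Set.mem_iUnion₂.1 (hF hx)
    refine ⟨en ⟨z, hz⟩, (en ⟨z, hz⟩).2, ?_⟩
    simp only [j, Fin.is_lt, dite_true, Fin.eta, Equiv.symm_apply_apply]
    exact le_of_lt hzx

/-! ### Codimension zero immersions -/

section LocalImmersion

variable {V : Type*} [NormedAddCommGroup V] [NormedSpace ℝ V] [FiniteDimensional ℝ V]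

/-- Near a point where its derivative is invertible, a `C¹` map on a convex set is uniformly close
to a linear isomorphism. -/
theorem exists_approximatesLinearOn {C : Set V} (hC : Convex ℝ C) (hCi : (interior C).Nonempty)
    {f : V → V} {x₀ : V} (hx₀ : x₀ ∈ C) (hf : ContDiffWithinAt ℝ 1 f C x₀)
    (hb : Function.Bijective (fderivWithin ℝ f C x₀)) :
    ∃ (A : V ≃L[ℝ] V) (c : NNReal) (r : ℝ), 0 < r ∧ (Subsingleton V ∨ c < ‖(A.symm : V →L[ℝ] V)‖₊⁻¹) ∧
      ApproximatesLinearOn f (A : V →L[ℝ] V) (C ∩ Metric.ball x₀ r) c := by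
  have : CompleteSpace V := FiniteDimensional.complete ℝ V
  obtain ⟨u, hu, -, -, f', hf', hcont⟩ :=
    (contDiffWithinAt_succ_iff_hasFDerivWithinAt' (n := 0) (by simp)).1
      (by simpa using hf)
  rw [Set.insert_eq_of_mem hx₀] at hu
  have hux₀ : x₀ ∈ u := mem_of_mem_nhdsWithin hx₀ hu
  have hfd : fderivWithin ℝ f C x₀ = f' x₀ :=
    (hf' x₀ hux₀).fderivWithin ((uniqueDiffOn_convex hC hCi) x₀ hx₀)
  rw [hfd] at hb
  let A : V ≃L[ℝ] V := ContinuousLinearEquiv.ofBijective (f' x₀)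
    (LinearMap.ker_eq_bot.2 hb.1) (LinearMap.range_eq_top.2 hb.2)
  have hA : (A : V →L[ℝ] V) = f' x₀ := ContinuousLinearEquiv.coe_ofBijective _ _ _
  obtain ⟨c, hc0, hc⟩ : ∃ c : NNReal, 0 < c ∧
      (Subsingleton V ∨ c < ‖(A.symm : V →L[ℝ] V)‖₊⁻¹) := by
    rcases A.subsingleton_or_nnnorm_symm_pos with h | h
    · exact ⟨1, one_pos, Or.inl h⟩
    · exact ⟨‖(A.symm : V →L[ℝ] V)‖₊⁻¹ / 2, by positivity, Or.inr (NNReal.half_lt_self (by positivity))⟩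
  have h1 : ∀ᶠ x in 𝓝[C] x₀, ‖f' x - f' x₀‖ ≤ c := by
    have h2 : Filter.Tendsto (fun x => ‖f' x - f' x₀‖) (𝓝[C] x₀) (𝓝 0) := by
      have := (hcont.continuousWithinAt.sub continuousWithinAt_const).norm (f := fun x => f' x - f' x₀)
      simpa [ContinuousWithinAt] using this
    filter_upwards [h2.eventually (gt_mem_nhds (show (0 : ℝ) < c from hc0))] with x hx
    exact hx.le
  obtain ⟨r, hr, hrs⟩ := Metric.mem_nhdsWithin_iff.1 (Filter.inter_mem hu h1)
  refine ⟨A, c, r, hr, hc, ?_⟩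
  rw [hA]
  rw [Set.inter_comm]
  intro x hx y hy
  exact ((convex_ball x₀ r).inter hC).norm_image_sub_le_of_norm_hasFDerivWithin_le'
    (fun z hz => (hf' z (hrs hz).1).mono Set.inter_subset_right) (fun z hz => (hrs hz).2) hy hx

/-- A local diffeomorphism between convex sets that preserves the boundary is open, also at boundary
points. Indeed, near the given point, the image of the interior is open, and closed in the interior
of the target, which is connected there by convexity. -/
theorem image_mem_nhdsWithin_of_approximatesLinearOn {C D : Set V} (hC : Convex ℝ C)
    (hCc : IsClosed C) (hCi : (interior C).Nonempty) (hD : Convex ℝ D) (hDi : (interior D).Nonempty)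
    {f : V → V} {x₀ : V} (hx₀ : x₀ ∈ C) {A : V ≃L[ℝ] V} {c : NNReal} {r : ℝ} (hr : 0 < r)
    (hc : Subsingleton V ∨ c < ‖(A.symm : V →L[ℝ] V)‖₊⁻¹)
    (hA : ApproximatesLinearOn f (A : V →L[ℝ] V) (C ∩ Metric.ball x₀ r) c)
    {N : Set V} (hN : N ∈ 𝓝[C] x₀) (hND : Set.MapsTo f N D)
    (hbd : ∀ x ∈ N, f x ∈ interior D → x ∈ interior C) :
    f '' N ∈ 𝓝[D] (f x₀) := by
  have : CompleteSpace V := FiniteDimensional.complete ℝ V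
  obtain ⟨r₁, hr₁, hrN⟩ := Metric.mem_nhdsWithin_iff.1 hN
  obtain ⟨ε, hε0, hεr, hεr₁⟩ : ∃ ε, 0 < ε ∧ ε < r ∧ ε < r₁ :=
    ⟨min r r₁ / 2, by positivity, by
      have := min_le_left r r₁; have := lt_min hr hr₁; linarith, by
      have := min_le_right r r₁; have := lt_min hr hr₁; linarith⟩
  let s := C ∩ Metric.closedBall x₀ ε
  have hsN : s ⊆ N := fun x hx => hrN ⟨Metric.closedBall_subset_ball hεr₁ hx.2, hx.1⟩
  have hss : s ⊆ C ∩ Metric.ball x₀ r :=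
    fun x hx => ⟨hx.1, Metric.closedBall_subset_ball hεr hx.2⟩
  have hAs := hA.mono_set hss
  have hanti := hAs.antilipschitz hc
  generalize (‖(A.symm : V →L[ℝ] V)‖₊⁻¹ - c)⁻¹ = K at hanti
  have hx₀s : x₀ ∈ s := ⟨hx₀, Metric.mem_closedBall_self hε0.le⟩
  have hdist : ∀ x ∈ s, dist x x₀ ≤ K * dist (f x) (f x₀) := fun x hx =>
    hanti.le_mul_dist ⟨x, hx⟩ ⟨x₀, hx₀s⟩
  let ρ : ℝ := ε / (K + 1)
  have hρ : 0 < ρ := by positivity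
  have hKρ : ∀ d : ℝ, d < ρ → K * d < ε := by
    intro d hd
    have hK : (0 : ℝ) ≤ K := K.2
    calc K * d ≤ K * ρ := by gcongr
      _ < (K + 1) * ρ := by nlinarith
      _ = ε := by simp only [ρ]; field_simp
  let O := f '' (interior C ∩ Metric.ball x₀ ε)
  have hsub : interior C ∩ Metric.ball x₀ ε ⊆ s := fun x hx =>
    ⟨interior_subset hx.1, Metric.ball_subset_closedBall hx.2⟩
  have hO : IsOpen O := (hAs.mono_set hsub).open_image A.toNonlinearRightInverse
    (isOpen_interior.inter Metric.isOpen_ball) hc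
  have hsc : IsCompact (f '' s) :=
    ((isCompact_closedBall x₀ ε).inter_left hCc).image_of_continuousOn hAs.continuousOn
  have hOD : O ⊆ interior D := by
    refine interior_maximal ?_ hO
    rintro _ ⟨x, hx, rfl⟩
    exact hND (hsN (hsub hx))
  have hOs : O ⊆ f '' s := Set.image_mono hsub
  have hcon : Metric.ball (f x₀) ρ ∩ interior D ⊆ O := by
    refine ((convex_ball (f x₀) ρ).inter hD.interior).isPreconnected.subset_of_closure_inter_subset
      hO ?_ ?_
    · have h1 : x₀ ∈ closure (interior C) := by
        rw [hC.closure_interior_eq_closure_of_nonempty_interior hCi]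
        exact subset_closure hx₀
      have h2 : Metric.ball x₀ ε ∩ f ⁻¹' Metric.ball (f x₀) ρ ∈ 𝓝[s] x₀ :=
        Filter.inter_mem (mem_nhdsWithin_of_mem_nhds (Metric.ball_mem_nhds x₀ hε0))
          ((hAs.continuousOn x₀ hx₀s) (Metric.ball_mem_nhds _ hρ))
      obtain ⟨r₂, hr₂, h3⟩ := Metric.mem_nhdsWithin_iff.1 h2
      obtain ⟨x, hx, hxd⟩ := Metric.mem_closure_iff.1 h1 (min ε r₂) (lt_min hε0 hr₂)
      rw [dist_comm] at hxd
      have hxε : x ∈ Metric.ball x₀ ε := hxd.trans_le (min_le_left _ _)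
      have hxO : f x ∈ O := ⟨x, ⟨hx, hxε⟩, rfl⟩
      exact ⟨f x, ⟨(h3 ⟨hxd.trans_le (min_le_right _ _), hsub ⟨hx, hxε⟩⟩).2, hOD hxO⟩, hxO⟩
    · rintro y ⟨hy, hyb, hyD⟩
      obtain ⟨x, hx, rfl⟩ := closure_minimal hOs hsc.isClosed hy
      exact ⟨x, ⟨hbd x (hsN hx) hyD, (hdist x hx).trans_lt (hKρ _ hyb)⟩, rfl⟩
  refine mem_nhdsWithin.2 ⟨Metric.ball (f x₀) ρ, Metric.isOpen_ball, Metric.mem_ball_self hρ, ?_⟩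
  rintro y ⟨hyb, hyD⟩
  have h1 : y ∈ closure (interior D) := by
    rw [hD.closure_interior_eq_closure_of_nonempty_interior hDi]
    exact subset_closure hyD
  have h2 : y ∈ closure (Metric.ball (f x₀) ρ ∩ interior D) :=
    Metric.isOpen_ball.inter_closure ⟨hyb, h1⟩
  exact Set.image_mono hsN (closure_minimal (hcon.trans hOs) hsc.isClosed h2)

end LocalImmersion

section Immersion

variable {q : ℕ} {HB HL : Type*} [TopologicalSpace HB] [TopologicalSpace HL]
  {IB : ModelWithCorners ℝ (EuclideanSpace ℝ (Fin q)) HB}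
  {IL : ModelWithCorners ℝ (EuclideanSpace ℝ (Fin q)) HL}
  {B L W E : Type*} [TopologicalSpace B] [TopologicalSpace L] [TopologicalSpace W]
  [TopologicalSpace E] [ChartedSpace HB B] [ChartedSpace HL L]
  {d0B d1B : Set B} {d0L d1L : Set L}
  {p : C(W, B)} {π : C(E, L)} {lam : C(L, B)} {lamT : C(E, W)}

theorem IsStratifiedEmbedding.exists_approximatesLinearOn
    (h : IsStratifiedEmbedding IB IL d0B d1B d1L p π lam lamT) (x : L) :
    ∃ (A : EuclideanSpace ℝ (Fin q) ≃L[ℝ] EuclideanSpace ℝ (Fin q)) (c : NNReal) (r : ℝ), 0 < r ∧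
      (Subsingleton (EuclideanSpace ℝ (Fin q)) ∨
        c < ‖(A.symm : EuclideanSpace ℝ (Fin q) →L[ℝ] EuclideanSpace ℝ (Fin q))‖₊⁻¹) ∧
      ApproximatesLinearOn (writtenInExtChartAt IL IB x lam)
        (A : EuclideanSpace ℝ (Fin q) →L[ℝ] EuclideanSpace ℝ (Fin q))
        (Set.range IL ∩ Metric.ball (extChartAt IL x x) r) c := by
  have hd : MDifferentiableAt IL IB lam x := h.contMDiff.mdifferentiable (by simp) x
  refine StratHom.exists_approximatesLinearOn IL.convex_range IL.nonempty_interior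
    (extChartAt_target_subset_range x (mem_extChartAt_target x)) ?_ ?_
  · exact ((contMDiffAt_iff.1 (h.contMDiff x)).2).of_le (by simp)
  · have := h.bijective_mfderiv x
    rwa [hd.mfderiv] at this

/-- A codimension zero immersion is locally injective. -/
theorem IsStratifiedEmbedding.exists_injOn
    (h : IsStratifiedEmbedding IB IL d0B d1B d1L p π lam lamT) (x : L) :
    ∃ U ∈ 𝓝 x, Set.InjOn lam U := by
  obtain ⟨A, c, r, hr, hc, hA⟩ := h.exists_approximatesLinearOn x
  have hsrc : (extChartAt IL x).source ∈ 𝓝 x := extChartAt_source_mem_nhds x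
  have hcont : ContinuousAt (extChartAt IL x) x := continuousAt_extChartAt x
  have h1 : ∀ᶠ y in 𝓝 x, extChartAt IL x y ∈ Set.range IL ∩ Metric.ball (extChartAt IL x x) r := by
    filter_upwards [hsrc, hcont.preimage_mem_nhds (Metric.ball_mem_nhds _ hr)] with y hy hy'
    exact ⟨extChartAt_target_subset_range x ((extChartAt IL x).map_source hy), hy'⟩
  refine ⟨_, Filter.inter_mem h1 hsrc, ?_⟩
  rintro y ⟨hy, hys⟩ y' ⟨hy', hys'⟩ hyy
  refine (extChartAt IL x).injOn hys hys' (hA.injOn hc hy hy' ?_)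
  simp only [writtenInExtChartAt, Function.comp_apply, (extChartAt IL x).left_inv hys,
    (extChartAt IL x).left_inv hys', hyy]

/-- Pairs of different points with the same image form a closed set. -/
theorem IsStratifiedEmbedding.isClosed_doublePoints [T2Space B]
    (h : IsStratifiedEmbedding IB IL d0B d1B d1L p π lam lamT) :
    IsClosed {z : L × L | lam z.1 = lam z.2 ∧ z.1 ≠ z.2} := by
  rw [← isOpen_compl_iff, isOpen_iff_mem_nhds]
  rintro ⟨x, x'⟩ hx
  by_cases hxx : lam x = lam x'
  · obtain rfl : x = x' := by
      by_contra hne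
      exact hx ⟨hxx, hne⟩
    obtain ⟨U, hU, hinj⟩ := h.exists_injOn x
    filter_upwards [prod_mem_nhds hU hU] with z hz hz'
    exact hz'.2 (hinj hz.1 hz.2 hz'.1)
  · have : IsOpen {z : L × L | lam z.1 ≠ lam z.2} := isOpen_ne_fun (by fun_prop) (by fun_prop)
    filter_upwards [this.mem_nhds hxx] with z hz hz'
    exact hz hz'.1

/-- A codimension zero immersion with `lam⁻¹ (∂₁B) = ∂₁L` whose image misses `∂₀B` is open away
from `∂₀L`. -/
theorem IsStratifiedEmbedding.isOpen_image [IsManifold IB ∞ B] [IsManifold IL ∞ L]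
    (h : IsStratifiedEmbedding IB IL d0B d1B d1L p π lam lamT)
    (hB : IsBoundaryDecomposition IB d0B d1B) (hL : IsBoundaryDecomposition IL d0L d1L)
    {U : Set L} (hU : IsOpen U) (hUd : U ⊆ d0Lᶜ) : IsOpen (lam '' U) := by
  have hbdry : ∀ y ∈ U, IB.IsInteriorPoint (lam y) → IL.IsInteriorPoint y := by
    intro y hy hint
    rw [IL.isInteriorPoint_iff_not_isBoundaryPoint]
    intro hy'
    have hy1 : y ∈ d1L := by
      have : y ∈ d0L ∪ d1L := by rw [hL.union_eq]; exact hy'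
      exact this.resolve_left (hUd hy)
    rw [← h.preimage_eq] at hy1
    rw [IB.isInteriorPoint_iff_not_isBoundaryPoint] at hint
    apply hint
    have : lam y ∈ d0B ∪ d1B := Or.inr hy1
    rwa [hB.union_eq] at this
  rw [isOpen_iff_mem_nhds]
  rintro _ ⟨x, hx, rfl⟩
  obtain ⟨A, c, r, hr, hc, hA⟩ := h.exists_approximatesLinearOn x
  let φ := extChartAt IL x
  let ψ := extChartAt IB (lam x)
  let f := writtenInExtChartAt IL IB x lam
  have hψ : ψ.source ∈ 𝓝 (lam x) := extChartAt_source_mem_nhds (lam x)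
  have hmap : Filter.map ψ (𝓝 (lam x)) = 𝓝[Set.range IB] (ψ (lam x)) := map_extChartAt_nhds (lam x)
  let U' := U ∩ lam ⁻¹' ψ.source
  have hU' : U' ∈ 𝓝 x := Filter.inter_mem (hU.mem_nhds hx)
    (lam.continuous.continuousAt.preimage_mem_nhds hψ)
  let N := φ.target ∩ φ.symm ⁻¹' U'
  have hN : N ∈ 𝓝[Set.range IL] (φ x) := by
    refine Filter.inter_mem (extChartAt_target_mem_nhdsWithin x) ?_
    refine mem_nhdsWithin_of_mem_nhds ((continuousAt_extChartAt_symm x).preimage_mem_nhds ?_)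
    rwa [extChartAt_to_inv x]
  have hfN : ∀ u ∈ N, f u = ψ (lam (φ.symm u)) := fun u _ => rfl
  have key : f '' N ∈ 𝓝[Set.range IB] (f (φ x)) := by
    refine image_mem_nhdsWithin_of_approximatesLinearOn IL.convex_range IL.isClosed_range
      IL.nonempty_interior IB.convex_range IB.nonempty_interior
      (extChartAt_target_subset_range x (mem_extChartAt_target x)) hr hc hA hN ?_ ?_
    · intro u hu
      exact extChartAt_target_subset_range (lam x) (ψ.map_source hu.2.2)
    · intro u hu hint
      have h1 : IB.IsInteriorPoint (lam (φ.symm u)) := by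
        rw [IB.isInteriorPoint_iff_of_mem_atlas (n := ∞) (by simp) (chart_mem_atlas HB (lam x))
          (by simpa [ψ] using hu.2.2)]
        exact OpenPartialHomeomorph.mem_interior_extend_target _
          (by simpa using ((chartAt HB (lam x)).map_source (by simpa [ψ] using hu.2.2))) hint
      have h2 := hbdry _ hu.2.1 h1
      rw [IL.isInteriorPoint_iff_of_mem_atlas (n := ∞) (by simp) (chart_mem_atlas HL x)
          (by simpa [φ] using φ.map_target hu.1)] at h2
      have h3 : ((chartAt HL x).extend IL) (φ.symm u) = u := φ.right_inv hu.1
      rw [h3] at h2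
      exact interior_mono (extChartAt_target_subset_range x) h2
  have hfx : f (φ x) = ψ (lam x) := by
    change ψ (lam (φ.symm (φ x))) = _
    rw [extChartAt_to_inv x]
  rw [hfx, ← hmap, Filter.mem_map] at key
  filter_upwards [key, hψ] with b hb hbs
  obtain ⟨u, hu, hub⟩ := hb
  refine ⟨φ.symm u, hu.2.1, ψ.injOn hu.2.2 hbs hub⟩

end Immersion

/-! ### Compactness of disk bundles -/

section DiskCompact

theorem compactSpace_disk {B W V : Type*} [TopologicalSpace B] [TopologicalSpace W]
    [CompactSpace W] [NormedAddCommGroup V] [NormedSpace ℝ V] [ProperSpace V] {p : C(W, B)}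
    {ν : B → Submodule ℝ V} (hν : IsClosed {z : B × V | z.2 ∈ ν z.1}) (δ : ℝ) :
    CompactSpace (Disk p ν δ) := by
  refine isCompact_iff_compactSpace.1 ?_
  have : IsCompact ((Set.univ : Set W) ×ˢ Metric.closedBall (0 : V) δ) :=
    isCompact_univ.prod (isCompact_closedBall 0 δ)
  refine this.of_isClosed_subset ?_ ?_
  · have h1 : Continuous fun x : W × V => (p x.1, x.2) := by fun_prop
    have h2 : IsClosed {x : W × V | ‖x.2‖ ≤ δ} := isClosed_le (by fun_prop) continuous_const
    exact (hν.preimage h1).inter h2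
  · intro x hx
    exact ⟨trivial, by simpa using hx.2⟩

/-- The normal bundle is closed, since the differential of `i` in tangent coordinates depends
continuously on the point. -/
theorem isClosed_normalBundle {q N : ℕ} {HB : Type*} [TopologicalSpace HB]
    (IB : ModelWithCorners ℝ (EuclideanSpace ℝ (Fin q)) HB)
    {B : Type*} [TopologicalSpace B] [ChartedSpace HB B] [IsManifold IB ∞ B]
    {i : B → EuclideanSpace ℝ (Fin N)} (hi : IsSmoothEmbedding IB i) :
    IsClosed {z : B × EuclideanSpace ℝ (Fin N) | z.2 ∈ normalBundle IB i z.1} := by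
  have : IsManifold IB 1 B := IsManifold.of_le (n := ∞) (by simp)
  rw [← isOpen_compl_iff, isOpen_iff_mem_nhds]
  rintro ⟨b, v⟩ hz
  have hz' : ¬ ∀ y, inner ℝ (differential IB i b y) v = 0 := by
    intro h
    apply hz
    refine (Submodule.mem_orthogonal _ _).2 ?_
    rintro _ ⟨y, rfl⟩
    exact h y
  push Not at hz'
  obtain ⟨y, hy⟩ := hz'
  have hc : ContinuousAt (inTangentCoordinates IB 𝓘(ℝ, EuclideanSpace ℝ (Fin N)) id i
      (differential IB i) b) b :=
    (ContMDiffAt.mfderiv_const (hi.contMDiff b) (m := 0) (by simp)).continuousAt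
  have hcoord : ∀ b' ∈ (chartAt HB b).source,
      inTangentCoordinates IB 𝓘(ℝ, EuclideanSpace ℝ (Fin N)) id i
        (differential IB i) b b' =
      (differential IB i b').comp
        ((tangentBundleCore IB B).coordChange (achart HB b) (achart HB b') b') := by
    intro b' hb'
    refine (inTangentCoordinates_eq id i (differential IB i) hb' (Set.mem_univ _)).trans ?_
    simp only [tangentBundleCore_coordChange_model_space, ContinuousLinearMap.id_comp, id]
  have hself : inTangentCoordinates IB 𝓘(ℝ, EuclideanSpace ℝ (Fin N)) id i
      (differential IB i) b b y = differential IB i b y := by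
    rw [hcoord b (mem_chart_source HB b), ContinuousLinearMap.comp_apply,
      (tangentBundleCore IB B).coordChange_self _ _ (by simp)]
  have hcont : ContinuousAt (fun z : B × EuclideanSpace ℝ (Fin N) =>
      inner ℝ (inTangentCoordinates IB 𝓘(ℝ, EuclideanSpace ℝ (Fin N)) id i
        (differential IB i) b z.1 y) z.2) (b, v) := by
    refine ContinuousAt.inner ?_ continuousAt_snd
    refine ContinuousAt.clm_apply ?_ continuousAt_const
    exact ContinuousAt.comp (x := (b, v)) (f := Prod.fst) hc continuousAt_fst
  have hne := hcont.eventually_ne (y := 0) (by simpa only [hself] using hy)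
  have hsrc : ∀ᶠ z : B × EuclideanSpace ℝ (Fin N) in 𝓝 (b, v), z.1 ∈ (chartAt HB b).source :=
    continuousAt_fst.eventually (chart_source_mem_nhds HB b)
  filter_upwards [hne, hsrc] with z hz1 hz2 hz3
  apply hz1
  rw [hcoord z.1 hz2, ContinuousLinearMap.comp_apply]
  exact (Submodule.mem_orthogonal _ _).1 hz3 _ ⟨_, rfl⟩

end DiskCompact

/-! ### Restriction and inclusion of sections -/

section BasedMaps

variable {G : Prespectrum.{u}} {X Y Z : Type*} [TopologicalSpace X] [TopologicalSpace Y]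
  [TopologicalSpace Z] [HasBase X] [HasBase Y] [HasBase Z]

/-- Composition of based maps. -/
def BasedMap.comp (c' : BasedMap Y Z) (c : BasedMap X Y) : BasedMap X Z where
  toMap := c'.toMap.comp c.toMap
  map_pt := by
    rw [ContinuousMap.comp_apply, c.map_pt, c'.map_pt]

theorem redMap_redMap (c' : BasedMap Y Z) (c : BasedMap X Y) (y : RedHom G X) :
    redMap G c' (redMap G c y) = redMap G (c'.comp c) y := by
  obtain ⟨m, hm⟩ := exists_cls y
  obtain ⟨f, hf, rfl⟩ := hm m le_rfl
  rw [redMap_cls' c hf, redMap_cls' (c'.comp c) hf, redMap_cls']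
  · congr 1
    funext t
    obtain ⟨⟨a, g⟩, h⟩ := Smash.isQuotientMap_mk.surjective (f t)
    rw [← h]
    rfl
  · exact Stage.isLoop (stageMap G c (hf.toStage G))

theorem redMap_eq_pt_of_forall {V : Type*} [TopologicalSpace V] (c : BasedMap (Plus V) Z)
    (h : ∀ v, c.toMap (Sum.inl v) = pt Z) (y : RedHom G (Plus V)) : redMap G c y = pt _ := by
  obtain ⟨m, hm⟩ := exists_cls y
  obtain ⟨f, hf, rfl⟩ := hm m le_rfl
  rw [redMap_cls c hf, ← cls_pt m]
  congr 1
  funext t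
  exact zmap_eq_pt_of_forall h _

theorem eq_pt_of_isEmpty {V : Type*} [TopologicalSpace V] [IsEmpty V] (y : RedHom G (Plus V)) :
    y = pt _ := by
  obtain ⟨m, hm⟩ := exists_cls y
  obtain ⟨f, hf, rfl⟩ := hm m le_rfl
  rw [← cls_pt m]
  congr 1
  funext t
  rcases el_cases (f t) with h | ⟨w, -⟩
  · exact h
  · exact isEmptyElim w

end BasedMaps

section Immersed

variable {B L W E : Type*} [TopologicalSpace B] [TopologicalSpace L] [TopologicalSpace W]
  [TopologicalSpace E]

/-- The topological properties of a stratified embedding on which the constructions depend: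
`lam` is locally injective (different points with the same image form a closed set) and open away
from `d0L`, and it is covered by an embedding `lamT`. -/
structure IsOpenImmersion (d0L : Set L) (p : C(W, B)) (π : C(E, L)) (lam : C(L, B))
    (lamT : C(E, W)) : Prop where
  isClosed_doublePoints : IsClosed {z : L × L | lam z.1 = lam z.2 ∧ z.1 ≠ z.2}
  isOpen_image : ∀ U : Set L, IsOpen U → U ⊆ d0Lᶜ → IsOpen (lam '' U)
  isEmbedding : IsEmbedding lamT
  comm : ∀ e, p (lamT e) = lam (π e)

open Classical in
/-- The map `W → (E_x)₊ ⊆ E₊` that is inverse to `lamT` on `lamT (E_x)` and sends the other points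
to the base point. -/
def fibProj (π : C(E, L)) (lamT : C(E, W)) (x : L) (w : W) : Plus E :=
  if hw : ∃ e, π e = x ∧ lamT e = w then Sum.inl hw.choose else Sum.inr ()

variable {d0L : Set L} {p : C(W, B)} {π : C(E, L)} {lam : C(L, B)} {lamT : C(E, W)}

theorem fibProj_lamT (hT : Function.Injective lamT) (x : L) (e : E) (he : π e = x) :
    fibProj π lamT x (lamT e) = Sum.inl e := by
  have hw : ∃ e', π e' = x ∧ lamT e' = lamT e := ⟨e, he, rfl⟩
  rw [fibProj, dif_pos hw, hT hw.choose_spec.2]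

theorem fibProj_of_ne {x : L} {w : W} (h : ∀ e, π e = x → lamT e ≠ w) :
    fibProj π lamT x w = pt (Plus E) :=
  dif_neg fun ⟨e, h1, h2⟩ => h e h1 h2

namespace IsOpenImmersion

/-- The fibers of `E^δ` are closed, since the fibers of `lam` are discrete. -/
theorem isClosed_fib [CompactSpace E] [T2Space W] [T1Space B]
    (h : IsOpenImmersion d0L p π lam lamT) (b : B) :
    IsClosed {w | w ∈ stratSub d0L π lamT ∧ p w = b} := by
  have h1 : IsClosed {x : L | lam x = b ∧ x ∉ d0L} := by
    rw [← isOpen_compl_iff, isOpen_iff_mem_nhds]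
    intro x hx
    by_cases hxb : lam x = b
    · have hnd := h.isClosed_doublePoints.isOpen_compl.mem_nhds
        (show (x, x) ∉ {z : L × L | lam z.1 = lam z.2 ∧ z.1 ≠ z.2} from fun hz => hz.2 rfl)
      rw [nhds_prod_eq, Filter.mem_prod_self_iff] at hnd
      obtain ⟨U, hU, hUU⟩ := hnd
      filter_upwards [hU] with y hy hyb
      have hyx : y = x := by
        by_contra hne
        exact hUU (show (y, x) ∈ U ×ˢ U from ⟨hy, mem_of_mem_nhds hU⟩)
          ⟨hyb.1.trans hxb.symm, hne⟩
      rw [hyx] at hyb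
      exact hx hyb
    · filter_upwards [(isClosed_singleton (x := b)).isOpen_compl.preimage lam.continuous |>.mem_nhds
        hxb] with y hy hyb
      exact hy hyb.1
  have h2 : {w | w ∈ stratSub d0L π lamT ∧ p w = b} = lamT '' (π ⁻¹' {x | lam x = b ∧ x ∉ d0L}) := by
    ext w
    constructor
    · rintro ⟨⟨e, he, rfl⟩, hb⟩
      exact ⟨e, ⟨by rw [← h.comm, hb], he⟩, rfl⟩
    · rintro ⟨e, ⟨he1, he2⟩, rfl⟩
      exact ⟨⟨e, he2, rfl⟩, by rw [h.comm, he1]⟩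
  rw [h2]
  exact ((h1.preimage π.continuous).isCompact.image lamT.continuous).isClosed

theorem continuousOn_fibProj [T2Space L] (h : IsOpenImmersion d0L p π lam lamT) :
    ContinuousOn (fun z : L × W => fibProj π lamT z.1 z.2)
      {z | z.2 ∈ Set.range lamT ∧ p z.2 = lam z.1} := by
  classical
  rw [continuousOn_iff_continuous_domRestrict]
  let M : Set (L × W) := {z | z.2 ∈ Set.range lamT ∧ p z.2 = lam z.1}
  let g : M → E := fun z => h.isEmbedding.toHomeomorph.symm ⟨z.1.2, z.2.1⟩
  have hg : Continuous g := h.isEmbedding.toHomeomorph.symm.continuous.comp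
    ((continuous_snd.comp continuous_subtype_val).subtype_mk _)
  have hgw : ∀ z : M, lamT (g z) = z.1.2 := fun z => congrArg Subtype.val
    (h.isEmbedding.toHomeomorph.apply_symm_apply ⟨z.1.2, z.2.1⟩)
  have hpair : Continuous fun z : M => (z.1.1, π (g z)) :=
    (continuous_fst.comp continuous_subtype_val).prodMk (π.continuous.comp hg)
  have hclopen : IsClopen {z : M | z.1.1 = π (g z)} := by
    refine ⟨isClosed_eq (continuous_fst.comp continuous_subtype_val) (π.continuous.comp hg), ?_⟩
    convert (h.isClosed_doublePoints.preimage hpair).isOpen_compl using 1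
    ext z
    have : lam z.1.1 = lam (π (g z)) := by rw [← h.comm, hgw, z.2.2]
    simp [this]
  have hcont : Continuous fun z : M => if z.1.1 = π (g z) then (Sum.inl (g z) : Plus E)
      else Sum.inr () := by
    refine Continuous.if ?_ (continuous_inl.comp hg) continuous_const
    intro z hz
    rw [hclopen.frontier_eq] at hz
    exact hz.elim
  refine hcont.congr fun z => ?_
  change _ = fibProj π lamT z.1.1 z.1.2
  split_ifs with hz
  · rw [← hgw z, fibProj_lamT h.isEmbedding.injective _ _ hz.symm]
  · refine (fibProj_of_ne fun e he hew => hz ?_).symm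
    rw [← he, h.isEmbedding.injective (hew.trans (hgw z).symm)]

theorem isClosed_range_prod [CompactSpace E] [T2Space W] [T2Space B]
    (_h : IsOpenImmersion d0L p π lam lamT) :
    IsClosed {z : L × W | z.2 ∈ Set.range lamT ∧ p z.2 = lam z.1} := by
  have h1 : IsClosed (Set.range lamT) := (isCompact_range lamT.continuous).isClosed
  exact (h1.preimage continuous_snd).inter (isClosed_eq (by fun_prop) (by fun_prop))

/-- Continuity of the projection to the sheet of `x`. -/
theorem continuous_zmap_fibProj {Γ : Type*} [TopologicalSpace Γ] [HasBase Γ] [T1Space Γ]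
    [CompactSpace E] [T2Space W] [T2Space B] [T2Space L] [LocallyCompactSpace L]
    (h : IsOpenImmersion d0L p π lam lamT) {X : Type*} [TopologicalSpace X] {x : X → L}
    (hx : Continuous x) {ζ : X → Smash (Plus W) Γ} (hζ : Continuous ζ)
    (ho : ∀ a, Over {w | w ∈ stratSub d0L π lamT ∧ p w = lam (x a)} (ζ a)) :
    Continuous fun a => zmap (fibProj π lamT (x a)) (ζ a) := by
  refine continuous_zmap_fiberwise h.isClosed_range_prod h.continuousOn_fibProj hx hζ fun a => ?_
  refine (ho a).mono ?_
  rintro w ⟨⟨e, -, rfl⟩, hw⟩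
  exact ⟨⟨e, rfl⟩, hw⟩

theorem zmap_fibProj_eq_pt {Γ : Type*} [HasBase Γ] (h : IsOpenImmersion d0L p π lam lamT)
    {x : L} (hx : x ∈ d0L) {b : B} {ζ : Smash (Plus W) Γ}
    (ho : Over {w | w ∈ stratSub d0L π lamT ∧ p w = b} ζ) :
    zmap (fibProj π lamT x) ζ = pt _ := by
  rcases el_cases ζ with rfl | ⟨w, g, hg, rfl⟩
  · exact zmap_pt _
  · obtain ⟨⟨e, he, rfl⟩, -⟩ := ho w g hg rfl
    rw [zmap_el, fibProj_of_ne]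
    · exact Smash.mk_eq_pt (Or.inl rfl)
    · intro e' he' hee
      rw [h.isEmbedding.injective hee] at he'
      exact he (he' ▸ hx)

theorem over_zmap_fibProj {Γ : Type*} [HasBase Γ] (x : L) (ζ : Smash (Plus W) Γ) :
    Over {e : E | e ∈ Set.univ ∧ π e = x} (zmap (fibProj π lamT x) ζ) := by
  rcases el_cases ζ with rfl | ⟨w, g, hg, rfl⟩
  · rw [zmap_pt]; exact over_pt _
  · rw [zmap_el]
    by_cases hw : ∃ e, π e = x ∧ lamT e = w
    · rw [fibProj, dif_pos hw]
      exact over_el (A := {e : E | e ∈ Set.univ ∧ π e = x}) (w := hw.choose)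
        ⟨trivial, hw.choose_spec.1⟩ g
    · rw [fibProj, dif_neg hw]
      exact (show Smash.mk ((Sum.inr () : Plus E), g) = pt _ from Smash.mk_eq_pt (Or.inl rfl)) ▸
        over_pt _

end IsOpenImmersion

section Rho

variable {G : Prespectrum.{u}} [CompactSpace L] [T2Space L] [CompactSpace E] [T2Space B]
  [CompactSpace B] [CompactSpace W] [T2Space W]
  (c : ∀ x, BasedMap (Plus (Fib p (stratSub d0L π lamT) (lam x))) (Plus (Fib π Set.univ x)))
  (hc : ∀ x w, (fibIncl π Set.univ x).toMap ((c x).toMap (Sum.inl w)) = fibProj π lamT x w.1)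

omit [CompactSpace L] [T2Space L] [CompactSpace B] [CompactSpace W] in
include hc in
theorem redMap_rho (h : IsOpenImmersion d0L p π lam lamT)
    (s : Sec G p (stratSub d0L π lamT) ∅) (x : L) {m : ℕ}
    {f : (Fin m → I) → Smash (Plus W) (G.space m)} (hf : IsLoop f) (hs : cls G m f = s.tot (lam x)) :
    redMap G (fibIncl π Set.univ x) (redMap G (c x) (s.val (lam x))) =
      cls G m (fun t => zmap (fibProj π lamT x) (f t)) := by
  rw [redMap_redMap]
  exact s.redMap_val (h.isClosed_fib (lam x)) hf hs _ _ (hc x)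

omit [CompactSpace B] [CompactSpace W] in
include hc in
theorem isRep_rho (h : IsOpenImmersion d0L p π lam lamT) {K : Type*} [TopologicalSpace K]
    {x : K → L} (hx : Continuous x) {s : K → Sec G p (stratSub d0L π lamT) ∅} {m : ℕ}
    {f : K → (Fin m → I) → Smash (Plus W) (G.space m)}
    (hf : IsRep (fun k => (s k).tot (lam (x k))) m f) :
    IsRep (fun k => redMap G (fibIncl π Set.univ (x k))
      (redMap G (c (x k)) ((s k).val (lam (x k))))) m
      (fun k t => zmap (fibProj π lamT (x k)) (f k t)) where
  cont := h.continuous_zmap_fibProj (hx.comp continuous_fst) hf.cont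
    fun z => (s z.1).over (hf.isLoop z.1) (hf.cls z.1) z.2
  bdry k t ht := by
    rw [hf.bdry k t ht, zmap_pt]
  cls k := (redMap_rho c hc h (s k) (x k) (hf.isLoop k) (hf.cls k)).symm

/-- The restriction of sections along `lam`: `ρ s x = pr_x (s (lam x))`. -/
def rho (h : IsOpenImmersion d0L p π lam lamT) (s : Sec G p (stratSub d0L π lamT) ∅) :
    Sec G π Set.univ d0L where
  val x := redMap G (c x) (s.val (lam x))
  continuous_val := by
    obtain ⟨m, hm⟩ := exists_isRep s.continuous_tot
    obtain ⟨f, hf⟩ := hm m le_rfl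
    have := (isRep_rho c hc h (K := L) continuous_id (s := fun _ => s)
      (hf.comp lam.continuous)).continuous
    exact continuous_induced_rng.2 (continuous_id.prodMk this)
  eq_pt x hx := by
    refine redMap_eq_pt_of_forall (c x) (fun w => ?_) _
    have h1 := hc x w
    rw [fibProj_of_ne] at h1
    · rcases hcw : (c x).toMap (Sum.inl w) with e | e
      · rw [hcw] at h1
        exact absurd h1 Sum.inl_ne_inr
      · rfl
    · intro e he hew
      obtain ⟨e', he', hew'⟩ := w.2.1
      have hee : e' = e := h.isEmbedding.injective (hew'.trans hew.symm)
      subst hee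
      subst he
      exact he' hx

theorem isRep_rho_family (h : IsOpenImmersion d0L p π lam lamT) {P : Type*} [TopologicalSpace P]
    {s : P → Sec G p (stratSub d0L π lamT) ∅} {m : ℕ}
    {f : P × B → (Fin m → I) → Smash (Plus W) (G.space m)}
    (hf : IsRep (fun z : P × B => (s z.1).tot z.2) m f) :
    IsRep (fun z : P × L => (rho c hc h (s z.1)).tot z.2) m
      (fun z t => zmap (fibProj π lamT z.2) (f (z.1, lam z.2) t)) :=
  isRep_rho c hc h (K := P × L) (s := fun z => s z.1) continuous_snd
    (hf.comp (g := fun z : P × L => (z.1, lam z.2)) (by fun_prop))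

theorem continuous_rho (h : IsOpenImmersion d0L p π lam lamT) :
    Continuous (rho (G := G) c hc h) := by
  refine continuous_of_cube_families fun n s hs => ?_
  obtain ⟨m, hm⟩ := exists_isRep (continuous_tot_family hs)
  obtain ⟨f, hf⟩ := hm m le_rfl
  exact continuous_sec_of_tot (isEuclideanRetract_cube n) (isRep_rho_family c hc h hf).continuous

end Rho

section Iota

variable {G : Prespectrum.{u}} {S : Set W}

theorem redMap_fibInclUniv (b : B) (y : RedHom G (Plus (Fib p S b))) :
    redMap G (fibIncl p Set.univ b) (redMap G (fibInclUniv p S b) y) = redMap G (fibIncl p S b) y := by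
  rw [redMap_redMap]
  congr 1
  have : ((fibIncl p Set.univ b).comp (fibInclUniv p S b)).toMap = (fibIncl p S b).toMap := by
    ext a
    rcases a with a | a <;> rfl
  cases hcc : (fibIncl p Set.univ b).comp (fibInclUniv p S b)
  cases hcd : fibIncl p S b
  rw [hcc, hcd] at this
  subst this
  rfl

/-- The map of sections induced by the inclusion of a subset `S` that does not meet the part of `W`
over `A`. -/
def iota {A : Set B} (hA : ∀ w ∈ S, p w ∉ A) (s : Sec G p S ∅) : Sec G p Set.univ A where
  val b := redMap G (fibInclUniv p S b) (s.val b)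
  continuous_val := by
    refine continuous_induced_rng.2 (continuous_id.prodMk (s.continuous_tot.congr fun b => ?_))
    exact (redMap_fibInclUniv b (s.val b)).symm
  eq_pt b hb := by
    have : IsEmpty (Fib p S b) := ⟨fun w => hA w.1 w.2.1 (w.2.2.symm ▸ hb)⟩
    rw [eq_pt_of_isEmpty (s.val b), redMap_pt]

theorem iota_tot {A : Set B} (hA : ∀ w ∈ S, p w ∉ A) (s : Sec G p S ∅) (b : B) :
    (iota hA s).tot b = s.tot b := redMap_fibInclUniv b (s.val b)

theorem continuous_iota [LocallyCompactSpace B] {A : Set B} (hA : ∀ w ∈ S, p w ∉ A) :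
    Continuous (iota (G := G) (p := p) hA) := by
  refine continuous_of_cube_families fun n s hs => ?_
  refine continuous_sec_of_tot (isEuclideanRetract_cube n) ((continuous_tot_family hs).congr ?_)
  exact fun z => (iota_tot hA (s z.1) z.2).symm

end Iota

end Immersed

/-! ### Sums over the sheets of an immersion -/

section Sheets

theorem Over.zmap_inl {W V Γ : Type*} [HasBase Γ] {A : Set W} {v : W → V}
    {ζ : Smash (Plus W) Γ} (hζ : Over A ζ) :
    Over (v '' A) (zmap (fun w => (Sum.inl (v w) : Plus V)) ζ) := by
  rcases el_cases ζ with rfl | ⟨w, g, hg, rfl⟩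
  · rw [zmap_pt]; exact over_pt _
  · exact over_el (A := v '' A) (w := v w) ⟨w, hζ w g hg rfl, rfl⟩ g

variable {B L W E : Type*} [TopologicalSpace B] [TopologicalSpace L] [TopologicalSpace W]
  [TopologicalSpace E] {d0L : Set L} {p : C(W, B)} {π : C(E, L)} {lam : C(L, B)} {lamT : C(E, W)}

theorem zmap_fibProj_of_over {Γ : Type*} [HasBase Γ] (hT : Function.Injective lamT) {x x' : L}
    (hx : x ≠ x') {ζ : Smash (Plus W) Γ} (hζ : Over (lamT '' {e | π e = x'}) ζ) :
    zmap (fibProj π lamT x) ζ = pt _ := by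
  rcases el_cases ζ with rfl | ⟨w, g, hg, rfl⟩
  · exact zmap_pt _
  · obtain ⟨e, he, rfl⟩ := hζ w g hg rfl
    rw [zmap_el, fibProj_of_ne]
    · exact Smash.mk_eq_pt (Or.inl rfl)
    · intro e' he' hee
      rw [hT hee] at he'
      exact hx (he'.symm.trans he)

theorem zmap_fibProj_zmap_lamT {Γ : Type*} [HasBase Γ] (hT : Function.Injective lamT) {x : L}
    {ζ : Smash (Plus E) Γ} (hζ : Over {e | π e = x} ζ) :
    zmap (fibProj π lamT x) (zmap (fun e => (Sum.inl (lamT e) : Plus W)) ζ) = ζ := by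
  rw [zmap_zmap]
  refine (zmap_congr (fun e he => ?_) hζ).trans (zmap_inl_id ζ)
  exact fibProj_lamT hT x e he

variable {G : Prespectrum.{u}}

/-- A family of loops over the sheets of `lam`, indexed by the points of `L`, such that at most one
of the loops over a point of `B` is away from the base point at any time. -/
structure IsSheetFamily (d0L : Set L) (π : C(E, L)) (lam : C(L, B)) (lamT : C(E, W)) (m : ℕ)
    (g : L → (Fin m → I) → Smash (Plus W) (G.space m)) : Prop where
  bdry : ∀ x, ∀ t ∈ Cube.boundary (Fin m), g x t = pt _
  eq_pt : ∀ x ∈ d0L, ∀ t, g x t = pt _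
  overSheet : ∀ x t, Over (lamT '' {e | π e = x}) (g x t)
  unique : ∀ t, UniqueOver lam (fun x => g x t)

namespace IsSheetFamily

variable {m : ℕ} {g : L → (Fin m → I) → Smash (Plus W) (G.space m)}

theorem rstab (hg : IsSheetFamily d0L π lam lamT m g) :
    IsSheetFamily d0L π lam lamT (m + 1) (fun x => StratHom.rstab G (g x)) where
  bdry x t ht := by
    obtain ⟨i, hi⟩ := ht
    induction i using Fin.lastCases with
    | last =>
      rcases hi with hi | hi <;> unfold StratHom.rstab <;> rw [hi]
      · exact smashSusp_zero G m _
      · exact smashSusp_one G m _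
    | cast i =>
      unfold StratHom.rstab
      rw [hg.bdry x _ ⟨i, hi⟩, smashSusp_pt]
  eq_pt x hx t := by
    unfold StratHom.rstab
    rw [hg.eq_pt x hx, smashSusp_pt]
  overSheet x t := (hg.overSheet x _).smashSusp _ _
  unique t := (hg.unique _).map (φ := fun ζ => smashSusp G (Plus W) m (ζ, t (Fin.last m)))
    (smashSusp_pt G m _)

theorem fsum_rstab (hg : IsSheetFamily d0L π lam lamT m g) (b : B) :
    (fun t => fsum lam (fun x => StratHom.rstab G (g x) t) b) =
      StratHom.rstab G (fun t => fsum lam (fun x => g x t) b) :=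
  funext fun t => (hg.unique _).fsum_map
    (φ := fun ζ => smashSusp G (Plus W) m (ζ, t (Fin.last m))) (smashSusp_pt G m _) b

theorem fsum_bdry (hg : IsSheetFamily d0L π lam lamT m g) (b : B) {t : Fin m → I}
    (ht : t ∈ Cube.boundary (Fin m)) : fsum lam (fun x => g x t) b = pt _ :=
  fsum_eq_pt fun x _ => hg.bdry x t ht

theorem over_fsum (hg : IsSheetFamily d0L π lam lamT m g) (h : IsOpenImmersion d0L p π lam lamT)
    (b : B) (t : Fin m → I) :
    Over {w | w ∈ stratSub d0L π lamT ∧ p w = b} (fsum lam (fun x => g x t) b) := by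
  rcases fsum_cases lam (fun x => g x t) b with h' | ⟨x, rfl, hx, h'⟩
  · rw [h'.1]; exact over_pt _
  · rw [h']
    refine (hg.overSheet x t).mono ?_
    rintro _ ⟨e, rfl, rfl⟩
    exact ⟨⟨e, fun he => hx (hg.eq_pt _ he t), rfl⟩, h.comm e⟩

/-- The restriction of a sum over the sheets to one sheet. -/
theorem zmap_fibProj_fsum (hg : IsSheetFamily d0L π lam lamT m g) (hT : Function.Injective lamT)
    (x : L) (t : Fin m → I) :
    zmap (fibProj π lamT x) (fsum lam (fun x => g x t) (lam x)) =
      zmap (fibProj π lamT x) (g x t) := by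
  by_cases hx : g x t = pt _
  · rw [hx, zmap_pt]
    rcases fsum_cases lam (fun x => g x t) (lam x) with h' | ⟨x', -, hx', h'⟩
    · rw [h'.1, zmap_pt]
    · rw [h']
      refine zmap_fibProj_of_over hT ?_ (hg.overSheet x' t)
      rintro rfl
      exact hx' hx
  · rw [(hg.unique t).fsum_eq hx]

end IsSheetFamily

theorem continuous_fsum_sheets [CompactSpace L] [T2Space B]
    (h : IsOpenImmersion d0L p π lam lamT) {P : Type*} [TopologicalSpace P] [CompactSpace P]
    [T2Space P] {m : ℕ} {g : P × L → (Fin m → I) → Smash (Plus W) (G.space m)}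
    (hc : Continuous fun z : (P × L) × (Fin m → I) => g z.1 z.2)
    (hg : ∀ z, IsSheetFamily d0L π lam lamT m (fun x => g (z, x))) :
    Continuous fun z : (P × B) × (Fin m → I) => fsum lam (fun x => g (z.1.1, x) z.2) z.1.2 := by
  have := continuous_fsum (T := P × (Fin m → I)) (X := L) (Y := B)
    (e := fun z => lam z.2) (g := fun z => g (z.1.1, z.2) z.1.2) (by fun_prop)
    (hc.comp (by fun_prop : Continuous fun z : (P × (Fin m → I)) × L =>
      ((z.1.1, z.2), z.1.2))) d0Lᶜ (fun z x hx => (hg z.1).eq_pt x (not_not.1 hx) z.2)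
    (fun U hU hUd => by
      exact (h.isOpen_image U hU hUd).preimage continuous_snd)
    (fun z => (hg z.1).unique z.2)
  exact this.comp (by fun_prop : Continuous fun z : (P × B) × (Fin m → I) =>
    ((z.1.1, z.2), z.1.2))

/-- A continuous family of loops over the sheets of `lam` adds up to a family of sections. -/
theorem exists_sec_of_sheets [CompactSpace L] [CompactSpace E] [T2Space B] [T2Space W]
    (h : IsOpenImmersion d0L p π lam lamT) {P : Type*} [TopologicalSpace P] [CompactSpace P]
    [T2Space P] {m : ℕ} {g : P × L → (Fin m → I) → Smash (Plus W) (G.space m)}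
    (hc : Continuous fun z : (P × L) × (Fin m → I) => g z.1 z.2)
    (hg : ∀ z, IsSheetFamily d0L π lam lamT m (fun x => g (z, x))) :
    ∃ F : P → Sec G p (stratSub d0L π lamT) ∅, IsRep (fun z : P × B => (F z.1).tot z.2) m
      (fun z t => fsum lam (fun x => g (z.1, x) t) z.2) :=
  exists_sec_of_loops h.isClosed_fib (continuous_fsum_sheets h hc hg)
    (fun z _ ht => (hg z.1).fsum_bdry z.2 ht) (fun _ _ hb => hb.elim)
    (fun z t => (hg z.1).over_fsum h z.2 t)

end Sheets

/-! ### Squeezing sections and the map `μ` -/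

section Squeeze

/-- The dilation factors `1 + 3 c` in the first `k` directions; for `c = 1` the factor is `4`. -/
def spread (k : ℕ) (c : ℝ) (i : ℕ) : ℝ := if i < k then 1 + 3 * c else 1

theorem one_le_spread {k : ℕ} {c : ℝ} (hc : 0 ≤ c) (i : ℕ) : 1 ≤ spread k c i := by
  unfold spread
  split_ifs <;> linarith

theorem spread_of_le {k : ℕ} {c : ℝ} {i : ℕ} (h : k ≤ i) : spread k c i = 1 :=
  if_neg h.not_gt

theorem spread_of_lt {k : ℕ} {c : ℝ} {i : ℕ} (h : i < k) : spread k c i = 1 + 3 * c := if_pos h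

theorem spread_zero (k i : ℕ) : spread k 0 i = 1 := by
  unfold spread
  split_ifs <;> norm_num

theorem continuous_spread (k : ℕ) : Continuous (spread k) := by
  refine continuous_pi fun i => ?_
  unfold spread
  split_ifs <;> fun_prop

variable {B L W E : Type*} [TopologicalSpace B] [TopologicalSpace L] [TopologicalSpace W]
  [TopologicalSpace E] {d0L : Set L} {p : C(W, B)} {π : C(E, L)} {lam : C(L, B)} {lamT : C(E, W)}
  {G : Prespectrum.{u}}

/-- The first `k` coordinates of `j` separate the different points with the same image under `e`. -/
def Separates {X Y : Type*} (e : X → Y) (k : ℕ) (j : X → ℕ → I) : Prop :=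
  ∀ x x', e x = e x' → x ≠ x' → ∃ i < k, 1 / 2 ≤ |(j x i : ℝ) - j x' i|

/-- Loops squeezed into disjoint boxes have disjoint supports. -/
theorem uniqueOver_of_dil {X Y Z : Type*} [HasBase Z] {e : X → Y} {m : ℕ} {S : ℕ → ℝ}
    {a : X → ℕ → I}
    (hsep : ∀ x x', e x = e x' → x ≠ x' → ∃ i < m, 4 ≤ S i ∧ 1 / 2 ≤ |(a x i : ℝ) - a x' i|)
    {f : X → (Fin m → I) → Z} (hf : ∀ x, ∀ t ∈ Cube.boundary (Fin m), f x t = pt Z)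
    (t : Fin m → I) : UniqueOver e (fun x => f x (dil S (a x) t)) := by
  intro x x' hx hg hg'
  by_cases hxx : x = x'
  · rw [hxx]
  obtain ⟨i, hi, h4, hd⟩ := hsep x x' hx hxx
  rcases dil_mem_boundary_or (t := t) ⟨i, hi⟩ h4 hd with h | h
  · exact absurd (hf x _ h) hg
  · exact absurd (hf x' _ h) hg'

/-- Coordinates that separate double points and in which the dilation factors are at least `4`. -/
theorem Separates.exists_lt {X Y : Type*} {e : X → Y} {k : ℕ} {j : X → ℕ → I}
    (h : Separates e k j) {m : ℕ} (hm : k ≤ m) {S : ℕ → ℝ} (hS : ∀ i < k, 4 ≤ S i) (x x' : X)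
    (hx : e x = e x') (hxx : x ≠ x') :
    ∃ i < m, 4 ≤ S i ∧ 1 / 2 ≤ |(j x i : ℝ) - j x' i| := by
  obtain ⟨i, hi, hd⟩ := h x x' hx hxx
  exact ⟨i, hi.trans_le hm, hS i hi, hd⟩

theorem isClosed_fib_univ [T1Space L] (x : L) : IsClosed {e | e ∈ (Set.univ : Set E) ∧ π e = x} := by
  have := (isClosed_singleton (x := x)).preimage π.continuous
  convert this using 1
  ext e
  simp

theorem IsRep.dil_bdry {K : Type*} [TopologicalSpace K] {q : K → RedHom G (Plus E)} {m : ℕ}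
    {f : K → (Fin m → I) → Smash (Plus E) (G.space m)} (hf : IsRep q m f) {S : ℕ → ℝ}
    (hS : ∀ i, 1 ≤ S i) (a : ℕ → I) (x : K) {t : Fin m → I} (ht : t ∈ Cube.boundary (Fin m)) :
    f x (dil S a t) = pt _ :=
  hf.bdry x _ (dil_mem_boundary hS ht)

variable {j : L → ℕ → I} (k : ℕ)

theorem exists_squeeze [CompactSpace L] [T2Space L] [CompactSpace E] [T2Space E]
    (hj : Continuous j) (c : I) (γ : Sec G π Set.univ d0L) :
    ∃ s : Sec G π Set.univ d0L, ∀ m ≥ k, ∀ f, IsRep γ.tot m f →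
      IsRep s.tot m (fun x t => f x (dil (spread k c) (j x) t)) := by
  have hS : ∀ i, 1 ≤ spread k (c : ℝ) i := one_le_spread c.2.1
  obtain ⟨m₀, hm₀⟩ := exists_isRep γ.continuous_tot
  obtain ⟨f₀, hf₀⟩ := hm₀ (max m₀ k) (le_max_left _ _)
  have hcont : ∀ m f, IsRep γ.tot m f → Continuous fun z : L × (Fin m → I) =>
      f z.1 (dil (spread k c) (j z.1) z.2) := fun m f hf =>
    hf.cont.comp (continuous_fst.prodMk (continuous_dil continuous_const
      (hj.comp continuous_fst) continuous_snd))
  obtain ⟨F, hF⟩ := exists_sec_of_loops (G := G) (A := d0L) (isClosed_fib_univ (π := π)) (P := Unit)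
    (g := fun z t => f₀ z.2 (dil (spread k c) (j z.2) t))
    ((hcont _ _ hf₀).comp (by fun_prop : Continuous fun z : (Unit × L) × _ => (z.1.2, z.2)))
    (fun z t ht => hf₀.dil_bdry hS _ _ ht) (fun _ x hx t => hf₀.eq_pt (γ.tot_eq_pt hx) _)
    (fun z t => γ.over (hf₀.isLoop z.2) (hf₀.cls z.2) _)
  refine ⟨F (), fun m hm f hf => ⟨hcont m f hf, fun x t ht => hf.dil_bdry hS _ _ ht,
    fun x => ?_⟩⟩
  refine Eq.trans ?_ (hF.cls ((), x))
  refine IsRep.eq_of_rstab (q := γ.tot) (fun m f => cls G m (fun t => f x (dil (spread k c) (j x) t)))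
    k (fun m hm f hf => ?_) hm (le_max_right _ _) hf hf₀
  simp only [rstab_dil (f x) (spread_of_le hm)]
  exact cls_rstab ⟨(hcont m f hf).comp (continuous_const.prodMk continuous_id),
    fun t ht => hf.dil_bdry hS _ _ ht⟩

/-- The section `γ` with its values squeezed, by the factor `1 + 3 c` in the first `k` loop
coordinates, towards the centres `j`. -/
def squeeze [CompactSpace L] [T2Space L] [CompactSpace E] [T2Space E]
    (hj : Continuous j) (c : I) (γ : Sec G π Set.univ d0L) : Sec G π Set.univ d0L :=
  (exists_squeeze k hj c γ).choose

theorem isRep_squeeze [CompactSpace L] [T2Space L] [CompactSpace E] [T2Space E]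
    (hj : Continuous j) (c : I) (γ : Sec G π Set.univ d0L) {m : ℕ} (hm : k ≤ m)
    {f : L → (Fin m → I) → Smash (Plus E) (G.space m)} (hf : IsRep γ.tot m f) :
    IsRep (squeeze k hj c γ).tot m (fun x t => f x (dil (spread k c) (j x) t)) :=
  (exists_squeeze k hj c γ).choose_spec m hm f hf

theorem squeeze_zero [CompactSpace L] [T2Space L] [CompactSpace E] [T2Space E]
    (hj : Continuous j) (γ : Sec G π Set.univ d0L) : squeeze k hj 0 γ = γ := by
  obtain ⟨m₀, hm₀⟩ := exists_isRep γ.continuous_tot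
  obtain ⟨f, hf⟩ := hm₀ (max m₀ k) (le_max_left _ _)
  refine Sec.ext_tot fun x => ?_
  rw [← (isRep_squeeze k hj 0 γ (le_max_right _ _) hf).cls x, ← hf.cls x]
  congr 1
  funext t
  exact congrArg (f x) (dil_one (fun i _ => spread_zero k i) t)

theorem continuous_squeeze [CompactSpace L] [T2Space L] [CompactSpace E] [T2Space E]
    (hj : Continuous j) :
    Continuous fun z : I × Sec G π Set.univ d0L => squeeze k hj z.1 z.2 := by
  refine continuous_uncurry_of_cube_families _ fun n s hs => ?_
  obtain ⟨m₀, hm₀⟩ := exists_isRep (continuous_tot_family hs)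
  obtain ⟨f, hf⟩ := hm₀ (max m₀ k) (le_max_left _ _)
  have key : IsRep (fun z : (I × (Fin n → I)) × L => (squeeze k hj z.1.1 (s z.1.2)).tot z.2)
      (max m₀ k) (fun z t => f (z.1.2, z.2) (dil (spread k z.1.1) (j z.2) t)) := by
    have hz := fun z : (I × (Fin n → I)) × L => isRep_squeeze k hj z.1.1 (s z.1.2)
      (le_max_right m₀ k) (hf.comp (g := fun x : L => (z.1.2, x)) (by fun_prop))
    refine ⟨?_, fun z => (hz z).bdry z.2, fun z => (hz z).cls z.2⟩
    refine hf.cont.comp (Continuous.prodMk (by fun_prop) (continuous_dil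
      ((continuous_spread k).comp (by fun_prop)) (hj.comp (by fun_prop)) (by fun_prop)))
  exact continuous_sec_of_tot (isEuclideanRetract_prod_cube n) key.continuous

variable {k}

/-- The squeezed loops over the sheets of `lam`. -/
theorem isSheetFamily_squeeze (hs : Separates lam k j) {γ : Sec G π Set.univ d0L} {m : ℕ}
    (hm : k ≤ m) {f : L → (Fin m → I) → Smash (Plus E) (G.space m)} (hf : IsRep γ.tot m f) :
    IsSheetFamily d0L π lam lamT m (fun x t =>
      zmap (fun e => (Sum.inl (lamT e) : Plus W)) (f x (dil (spread k 1) (j x) t))) where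
  bdry x t ht := by rw [hf.dil_bdry (one_le_spread zero_le_one) _ _ ht, zmap_pt]
  eq_pt x hx t := by rw [hf.eq_pt (γ.tot_eq_pt hx), zmap_pt]
  overSheet x t := by
    refine (γ.over (hf.isLoop x) (hf.cls x) _).zmap_inl.mono ?_
    exact Set.image_mono fun e he => he.2
  unique t := (uniqueOver_of_dil (hs.exists_lt hm fun i hi => by
    rw [spread_of_lt hi]; norm_num) hf.bdry t).map (zmap_pt _)

theorem exists_mu [CompactSpace L] [T2Space L] [CompactSpace E] [T2Space E] [T2Space B] [T2Space W]
    (h : IsOpenImmersion d0L p π lam lamT) (hj : Continuous j) (hs : Separates lam k j)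
    (γ : Sec G π Set.univ d0L) :
    ∃ s : Sec G p (stratSub d0L π lamT) ∅, ∀ m ≥ k, ∀ f, IsRep γ.tot m f →
      IsRep s.tot m (fun b t => fsum lam (fun x =>
        zmap (fun e => (Sum.inl (lamT e) : Plus W)) (f x (dil (spread k 1) (j x) t))) b) := by
  obtain ⟨m₀, hm₀⟩ := exists_isRep γ.continuous_tot
  obtain ⟨f₀, hf₀⟩ := hm₀ (max m₀ k) (le_max_left _ _)
  have hsec : ∀ m ≥ k, ∀ f, IsRep γ.tot m f → ∃ s : Sec G p (stratSub d0L π lamT) ∅,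
      IsRep s.tot m (fun b t => fsum lam (fun x =>
        zmap (fun e => (Sum.inl (lamT e) : Plus W)) (f x (dil (spread k 1) (j x) t))) b) := by
    intro m hm f hf
    obtain ⟨F, hF⟩ := exists_sec_of_sheets h (P := Unit) (g := fun z t =>
      zmap (fun e => (Sum.inl (lamT e) : Plus W)) (f z.2 (dil (spread k 1) (j z.2) t)))
      ((continuous_zmap (continuous_inl.comp lamT.continuous)).comp
        (hf.cont.comp (Continuous.prodMk (by fun_prop) (continuous_dil continuous_const
          (hj.comp (by fun_prop)) (by fun_prop)))))
      (fun _ => isSheetFamily_squeeze hs hm hf)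
    exact ⟨F (), hF.comp (g := fun b : B => ((), b)) (by fun_prop)⟩
  obtain ⟨s, hs₀⟩ := hsec _ (le_max_right m₀ k) f₀ hf₀
  refine ⟨s, fun m hm f hf => ?_⟩
  obtain ⟨s', hs'⟩ := hsec m hm f hf
  refine ⟨hs'.cont, hs'.bdry, fun b => ?_⟩
  refine Eq.trans ?_ (hs₀.cls b)
  refine IsRep.eq_of_rstab (q := γ.tot) (fun m f => cls G m (fun t => fsum lam (fun x =>
        zmap (fun e => (Sum.inl (lamT e) : Plus W)) (f x (dil (spread k 1) (j x) t))) b))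
    k (fun m hm f hf => ?_) hm (le_max_right _ _) hf hf₀
  obtain ⟨s', hs'⟩ := hsec m hm f hf
  rw [← cls_rstab (hs'.isLoop b), ← (isSheetFamily_squeeze hs hm hf).fsum_rstab b]
  congr 1
  funext t
  congr 1
  funext x
  refine (congrArg (zmap _) (rstab_dil (f x) (spread_of_le hm) t)).trans ?_
  exact zmap_smashSusp G _ _ _

/-- The map `μ`: the sum, over the sheets of `lam`, of the values of a section; the addition of
loops is by squeezing them into disjoint boxes. -/
def mu [CompactSpace L] [T2Space L] [CompactSpace E] [T2Space E] [T2Space B] [T2Space W]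
    (h : IsOpenImmersion d0L p π lam lamT) (hj : Continuous j) (hs : Separates lam k j)
    (γ : Sec G π Set.univ d0L) : Sec G p (stratSub d0L π lamT) ∅ :=
  (exists_mu h hj hs γ).choose

theorem isRep_mu [CompactSpace L] [T2Space L] [CompactSpace E] [T2Space E] [T2Space B] [T2Space W]
    (h : IsOpenImmersion d0L p π lam lamT) (hj : Continuous j) (hs : Separates lam k j)
    (γ : Sec G π Set.univ d0L) {m : ℕ} (hm : k ≤ m)
    {f : L → (Fin m → I) → Smash (Plus E) (G.space m)} (hf : IsRep γ.tot m f) :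
    IsRep (mu h hj hs γ).tot m (fun b t => fsum lam (fun x =>
      zmap (fun e => (Sum.inl (lamT e) : Plus W)) (f x (dil (spread k 1) (j x) t))) b) :=
  (exists_mu h hj hs γ).choose_spec m hm f hf

theorem isRep_mu_family [CompactSpace L] [T2Space L] [CompactSpace E] [T2Space E] [T2Space B]
    [T2Space W] (h : IsOpenImmersion d0L p π lam lamT) (hj : Continuous j) (hs : Separates lam k j)
    {P : Type*} [TopologicalSpace P] [CompactSpace P] [T2Space P] {γ : P → Sec G π Set.univ d0L}
    {m : ℕ} (hm : k ≤ m) {f : P × L → (Fin m → I) → Smash (Plus E) (G.space m)}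
    (hf : IsRep (fun z : P × L => (γ z.1).tot z.2) m f) :
    IsRep (fun z : P × B => (mu h hj hs (γ z.1)).tot z.2) m (fun z t => fsum lam (fun x =>
      zmap (fun e => (Sum.inl (lamT e) : Plus W)) (f (z.1, x) (dil (spread k 1) (j x) t))) z.2) := by
  have hfz := fun z : P => hf.comp (g := fun x : L => (z, x)) (by fun_prop)
  have hz := fun z : P => isRep_mu h hj hs (γ z) hm (hfz z)
  refine ⟨?_, fun z => (hz z.1).bdry z.2, fun z => (hz z.1).cls z.2⟩
  exact continuous_fsum_sheets h (g := fun z t =>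
    zmap (fun e => (Sum.inl (lamT e) : Plus W)) (f z (dil (spread k 1) (j z.2) t)))
    ((continuous_zmap (continuous_inl.comp lamT.continuous)).comp
      (hf.cont.comp (Continuous.prodMk (by fun_prop) (continuous_dil continuous_const
        (hj.comp (by fun_prop)) (by fun_prop)))))
    (fun z => isSheetFamily_squeeze hs hm (hfz z))

theorem continuous_mu [CompactSpace L] [T2Space L] [CompactSpace E] [T2Space E] [T2Space B]
    [T2Space W] (h : IsOpenImmersion d0L p π lam lamT) (hj : Continuous j)
    (hs : Separates lam k j) : Continuous (mu (G := G) h hj hs) := by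
  refine continuous_of_cube_families fun n s hs' => ?_
  obtain ⟨m₀, hm₀⟩ := exists_isRep (continuous_tot_family hs')
  obtain ⟨f, hf⟩ := hm₀ (max m₀ k) (le_max_left _ _)
  exact continuous_sec_of_tot (isEuclideanRetract_cube n)
    (isRep_mu_family h hj hs (le_max_right _ _) hf).continuous

/-- The composition `ρ ∘ μ` squeezes sections; hence it is homotopic to the identity. -/
theorem rho_mu [CompactSpace L] [T2Space L] [CompactSpace E] [T2Space E] [T2Space B]
    [CompactSpace B] [CompactSpace W] [T2Space W]
    (c : ∀ x, BasedMap (Plus (Fib p (stratSub d0L π lamT) (lam x))) (Plus (Fib π Set.univ x)))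
    (hc : ∀ x w, (fibIncl π Set.univ x).toMap ((c x).toMap (Sum.inl w)) = fibProj π lamT x w.1)
    (h : IsOpenImmersion d0L p π lam lamT) (hj : Continuous j) (hs : Separates lam k j)
    (γ : Sec G π Set.univ d0L) : rho c hc h (mu h hj hs γ) = squeeze k hj 1 γ := by
  obtain ⟨m₀, hm₀⟩ := exists_isRep γ.continuous_tot
  obtain ⟨f, hf⟩ := hm₀ (max m₀ k) (le_max_left _ _)
  have hm := le_max_right m₀ k
  refine Sec.ext_tot fun x => ?_
  rw [← (isRep_squeeze k hj 1 γ hm hf).cls x]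
  have hr := isRep_mu h hj hs γ hm hf
  refine (redMap_rho c hc h _ x (hr.isLoop (lam x)) (hr.cls (lam x))).trans ?_
  congr 1
  funext t
  rw [(isSheetFamily_squeeze hs hm hf).zmap_fibProj_fsum h.isEmbedding.injective x t,
    zmap_fibProj_zmap_lamT h.isEmbedding.injective]
  · simp
  · exact (γ.over (hf.isLoop x) (hf.cls x) _).mono fun e he => he.2

end Squeeze

/-! ### The map `μ` is a weak equivalence -/

section Radial

/-- A collar of the cube: the radial map `r` retracts the collar `1 / 2 ≤ w` to the boundary, and
`w` is the distance from the centre, normalized to be `1` on the boundary. -/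
theorem exists_radial (n : ℕ) : ∃ (w : C(Fin n → I, ℝ)) (r : C(Fin n → I, Fin n → I)),
    (∀ z, 1 / 2 ≤ w z → r z ∈ Cube.boundary (Fin n)) ∧
      ∀ z ∈ Cube.boundary (Fin n), r z = z ∧ w z = 1 := by
  let w : (Fin n → I) → ℝ := fun z => 2 * ‖fun i => (z i : ℝ) - 1 / 2‖
  have hw : Continuous w := by fun_prop
  have hle : ∀ z i, 2 * |(z i : ℝ) - 1 / 2| ≤ w z := fun z i => by
    have := norm_le_pi_norm (fun i => (z i : ℝ) - 1 / 2) i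
    rw [Real.norm_eq_abs] at this
    linarith
  have hpos : ∀ z, 0 < max (1 / 2) (w z) := fun z => lt_max_of_lt_left (by norm_num)
  let r : (Fin n → I) → Fin n → I := fun z i =>
    Set.projIcc 0 1 zero_le_one (1 / 2 + ((z i : ℝ) - 1 / 2) / max (1 / 2) (w z))
  have hr : Continuous r := by
    refine continuous_pi fun i => continuous_projIcc.comp (continuous_const.add (Continuous.div ?_
      (continuous_const.max hw) fun z => (hpos z).ne'))
    fun_prop
  have hsup : ∀ z, 1 / 2 ≤ w z → ∃ i, 2 * |(z i : ℝ) - 1 / 2| = w z := by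
    intro z hz
    have hne : Nonempty (Fin n) := by
      by_contra hne
      rw [not_nonempty_iff] at hne
      have : w z = 0 := by
        simp only [w]
        rw [show (fun i => (z i : ℝ) - 1 / 2) = 0 from funext fun i => isEmptyElim i]
        simp
      linarith
    obtain ⟨i, hi⟩ := Finite.exists_max (fun i => |(z i : ℝ) - 1 / 2|)
    refine ⟨i, le_antisymm (hle z i) ?_⟩
    have := (pi_norm_le_iff_of_nonneg (x := fun i => (z i : ℝ) - 1 / 2) (abs_nonneg _)).2 hi
    simp only [w]
    linarith
  refine ⟨⟨w, hw⟩, ⟨r, hr⟩, fun z hz => ?_, fun z hz => ?_⟩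
  · change 1 / 2 ≤ w z at hz
    obtain ⟨i, hi⟩ := hsup z hz
    have hw0 : 0 < w z := by linarith
    refine ⟨i, ?_⟩
    change Set.projIcc 0 1 zero_le_one (1 / 2 + ((z i : ℝ) - 1 / 2) / max (1 / 2) (w z)) = 0 ∨
      Set.projIcc 0 1 zero_le_one (1 / 2 + ((z i : ℝ) - 1 / 2) / max (1 / 2) (w z)) = 1
    rw [max_eq_right hz]
    rcases abs_cases ((z i : ℝ) - 1 / 2) with ⟨h, -⟩ | ⟨h, -⟩
    · right
      refine Set.projIcc_of_right_le zero_le_one ?_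
      rw [h] at hi
      rw [← sub_le_iff_le_add', le_div_iff₀ hw0]
      linarith
    · left
      refine Set.projIcc_of_le_left zero_le_one ?_
      rw [h] at hi
      rw [← le_neg_iff_add_nonpos_left, div_le_iff₀ hw0]
      linarith
  · have h1 : w z = 1 := by
      refine le_antisymm ?_ ?_
      · have : ‖fun i => (z i : ℝ) - 1 / 2‖ ≤ 1 / 2 := by
          refine (pi_norm_le_iff_of_nonneg (by norm_num)).2 fun i => ?_
          rw [Real.norm_eq_abs, abs_le]
          exact ⟨by linarith [(z i).2.1], by linarith [(z i).2.2]⟩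
        simp only [w]
        linarith
      · obtain ⟨i, hi⟩ := hz
        refine le_trans ?_ (hle z i)
        rcases hi with hi | hi <;> rw [hi] <;> norm_num [abs_of_pos]
    refine ⟨funext fun i => ?_, h1⟩
    change Set.projIcc 0 1 zero_le_one (1 / 2 + ((z i : ℝ) - 1 / 2) / max (1 / 2) (w z)) = z i
    rw [h1]
    convert Set.projIcc_val zero_le_one (z i) using 2
    norm_num

/-- The homotopy is along the segments from `r z` to `z`. -/
theorem homotopicRel_cube {n : ℕ} {X : Type*} [TopologicalSpace X] (b : C(Fin n → I, X))
    (r : C(Fin n → I, Fin n → I)) (hr : ∀ z ∈ Cube.boundary (Fin n), r z = z) :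
    (b.comp r).HomotopicRel b (Cube.boundary (Fin n)) := by
  let H : I × (Fin n → I) → Fin n → I := fun y i =>
    Set.projIcc 0 1 zero_le_one ((1 - y.1) * r y.2 i + y.1 * y.2 i)
  have hH : Continuous H := continuous_pi fun i => continuous_projIcc.comp (by fun_prop)
  have hproj : ∀ (x : ℝ) (y : I), x = y → Set.projIcc 0 1 zero_le_one x = y := by
    rintro _ y rfl
    exact Set.projIcc_val zero_le_one y
  refine ⟨⟨⟨⟨fun y => b (H y), b.continuous.comp hH⟩, fun z => congrArg b (funext fun i =>
    hproj _ _ ?_), fun z => congrArg b (funext fun i => hproj _ _ ?_)⟩, fun t z hz =>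
      congrArg b (funext fun i => hproj _ _ ?_)⟩⟩
  · simp
  · simp
  · rw [hr z hz]
    ring

end Radial

section Blocks

theorem dil_congr {m : ℕ} {S S' : ℕ → ℝ} {a a' : ℕ → I}
    (h : ∀ i < m, S i = S' i ∧ (a i = a' i ∨ S i = 1)) (t : Fin m → I) :
    dil S a t = dil S' a' t := by
  funext i
  unfold dil
  obtain ⟨h1, h2 | h2⟩ := h i i.2
  · rw [h1, h2]
  · rw [← h1, h2]
    congr 1
    ring

/-- Dilation factors `1 + 3 c` in the first `k` directions and `1 + 3 c'` in the directions
from `m` on. -/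
def blockSpread (k m : ℕ) (c c' : ℝ) (i : ℕ) : ℝ :=
  if i < k then 1 + 3 * c else if i < m then 1 else 1 + 3 * c'

/-- The centres for `blockSpread`: those in the directions from `m` on are copies of the first
ones. -/
def blockCentre {X : Type*} (m : ℕ) (j : X → ℕ → I) (x : X) (i : ℕ) : I :=
  if i < m then j x i else j x (i - m)

theorem one_le_blockSpread {k m : ℕ} {c c' : ℝ} (hc : 0 ≤ c) (hc' : 0 ≤ c') (i : ℕ) :
    1 ≤ blockSpread k m c c' i := by
  unfold blockSpread
  split_ifs <;> linarith

theorem continuous_blockSpread (k m : ℕ) :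
    Continuous fun c : ℝ × ℝ => blockSpread k m c.1 c.2 := by
  refine continuous_pi fun i => ?_
  unfold blockSpread
  split_ifs <;> fun_prop

theorem continuous_blockCentre {X : Type*} [TopologicalSpace X] {j : X → ℕ → I}
    (hj : Continuous j) (m : ℕ) : Continuous (blockCentre m j) := by
  refine continuous_pi fun i => ?_
  unfold blockCentre
  split_ifs <;> fun_prop

theorem dil_blockSpread_zero_right {X : Type*} {k m m' : ℕ} (hk : k ≤ m) (c : ℝ) (j : X → ℕ → I)
    (x : X) (t : Fin m' → I) :
    dil (blockSpread k m c 0) (blockCentre m j x) t = dil (spread k c) (j x) t := by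
  refine dil_congr (fun i _ => ⟨?_, ?_⟩) t
  · unfold blockSpread spread
    split_ifs <;> norm_num
  · unfold blockSpread blockCentre
    by_cases hi : i < m
    · exact Or.inl (if_pos hi)
    · right
      rw [if_neg (by omega), if_neg hi]
      norm_num

theorem dil_spread_dil_blockSpread {X : Type*} {k m m' : ℕ} (hk : k ≤ m) {c : ℝ} (hc : 0 ≤ c)
    {c₁ c₂ : ℝ} (j : X → ℕ → I) (x : X) (t : Fin m' → I) :
    dil (spread k c) (j x) (dil (blockSpread k m c₁ c₂) (blockCentre m j x) t) =
      dil (fun i => spread k c i * blockSpread k m c₁ c₂ i) (blockCentre m j x) t := by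
  rw [← dil_dil (one_le_spread hc)]
  refine dil_congr (fun i _ => ⟨rfl, ?_⟩) _
  by_cases hi : i < k
  · left
    rw [blockCentre, if_pos (hi.trans_le hk)]
  · right
    exact spread_of_le (not_lt.1 hi)

end Blocks

section WeakEquiv

variable {B L W E : Type*} [TopologicalSpace B] [TopologicalSpace L] [TopologicalSpace W]
  [TopologicalSpace E] {d0L : Set L} {p : C(W, B)} {π : C(E, L)} {lam : C(L, B)} {lamT : C(E, W)}
  {G : Prespectrum.{u}}

/-- A loop over `E^δ` is the sum of its restrictions to the sheets. -/
theorem fsum_zmap_fibProj {Γ : Type*} [HasBase Γ] (h : IsOpenImmersion d0L p π lam lamT) {b : B}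
    {ζ : B → Smash (Plus W) Γ} (ho : Over {w | w ∈ stratSub d0L π lamT ∧ p w = b} (ζ b)) :
    fsum lam (fun x => zmap (fun e => (Sum.inl (lamT e) : Plus W))
      (zmap (fibProj π lamT x) (ζ (lam x)))) b = ζ b := by
  rcases el_cases (ζ b) with hζ | ⟨w, g, hg, hζ⟩
  · rw [hζ]
    refine fsum_eq_pt fun x hx => ?_
    rw [hx, hζ, zmap_pt, zmap_pt]
  · obtain ⟨⟨e, -, rfl⟩, rfl⟩ := ho w g hg hζ
    have hval : zmap (fun e => (Sum.inl (lamT e) : Plus W))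
        (zmap (fibProj π lamT (π e)) (ζ (lam (π e)))) = el (lamT e) g := by
      rw [← h.comm, hζ, zmap_el, fibProj_lamT h.isEmbedding.injective _ _ rfl]
      rfl
    rw [hζ, ← hval]
    refine fsum_eq (g := fun x => zmap (fun e => (Sum.inl (lamT e) : Plus W))
      (zmap (fibProj π lamT x) (ζ (lam x)))) (h.comm e).symm fun x hx hx' => ?_
    have : x = π e := by
      by_contra hne
      refine hx' ?_
      change zmap _ (zmap (fibProj π lamT x) (ζ (lam x))) = _
      rw [hx, hζ, zmap_fibProj_of_over h.isEmbedding.injective hne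
        (over_el (A := lamT '' {e' | π e' = π e}) ⟨e, rfl, rfl⟩ g), zmap_pt]
    rw [this]

/-- The restrictions of loops over `E^δ` to the sheets, precomposed with dilations. -/
theorem isSheetFamily_fibProj (h : IsOpenImmersion d0L p π lam lamT)
    {s : Sec G p (stratSub d0L π lamT) ∅} {m : ℕ}
    {F : B → (Fin m → I) → Smash (Plus W) (G.space m)} (hF : IsRep s.tot m F) {S : ℕ → ℝ}
    (hS : ∀ i, 1 ≤ S i) (a : L → ℕ → I)
    (hu : ∀ t, UniqueOver lam (fun x => zmap (fun e => (Sum.inl (lamT e) : Plus W))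
      (zmap (fibProj π lamT x) (F (lam x) (dil S (a x) t))))) :
    IsSheetFamily d0L π lam lamT m (fun x t => zmap (fun e => (Sum.inl (lamT e) : Plus W))
      (zmap (fibProj π lamT x) (F (lam x) (dil S (a x) t)))) where
  bdry x t ht := by rw [hF.bdry _ _ (dil_mem_boundary hS ht), zmap_pt, zmap_pt]
  eq_pt x hx t := by
    rw [h.zmap_fibProj_eq_pt hx (s.over (hF.isLoop _) (hF.cls _) _), zmap_pt]
  overSheet x t := (IsOpenImmersion.over_zmap_fibProj x _).zmap_inl.mono
    (Set.image_mono fun _ he => he.2)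
  unique := hu

variable {k : ℕ} {j : L → ℕ → I} [CompactSpace L] [T2Space L] [CompactSpace E] [T2Space E]
  [T2Space B] [CompactSpace B] [CompactSpace W] [T2Space W]

omit [CompactSpace B] [CompactSpace W] in
/-- The restriction of `μ γ` to a sheet is `γ`, squeezed. -/
theorem zmap_fibProj_isRep_mu (h : IsOpenImmersion d0L p π lam lamT) (hj : Continuous j)
    (hs : Separates lam k j) {γ : Sec G π Set.univ d0L} {m : ℕ} (hm : k ≤ m)
    {f : L → (Fin m → I) → Smash (Plus E) (G.space m)} (hf : IsRep γ.tot m f)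
    {F : B → (Fin m → I) → Smash (Plus W) (G.space m)} (hF : IsRep (mu h hj hs γ).tot m F)
    (x : L) (t : Fin m → I) :
    zmap (fibProj π lamT x) (F (lam x) t) = f x (dil (spread k 1) (j x) t) := by
  rw [hF.unique (isRep_mu h hj hs γ hm hf),
    (isSheetFamily_squeeze hs hm hf).zmap_fibProj_fsum h.isEmbedding.injective x t,
    zmap_fibProj_zmap_lamT h.isEmbedding.injective]
  exact (γ.over (hf.isLoop x) (hf.cls x) _).mono fun e he => he.2

/-- The map `μ` satisfies the relative lifting criterion. Given `b` on the cube and `a` on the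
boundary with `μ a = b`, pull `b` back along a radial map that is constant along the rays of a
collar. The lift is `ρ b` inside, and squeezed values of `a` on the collar. The loops of
`μ (ρ b)` at the sheets are those of `b`, squeezed into disjoint boxes in the first `k` loop
coordinates. They are also squeezed in `k` new suspension coordinates, then released in
the first coordinates, and then in the new ones; in the last step they do not collide, because
the point of `W` at which a stabilized loop lies does not depend on the new coordinates. -/
theorem isWeakEquiv_mu
    (c : ∀ x, BasedMap (Plus (Fib p (stratSub d0L π lamT) (lam x))) (Plus (Fib π Set.univ x)))
    (hc : ∀ x w, (fibIncl π Set.univ x).toMap ((c x).toMap (Sum.inl w)) = fibProj π lamT x w.1)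
    (h : IsOpenImmersion d0L p π lam lamT) (hj : Continuous j) (hs : Separates lam k j) :
    IsWeakEquiv (⟨mu (G := G) h hj hs, continuous_mu h hj hs⟩ : C(Sec G π Set.univ d0L, _)) := by
  classical
  intro n a b hab
  change ∀ y, mu h hj hs (a y) = b y at hab
  have hT := h.isEmbedding.injective
  have hcb : CompactSpace (Cube.boundary (Fin n)) := by
    refine isCompact_iff_compactSpace.1 (IsClosed.isCompact ?_)
    have : Cube.boundary (Fin n) = ⋃ i, {y : Fin n → I | y i = 0 ∨ y i = 1} := by
      ext y
      simp [Cube.boundary]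
    rw [this]
    exact isClosed_iUnion_of_finite fun i => (isClosed_eq (by fun_prop) (by fun_prop)).union
      (isClosed_eq (by fun_prop) (by fun_prop))
  obtain ⟨w, r, hr1, hr2⟩ := exists_radial n
  let v : (Fin n → I) → I := fun z => Set.projIcc 0 1 zero_le_one (2 - 2 * w z)
  have hv : Continuous v := continuous_projIcc.comp (by fun_prop)
  have hv1 : ∀ z, w z ≤ 1 / 2 → v z = 1 := fun z hz =>
    Set.projIcc_of_right_le zero_le_one (by linarith)
  have hv0 : ∀ z ∈ Cube.boundary (Fin n), v z = 0 := fun z hz =>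
    Set.projIcc_of_le_left zero_le_one (by rw [(hr2 z hz).2]; norm_num)
  -- the lift
  let a₁ : (Fin n → I) → Sec G π Set.univ d0L := fun z =>
    if hz : r z ∈ Cube.boundary (Fin n) then squeeze k hj (v z) (a ⟨r z, hz⟩)
    else rho c hc h (b (r z))
  have ha₁ : ContinuousOn a₁ {z | 1 / 2 ≤ w z} := by
    rw [continuousOn_iff_continuous_domRestrict]
    have : Continuous fun z : {z | 1 / 2 ≤ w z} =>
        squeeze k hj (v z) (a ⟨r z, hr1 z z.2⟩) := by
      refine (continuous_squeeze k hj).comp (Continuous.prodMk (hv.comp continuous_subtype_val)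
        (a.continuous.comp (Continuous.subtype_mk (r.continuous.comp continuous_subtype_val) _)))
    refine this.congr fun z => ?_
    rw [Set.domRestrict_apply]
    simp only [a₁]
    rw [dif_pos (hr1 z z.2)]
  let a' : (Fin n → I) → Sec G π Set.univ d0L := fun z =>
    if w z ≤ 1 / 2 then rho c hc h (b (r z)) else a₁ z
  have ha'c : Continuous a' := by
    refine continuous_if_le w.continuous continuous_const
      ((continuous_rho c hc h).comp (b.continuous.comp r.continuous)).continuousOn ha₁ ?_
    intro z hz
    have hrz := hr1 z hz.ge
    simp only [a₁, dif_pos hrz]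
    rw [← hab ⟨r z, hrz⟩, rho_mu c hc h hj hs, hv1 z hz.le]
  have ha'1 : ∀ z, w z ≤ 1 / 2 → a' z = rho c hc h (b (r z)) := fun z hz => if_pos hz
  have ha'2 : ∀ z (hz : 1 / 2 < w z), a' z = squeeze k hj (v z) (a ⟨r z, hr1 z hz.le⟩) :=
    fun z hz => (if_neg hz.not_ge).trans (dif_pos (hr1 z hz.le))
  -- representatives
  obtain ⟨mb, hmb⟩ := exists_isRep (continuous_tot_family (b.continuous.comp r.continuous))
  obtain ⟨ma, hma⟩ := exists_isRep (continuous_tot_family a.continuous)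
  obtain ⟨m, hmb', hma', hkm⟩ : ∃ m, mb ≤ m ∧ ma ≤ m ∧ k ≤ m :=
    ⟨max mb (max ma k), by omega, by omega, by omega⟩
  obtain ⟨f, hf⟩ := hmb m hmb'
  obtain ⟨F, hF, hFo⟩ := hf.exists_rstab_iterate k
  obtain ⟨fa, hfa⟩ := hma (m + k) (by omega)
  have hkM : k ≤ m + k := by omega
  have hFz : ∀ z, IsRep (b (r z)).tot (m + k) (fun y => F (z, y)) := fun z =>
    hF.comp (g := fun y : B => (z, y)) (by fun_prop)
  have hfaz : ∀ y, IsRep (a y).tot (m + k) (fun x => fa (y, x)) := fun y =>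
    hfa.comp (g := fun x : L => (y, x)) (by fun_prop)
  have hcollar : ∀ z (hz : 1 / 2 < w z) x t, zmap (fibProj π lamT x) (F (z, lam x) t) =
      fa (⟨r z, hr1 z hz.le⟩, x) (dil (spread k 1) (j x) t) := fun z hz x t =>
    zmap_fibProj_isRep_mu h hj hs hkM (hfaz ⟨r z, hr1 z hz.le⟩)
      (F := fun y => F (z, y)) (by rw [hab]; exact hFz z) x t
  -- the factors in the first coordinates are `σ'`, which falls from `1` to `0` on `[1/3, 2/3]`; those
  -- in the new coordinates are `ω'`, which is `0` at the ends and `1` on `[1/3, 2/3]`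
  let σ' : I → I := fun τ => Set.projIcc 0 1 zero_le_one (2 - 3 * (τ : ℝ))
  let ω' : I → I := fun τ => Set.projIcc 0 1 zero_le_one (min (3 * (τ : ℝ)) (3 - 3 * τ))
  have hσc : Continuous σ' := continuous_projIcc.comp (by fun_prop)
  have hωc : Continuous ω' := continuous_projIcc.comp (by fun_prop)
  have hcases : ∀ τ, σ' τ = 1 ∨ ω' τ = 1 ∨ σ' τ = 0 := by
    intro τ
    rcases le_total (τ : ℝ) (1 / 3) with h1 | h1
    · exact Or.inl (Set.projIcc_of_right_le zero_le_one (by linarith))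
    · rcases le_total (τ : ℝ) (2 / 3) with h2 | h2
      · exact Or.inr (Or.inl (Set.projIcc_of_right_le zero_le_one
          (le_min (by linarith) (by linarith))))
      · exact Or.inr (Or.inr (Set.projIcc_of_le_left zero_le_one (by linarith)))
  let S : I × (Fin n → I) → ℕ → ℝ := fun y =>
    blockSpread k m ((v y.2 : ℝ) * σ' y.1) ((v y.2 : ℝ) * ω' y.1)
  have hS1 : ∀ y i, 1 ≤ S y i := fun y i => one_le_blockSpread
    (mul_nonneg (v y.2).2.1 (σ' y.1).2.1) (mul_nonneg (v y.2).2.1 (ω' y.1).2.1) i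
  have hSc : Continuous S := (continuous_blockSpread k m).comp
    (f := fun y : I × (Fin n → I) => ((v y.2 : ℝ) * σ' y.1, (v y.2 : ℝ) * ω' y.1)) (by fun_prop)
  let A := blockCentre m j
  have hAc : Continuous A := continuous_blockCentre hj m
  have hfirst : ∀ i < k, ∀ x, A x i = j x i := fun i hi x => if_pos (by omega)
  have hlast : ∀ i x, A x (m + i) = j x i := fun i x => by
    simp only [A, blockCentre]
    rw [if_neg (by omega), Nat.add_sub_cancel_left]
  have hbd : ∀ z x, ∀ t ∈ Cube.boundary (Fin (m + k)),
      zmap (fun e => (Sum.inl (lamT e) : Plus W)) (zmap (fibProj π lamT x) (F (z, lam x) t)) =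
        pt _ := fun z x t ht => by rw [hF.bdry _ _ ht, zmap_pt, zmap_pt]
  have huniq : ∀ y t, UniqueOver lam (fun x => zmap (fun e => (Sum.inl (lamT e) : Plus W))
      (zmap (fibProj π lamT x) (F (y.2, lam x) (dil (S y) (A x) t)))) := by
    rintro ⟨τ, z⟩ t
    rcases le_or_gt (w z) (1 / 2) with hz | hz
    · have hSz : S (τ, z) = blockSpread k m (σ' τ) (ω' τ) := by
        simp only [S]
        rw [hv1 z hz]
        simp
      rcases hcases τ with hτ | hτ | hτ
      · refine uniqueOver_of_dil (S := S (τ, z)) (a := A) (fun x x' hx hxx => ?_)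
          (f := fun x t => zmap (fun e => (Sum.inl (lamT e) : Plus W))
            (zmap (fibProj π lamT x) (F (z, lam x) t))) (hbd z) t
        obtain ⟨i, hi, hd⟩ := hs x x' hx hxx
        refine ⟨i, by omega, ?_, ?_⟩
        · rw [hSz, hτ, blockSpread, if_pos hi]
          norm_num
        · rwa [hfirst i hi, hfirst i hi]
      · refine uniqueOver_of_dil (S := S (τ, z)) (a := A) (fun x x' hx hxx => ?_)
          (f := fun x t => zmap (fun e => (Sum.inl (lamT e) : Plus W))
            (zmap (fibProj π lamT x) (F (z, lam x) t))) (hbd z) t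
        obtain ⟨i, hi, hd⟩ := hs x x' hx hxx
        refine ⟨m + i, by omega, ?_, ?_⟩
        · rw [hSz, hτ, blockSpread, if_neg (by omega), if_neg (by omega)]
          norm_num
        · rwa [hlast, hlast]
      · intro x x' hx hg hg'
        change zmap _ (zmap (fibProj π lamT x) (F (z, lam x) (dil (S (τ, z)) (A x) t))) ≠ _ at hg
        change zmap _ (zmap (fibProj π lamT x') (F (z, lam x') (dil (S (τ, z)) (A x') t))) ≠ _
          at hg'
        -- the first `m` coordinates are not dilated
        have hres : ∀ x, (fun i => dil (S (τ, z)) (A x) t (Fin.castAdd k i)) =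
            fun i => t (Fin.castAdd k i) := by
          intro x
          funext i
          have h1 : S (τ, z) (i : ℕ) = 1 := by
            rw [hSz, hτ, blockSpread]
            split_ifs with h1 h2
            · norm_num
            · rfl
            · exact absurd i.2 h2
          refine Eq.trans ?_ (Set.projIcc_val zero_le_one (t (Fin.castAdd k i)))
          unfold dil
          congr 1
          rw [show S (τ, z) ((Fin.castAdd k i : Fin (m + k)) : ℕ) = 1 from h1]
          ring
        have hov : ∀ x V, Over V (f (z, lam x) fun i => t (Fin.castAdd k i)) →
            Over V (F (z, lam x) (dil (S (τ, z)) (A x) t)) := fun x V hV =>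
          hFo _ _ _ (by rw [hres]; exact hV)
        have hx' : x = x' := by
          have key : ∀ x V, Over V (f (z, lam x) fun i => t (Fin.castAdd k i)) →
              zmap (fun e => (Sum.inl (lamT e) : Plus W))
                (zmap (fibProj π lamT x) (F (z, lam x) (dil (S (τ, z)) (A x) t))) ≠ pt _ →
              ∃ e, π e = x ∧ lamT e ∈ V := by
            intro x V hV hne
            rcases el_cases (F (z, lam x) (dil (S (τ, z)) (A x) t)) with h0 | ⟨y, g, hg, h0⟩
            · rw [h0, zmap_pt, zmap_pt] at hne
              exact absurd rfl hne
            · have hy := hov x V hV y g hg h0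
              by_contra! hno
              refine hne ?_
              rw [h0, zmap_el, fibProj_of_ne (fun e he hey => hno e he (hey ▸ hy))]
              exact (congrArg _ (Smash.mk_eq_pt (Or.inl rfl))).trans (zmap_pt _)
          rcases el_cases (f (z, lam x) fun i => t (Fin.castAdd k i)) with h0 | ⟨y, g, hg0, h0⟩
          · obtain ⟨e, -, he⟩ := key x ∅ (by rw [h0]; exact over_pt _) hg
            exact he.elim
          · obtain ⟨e, he, hey⟩ := key x {y} (by rw [h0]; exact over_el (A := {y}) rfl g) hg
            obtain ⟨e', he', hey'⟩ := key x' {y}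
              (by rw [← hx, h0]; exact over_el (A := {y}) rfl g) hg'
            rw [← he, ← he', hT (hey.trans hey'.symm)]
        rw [hx']
    · -- on the collar the loops are squeezed already
      have := (uniqueOver_of_dil (e := lam) (S := fun i => spread k 1 i * S (τ, z) i) (a := A)
        (fun x x' hx hxx => by
          obtain ⟨i, hi, hd⟩ := hs x x' hx hxx
          refine ⟨i, by omega, ?_, by rwa [hfirst i hi, hfirst i hi]⟩
          rw [spread_of_lt hi]
          linarith [hS1 (τ, z) i])
        (f := fun x t => fa (⟨r z, hr1 z hz.le⟩, x) t) (fun x t ht => hfa.bdry _ _ ht) t).map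
        (φ := zmap fun e => (Sum.inl (lamT e) : Plus W)) (zmap_pt _)
      convert this using 4 with x
      rw [hcollar z hz, dil_spread_dil_blockSpread hkm zero_le_one]
  have hsheets := fun y : I × (Fin n → I) =>
    isSheetFamily_fibProj h (hFz y.2) (hS1 y) A (huniq y)
  obtain ⟨Φ, hΦ⟩ := exists_sec_of_sheets (G := G) h (P := I × (Fin n → I))
    (g := fun y t => zmap (fun e => (Sum.inl (lamT e) : Plus W))
      (zmap (fibProj π lamT y.2) (F (y.1.2, lam y.2) (dil (S y.1) (A y.2) t))))
    ((continuous_zmap (continuous_inl.comp lamT.continuous)).comp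
      (h.continuous_zmap_fibProj (continuous_snd.comp continuous_fst)
        (hF.cont.comp (Continuous.prodMk (by fun_prop) (continuous_dil
          (hSc.comp (by fun_prop)) (hAc.comp (by fun_prop)) (by fun_prop))))
        fun y => (b (r y.1.1.2)).over ((hFz _).isLoop _) ((hFz _).cls _) _)) hsheets
  have hΦc : Continuous Φ :=
    continuous_sec_of_tot (isEuclideanRetract_prod_cube n) hΦ.continuous
  -- without dilation, the homotopy is at `b ∘ r`
  have hΦ1 : ∀ y, (∀ i, S y i = 1) → Φ y = b (r y.2) := by
    intro y hy
    refine Sec.ext_tot fun β => ?_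
    rw [← hΦ.cls (y, β), ← (hFz y.2).cls β]
    congr 1
    funext t
    simp only [dil_one (fun i _ => hy i)]
    exact fsum_zmap_fibProj h (ζ := fun β => F (y.2, β) t)
      ((b (r y.2)).over ((hFz y.2).isLoop β) ((hFz y.2).cls β) t)
  have hΦ0 : ∀ z, Φ (0, z) = mu h hj hs (a' z) := by
    intro z
    have h0 : ∀ x t, dil (S (0, z)) (A x) t = dil (spread k (v z)) (j x) (t : Fin (m + k) → I) := by
      intro x t
      have h1 : σ' 0 = 1 := Set.projIcc_of_right_le zero_le_one (by norm_num)
      have h2 : ω' 0 = 0 := Set.projIcc_of_le_left zero_le_one (by norm_num)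
      simp only [S, h1, h2, Set.Icc.coe_one, Set.Icc.coe_zero, mul_one, mul_zero]
      exact dil_blockSpread_zero_right hkm _ j x t
    refine Sec.ext_tot fun β => ?_
    rw [← hΦ.cls ((0, z), β)]
    simp only [h0]
    rcases le_or_gt (w z) (1 / 2) with hz | hz
    · have h1 := isRep_rho c hc h (K := L) continuous_id (s := fun _ => b (r z))
        ((hFz z).comp lam.continuous)
      rw [ha'1 z hz, ← (isRep_mu h hj hs (rho c hc h (b (r z))) hkM h1).cls β, hv1 z hz]
      rfl
    · have h1 := isRep_squeeze k hj (v z) (a ⟨r z, hr1 z hz.le⟩) hkM (hfaz _)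
      rw [ha'2 z hz, ← (isRep_mu h hj hs _ hkM h1).cls β]
      simp only [hcollar z hz]
      congr 1
      funext t
      congr 1
      funext x
      rw [dil_dil (one_le_spread zero_le_one), dil_dil (one_le_spread (v z).2.1)]
      simp only [mul_comm]
  refine ⟨⟨a', ha'c⟩, fun y => ?_, ?_⟩
  · have hy := hr2 y y.2
    have hz : 1 / 2 < w y := by rw [hy.2]; norm_num
    refine (ha'2 y hz).trans ?_
    rw [hv0 y y.2, squeeze_zero]
    congr 1
    exact Subtype.ext hy.1
  · refine ContinuousMap.HomotopicRel.trans (g := b.comp r) ⟨⟨⟨⟨Φ, hΦc⟩, hΦ0, fun z => ?_⟩,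
      fun τ z hz => ?_⟩⟩ (homotopicRel_cube b r fun z hz => (hr2 z hz).1)
    · refine hΦ1 (1, z) fun i => ?_
      have h1 : σ' 1 = 0 := Set.projIcc_of_le_left zero_le_one (by norm_num)
      have h2 : ω' 1 = 0 := Set.projIcc_of_le_left zero_le_one (by norm_num)
      simp only [S, h1, h2, blockSpread]
      split_ifs <;> simp
    · have hS0 : ∀ τ i, S (τ, z) i = 1 := by
        intro τ i
        simp only [S, hv0 z hz, blockSpread]
        split_ifs <;> simp
      exact (hΦ1 (τ, z) (hS0 τ)).trans ((hΦ1 (0, z) (hS0 0)).symm.trans (hΦ0 z))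

end WeakEquiv

/-! ### Duality maps -/

section ThomPoint

variable {B W V : Type*} [TopologicalSpace B] [TopologicalSpace W] [NormedAddCommGroup V]
  [NormedSpace ℝ V]

open Classical in
/-- The map `W → D(ξ) / (S(ξ) ∪ D(ξ_A))` that sends a point `w` of the fiber under `d = (b, v)`
to `(w, v)`, and the points of other fibers to the base point. -/
def thomPt (p : C(W, B)) (ν : B → Submodule ℝ V) (δ : ℝ) (A : Set B)
    (d : Disk (ContinuousMap.id B) ν δ) (w : W) : ThomQuo p ν δ A :=
  if hw : p w = d.1.1 then (fibToThom p ν δ A d).toMap (Sum.inl ⟨w, trivial, hw⟩) else pt _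

variable {p : C(W, B)} {ν : B → Submodule ℝ V} {δ : ℝ} {A : Set B}

theorem fibToThom_inl (d : Disk (ContinuousMap.id B) ν δ) (w : Fib p Set.univ d.1.1) :
    (fibToThom p ν δ A d).toMap (Sum.inl w) = thomPt p ν δ A d w.1 := by
  rw [thomPt, dif_pos w.2.2]

theorem thomPt_eq_mk {d : Disk (ContinuousMap.id B) ν δ} {w : W} (hw : p w = d.1.1) :
    thomPt p ν δ A d w = Quo.mk _ (fibToDisk p ν δ d ⟨w, trivial, hw⟩) := dif_pos hw

theorem Quo.mk_eq_pt {X : Type*} {A : Set X} {x : X} (hx : x ∈ A) : Quo.mk A x = pt (Quo A) :=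
  Quotient.sound (Or.inr ⟨Or.inr ⟨x, hx, rfl⟩, Or.inl rfl⟩)

theorem thomPt_eq_pt {d : Disk (ContinuousMap.id B) ν δ} (hd : ‖d.1.2‖ = δ ∨ d.1.1 ∈ A) (w : W) :
    thomPt p ν δ A d w = pt _ := by
  by_cases hw : p w = d.1.1
  · rw [thomPt_eq_mk hw]
    refine Quo.mk_eq_pt (hd.imp id fun h => ?_)
    change p w ∈ A
    rwa [hw]
  · exact dif_neg hw

theorem continuousOn_thomPt : ContinuousOn
    (fun z : Disk (ContinuousMap.id B) ν δ × W => thomPt p ν δ A z.1 z.2)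
    {z | p z.2 = z.1.1.1} := by
  rw [continuousOn_iff_continuous_domRestrict]
  have hc : Continuous fun z : {z : Disk (ContinuousMap.id B) ν δ × W | p z.2 = z.1.1.1} =>
      (⟨(z.1.2, z.1.1.1.2), fibToDisk_mem p ν δ z.1.1 ⟨z.1.2, trivial, z.2⟩⟩ : Disk p ν δ) :=
    Continuous.subtype_mk (by fun_prop) _
  exact ((Quo.continuous_mk _).comp hc).congr fun z => (thomPt_eq_mk z.2).symm

/-- Continuity of the maps from the fibers to the Thom space. -/
theorem continuous_zmap_thomPt {Γ : Type*} [TopologicalSpace Γ] [HasBase Γ] [T1Space Γ]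
    [T2Space B] [LocallyCompactSpace (Disk (ContinuousMap.id B) ν δ)]
    {X : Type*} [TopologicalSpace X] {d : X → Disk (ContinuousMap.id B) ν δ} (hd : Continuous d)
    {ζ : X → Smash (Plus W) Γ} (hζ : Continuous ζ)
    (ho : ∀ x, Over {w | w ∈ Set.univ ∧ p w = (d x).1.1} (ζ x)) :
    Continuous fun x => zmap (thomPt p ν δ A (d x)) (ζ x) :=
  continuous_zmap_fiberwise (M := {z : Disk (ContinuousMap.id B) ν δ × W | p z.2 = z.1.1.1})
    (isClosed_eq (by fun_prop) (by fun_prop)) continuousOn_thomPt hd hζ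
    fun x => (ho x).mono fun _ hw => hw.2

end ThomPoint

section ThomSum

variable {B W V : Type*} [TopologicalSpace B] [TopologicalSpace W] [NormedAddCommGroup V]
  [NormedSpace ℝ V] {p : C(W, B)} {ν : B → Submodule ℝ V} {δ : ℝ} {d0 d1 : Set B}
  {G : Prespectrum.{u}} {N : ℕ}

/-- An immersed tube in the cube, with dilations that separate the different points with the same
image: a map `e` from the disk bundle to the interior of the cube that is open on the interior of
the disk bundle, together with dilations of the first `K` loop coordinates, with factors `S` and
centres `a`, that squeeze the loops at different points of a fiber of `e` into disjoint boxes. -/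
structure IsSeparatedTube (ν : B → Submodule ℝ V) (δ : ℝ) (bd : Set B)
    (e : Disk (ContinuousMap.id B) ν δ → Fin N → I) (S : ℕ → ℝ)
    (a : Disk (ContinuousMap.id B) ν δ → ℕ → I) (K : ℕ) : Prop where
  continuous : Continuous e
  notMem_boundary : ∀ d, e d ∉ Cube.boundary (Fin N)
  isOpen_image : ∀ U : Set (Disk (ContinuousMap.id B) ν δ), IsOpen U →
    (∀ d ∈ U, ‖d.1.2‖ < δ ∧ d.1.1 ∉ bd) → IsOpen (e '' U)
  continuous_centre : Continuous a
  one_le : ∀ i, 1 ≤ S i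
  eq_one : ∀ i ≥ K, S i = 1
  sep : ∀ d d', e d = e d' → d ≠ d' → ∃ i < K, 4 ≤ S i ∧ 1 / 2 ≤ |(a d i : ℝ) - a d' i|

/-- The summands of the duality map. -/
def thomTerm (p : C(W, B)) (d1 : Set B) {m : ℕ} (S : ℕ → ℝ)
    (a : Disk (ContinuousMap.id B) ν δ → ℕ → I)
    (f : B → (Fin m → I) → Smash (Plus W) (G.space m)) (t : Fin m → I)
    (d : Disk (ContinuousMap.id B) ν δ) : Smash (ThomQuo p ν δ d1) (G.space m) :=
  zmap (thomPt p ν δ d1 d) (f d.1.1 (dil S (a d) t))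

namespace IsSeparatedTube

variable {e : Disk (ContinuousMap.id B) ν δ → Fin N → I} {S : ℕ → ℝ}
  {a : Disk (ContinuousMap.id B) ν δ → ℕ → I} {K : ℕ}

theorem uniqueOver (h : IsSeparatedTube ν δ (d0 ∪ d1) e S a K) {s : Sec G p Set.univ d0} {m : ℕ}
    (hm : K ≤ m) {f : B → (Fin m → I) → Smash (Plus W) (G.space m)} (hf : IsRep s.tot m f)
    (t : Fin m → I) : UniqueOver e (thomTerm p d1 S a f t) := by
  refine uniqueOver_of_dil (S := S) (a := a) (fun d d' hd hdd => ?_)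
    (f := fun d t => zmap (thomPt p ν δ d1 d) (f d.1.1 t)) (fun d t ht => ?_) t
  · obtain ⟨i, hi, h1⟩ := h.sep d d' hd hdd
    exact ⟨i, hi.trans_le hm, h1⟩
  · rw [hf.bdry _ t ht, zmap_pt]

theorem thomTerm_bdry (h : IsSeparatedTube ν δ (d0 ∪ d1) e S a K) {s : Sec G p Set.univ d0}
    {m : ℕ} {f : B → (Fin m → I) → Smash (Plus W) (G.space m)} (hf : IsRep s.tot m f)
    {t : Fin m → I} (ht : t ∈ Cube.boundary (Fin m)) (d : Disk (ContinuousMap.id B) ν δ) :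
    thomTerm p d1 S a f t d = pt _ := by
  rw [thomTerm, hf.bdry _ _ (dil_mem_boundary h.one_le ht), zmap_pt]

end IsSeparatedTube

theorem thomTerm_eq_pt {s : Sec G p Set.univ d0}
    {m : ℕ} {f : B → (Fin m → I) → Smash (Plus W) (G.space m)} (hf : IsRep s.tot m f)
    (S : ℕ → ℝ) (a : Disk (ContinuousMap.id B) ν δ → ℕ → I) (t : Fin m → I)
    {d : Disk (ContinuousMap.id B) ν δ} (hd : ¬(‖d.1.2‖ < δ ∧ d.1.1 ∉ d0 ∪ d1)) :
    thomTerm p d1 S a f t d = pt _ := by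
  by_cases h0 : d.1.1 ∈ d0
  · rw [thomTerm, hf.eq_pt (s.tot_eq_pt h0), zmap_pt]
  · refine zmap_eq_pt_of_forall (fun w => thomPt_eq_pt ?_ w) _
    by_cases h1 : d.1.1 ∈ d1
    · exact Or.inr h1
    · left
      refine le_antisymm d.2.2 (not_lt.1 fun hlt => hd ⟨hlt, ?_⟩)
      rintro (h | h)
      · exact h0 h
      · exact h1 h

variable [T2Space B] [T2Space W] [CompactSpace (Disk (ContinuousMap.id B) ν δ)] [CompactSpace B]
  [CompactSpace W]

omit [T2Space W] [CompactSpace B] [CompactSpace W] in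
theorem continuous_fsum_thomTerm {T : Type*} [TopologicalSpace T] [CompactSpace T] [T2Space T]
    {P : Type*} [TopologicalSpace P] [CompactSpace P] [T2Space P]
    {e : T → Disk (ContinuousMap.id B) ν δ → Fin N → I} {S : T → ℕ → ℝ}
    {a : Disk (ContinuousMap.id B) ν δ → ℕ → I} {K : ℕ}
    (he : Continuous fun z : T × Disk (ContinuousMap.id B) ν δ => e z.1 z.2) (hS : Continuous S)
    (h : ∀ τ, IsSeparatedTube ν δ (d0 ∪ d1) (e τ) (S τ) a K)
    (hopen : ∀ U : Set (Disk (ContinuousMap.id B) ν δ), IsOpen U →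
      (∀ d ∈ U, ‖d.1.2‖ < δ ∧ d.1.1 ∉ d0 ∪ d1) →
      IsOpen {z : T × (Fin N → I) | ∃ d ∈ U, e z.1 d = z.2})
    {s : P → Sec G p Set.univ d0} {m : ℕ} (hm : K ≤ m)
    {f : P × B → (Fin m → I) → Smash (Plus W) (G.space m)}
    (hf : IsRep (fun z : P × B => (s z.1).tot z.2) m f) :
    Continuous fun z : ((T × P) × (Fin N → I)) × (Fin m → I) =>
      fsum (e z.1.1.1) (thomTerm p d1 (S z.1.1.1) a (fun b => f (z.1.1.2, b)) z.2) z.1.2 := by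
  rcases isEmpty_or_nonempty T with hT | ⟨⟨τ₀⟩⟩
  · have : IsEmpty (((T × P) × (Fin N → I)) × (Fin m → I)) := by
      infer_instance
    exact continuous_of_const fun x => isEmptyElim x
  have ha := (h τ₀).continuous_centre
  have hfz : ∀ z, IsRep (s z).tot m (fun b => f (z, b)) := fun z =>
    hf.comp (g := fun b : B => (z, b)) (by fun_prop)
  have hg : Continuous fun z : ((T × P) × (Fin m → I)) × Disk (ContinuousMap.id B) ν δ =>
      thomTerm p d1 (S z.1.1.1) a (fun b => f (z.1.1.2, b)) z.1.2 z.2 := by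
    refine continuous_zmap_thomPt continuous_snd (hf.cont.comp (Continuous.prodMk (by fun_prop)
      (continuous_dil (hS.comp (by fun_prop)) (ha.comp (by fun_prop)) (by fun_prop)))) fun z => ?_
    exact (s z.1.1.2).over ((hfz z.1.1.2).isLoop _) ((hfz z.1.1.2).cls _) _
  have := continuous_fsum (T := (T × P) × (Fin m → I)) (Y := Fin N → I)
    (e := fun z => e z.1.1.1 z.2)
    (g := fun z => thomTerm p d1 (S z.1.1.1) a (fun b => f (z.1.1.2, b)) z.1.2 z.2)
    (he.comp (by fun_prop : Continuous fun z : ((T × P) × (Fin m → I)) ×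
      Disk (ContinuousMap.id B) ν δ => (z.1.1.1, z.2))) hg
    {d | ‖d.1.2‖ < δ ∧ d.1.1 ∉ d0 ∪ d1}
    (fun z d hd => thomTerm_eq_pt (hfz z.1.2) _ _ _ hd)
    (fun U hU hUV => (hopen U hU fun d hd => hUV hd).preimage
      (by fun_prop : Continuous fun z : ((T × P) × (Fin m → I)) × (Fin N → I) => (z.1.1.1, z.2)))
    (fun z => (h z.1.1).uniqueOver hm (hfz z.1.2) z.2)
  exact this.comp (by fun_prop : Continuous fun z : ((T × P) × (Fin N → I)) × (Fin m → I) =>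
    ((z.1.1, z.2), z.1.2))

section Single

variable {e : Disk (ContinuousMap.id B) ν δ → Fin N → I} {S : ℕ → ℝ}
  {a : Disk (ContinuousMap.id B) ν δ → ℕ → I} {K : ℕ}

omit [T2Space W] [CompactSpace B] [CompactSpace W] in
theorem IsSeparatedTube.continuous_fsum (h : IsSeparatedTube ν δ (d0 ∪ d1) e S a K)
    {s : Sec G p Set.univ d0} {m : ℕ} (hm : K ≤ m)
    {f : B → (Fin m → I) → Smash (Plus W) (G.space m)} (hf : IsRep s.tot m f) :
    Continuous fun z : (Fin N → I) × (Fin m → I) => fsum e (thomTerm p d1 S a f z.2) z.1 := by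
  have := continuous_fsum_thomTerm (T := Unit) (P := Unit) (e := fun _ => e) (S := fun _ => S)
    (h.continuous.comp continuous_snd) continuous_const (fun _ => h)
    (fun U hU hUV => by
      exact (h.isOpen_image U hU hUV).preimage continuous_snd)
    (s := fun _ => s) hm (f := fun z => f z.2) (hf.comp continuous_snd)
  exact this.comp (by fun_prop : Continuous fun z : (Fin N → I) × (Fin m → I) =>
    ((((), ()), z.1), z.2))

omit [T2Space W] [CompactSpace B] [CompactSpace W] in
theorem IsSeparatedTube.isLoop_fsum (h : IsSeparatedTube ν δ (d0 ∪ d1) e S a K)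
    {s : Sec G p Set.univ d0} {m : ℕ} (hm : K ≤ m)
    {f : B → (Fin m → I) → Smash (Plus W) (G.space m)} (hf : IsRep s.tot m f) (y : Fin N → I) :
    IsLoop (fun t => fsum e (thomTerm p d1 S a f t) y) :=
  ⟨(h.continuous_fsum hm hf).comp (continuous_const.prodMk continuous_id),
    fun _ ht => fsum_eq_pt fun d _ => h.thomTerm_bdry hf ht d⟩

theorem IsSeparatedTube.exists_thomSum (h : IsSeparatedTube ν δ (d0 ∪ d1) e S a K)
    (s : Sec G p Set.univ d0) :
    ∃ ψ : Ω^ (Fin N) (RedHom G (ThomQuo p ν δ d1)) (pt _), ∀ m ≥ K, ∀ f, IsRep s.tot m f →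
      ∀ y, ψ y = cls G m (fun t => fsum e (thomTerm p d1 S a f t) y) := by
  obtain ⟨m₀, hm₀⟩ := exists_isRep s.continuous_tot
  obtain ⟨f₀, hf₀⟩ := hm₀ (max m₀ K) (le_max_left _ _)
  have hm := le_max_right m₀ K
  refine ⟨⟨⟨fun y => cls G _ (fun t => fsum e (thomTerm p d1 S a f₀ t) y),
    continuous_cls (h.continuous_fsum hm hf₀) fun y => (h.isLoop_fsum hm hf₀ y).2⟩,
    fun y hy => ?_⟩, fun m hm' f hf y => ?_⟩
  · rw [← cls_pt (max m₀ K)]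
    refine congrArg (cls G _) (funext fun t => fsum_eq_pt fun d hd => ?_)
    exact absurd hy (hd ▸ h.notMem_boundary d)
  · refine IsRep.eq_of_rstab (q := s.tot)
      (fun m f => cls G m (fun t => fsum e (thomTerm p d1 S a f t) y)) K
      (fun m hm f hf => ?_) hm hm' hf₀ hf
    rw [← cls_rstab (h.isLoop_fsum hm hf y)]
    congr 1
    funext t
    refine Eq.trans ?_ ((h.uniqueOver hm hf _).fsum_map
      (φ := fun ζ => smashSusp G (ThomQuo p ν δ d1) m (ζ, t (Fin.last m))) (smashSusp_pt G m _) y)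
    congr 1
    funext d
    refine (congrArg (zmap _) (rstab_dil (f d.1.1) (h.eq_one m hm) t)).trans ?_
    exact zmap_smashSusp G _ _ _

/-- The sum of the values of a section, placed along the immersed tube `e`. For an embedding `e`
this is the duality map. -/
def thomSum (h : IsSeparatedTube ν δ (d0 ∪ d1) e S a K) (s : Sec G p Set.univ d0) :
    Ω^ (Fin N) (RedHom G (ThomQuo p ν δ d1)) (pt _) := (h.exists_thomSum s).choose

theorem thomSum_apply (h : IsSeparatedTube ν δ (d0 ∪ d1) e S a K) (s : Sec G p Set.univ d0)
    {m : ℕ} (hm : K ≤ m) {f : B → (Fin m → I) → Smash (Plus W) (G.space m)}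
    (hf : IsRep s.tot m f) (y : Fin N → I) :
    thomSum h s y = cls G m (fun t => fsum e (thomTerm p d1 S a f t) y) :=
  (h.exists_thomSum s).choose_spec m hm f hf y

end Single

theorem continuous_thomSum_family {T : Type*} [TopologicalSpace T] [CompactSpace T] [T2Space T]
    {e : T → Disk (ContinuousMap.id B) ν δ → Fin N → I} {S : T → ℕ → ℝ}
    {a : Disk (ContinuousMap.id B) ν δ → ℕ → I} {K : ℕ}
    (he : Continuous fun z : T × Disk (ContinuousMap.id B) ν δ => e z.1 z.2) (hS : Continuous S)
    (h : ∀ τ, IsSeparatedTube ν δ (d0 ∪ d1) (e τ) (S τ) a K)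
    (hopen : ∀ U : Set (Disk (ContinuousMap.id B) ν δ), IsOpen U →
      (∀ d ∈ U, ‖d.1.2‖ < δ ∧ d.1.1 ∉ d0 ∪ d1) →
      IsOpen {z : T × (Fin N → I) | ∃ d ∈ U, e z.1 d = z.2})
    {n : ℕ} {s : (Fin n → I) → Sec G p Set.univ d0} (hs : Continuous s) :
    Continuous fun z : T × (Fin n → I) => thomSum (h z.1) (s z.2) := by
  obtain ⟨m₀, hm₀⟩ := exists_isRep (continuous_tot_family hs)
  obtain ⟨f, hf⟩ := hm₀ (max m₀ K) (le_max_left _ _)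
  have hm := le_max_right m₀ K
  have hfz : ∀ z, IsRep (s z).tot (max m₀ K) (fun b => f (z, b)) := fun z =>
    hf.comp (g := fun b : B => (z, b)) (by fun_prop)
  refine Continuous.subtype_mk (ContinuousMap.continuous_of_continuous_uncurry _ ?_) _
  refine (continuous_cls (G := G) (continuous_fsum_thomTerm he hS h hopen hm hf) fun z =>
    ((h z.1.1).isLoop_fsum hm (hfz z.1.2) z.2).2).congr fun z => ?_
  exact (thomSum_apply (h z.1.1) (s z.1.2) hm (hfz z.1.2) z.2).symm

theorem continuous_thomSum {e : Disk (ContinuousMap.id B) ν δ → Fin N → I} {S : ℕ → ℝ}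
    {a : Disk (ContinuousMap.id B) ν δ → ℕ → I} {K : ℕ}
    (h : IsSeparatedTube ν δ (d0 ∪ d1) e S a K) :
    Continuous (thomSum (G := G) (p := p) h) := by
  refine continuous_of_cube_families fun n s hs => ?_
  have := continuous_thomSum_family (T := Unit) (e := fun _ => e) (S := fun _ => S)
    (h.continuous.comp continuous_snd) continuous_const (fun _ => h)
    (fun U hU hUV => by
      exact (h.isOpen_image U hU hUV).preimage continuous_snd) hs
  exact this.comp (by fun_prop : Continuous fun z : Fin n → I => ((), z))

/-- For an embedded tube, the sum along the tube is the duality map. -/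
theorem isDualityMap_thomSum {t : Disk (ContinuousMap.id B) ν δ → EuclideanSpace ℝ (Fin N)}
    {e : Disk (ContinuousMap.id B) ν δ → Fin N → I} (het : ∀ d k, (e d k : ℝ) = t d k)
    (hinj : Function.Injective e) {a : Disk (ContinuousMap.id B) ν δ → ℕ → I}
    (h : IsSeparatedTube ν δ (d0 ∪ d1) e (fun _ => 1) a 0) :
    IsDualityMap G p d0 d1 ν δ t ⟨thomSum h, continuous_thomSum h⟩ where
  apply_tube s d z hz := by
    obtain ⟨m, hm⟩ := exists_isRep s.continuous_tot
    obtain ⟨f, hf⟩ := hm m le_rfl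
    obtain rfl : e d = z := funext fun k => Subtype.ext ((het d k).trans (hz k).symm)
    refine (thomSum_apply h s (Nat.zero_le m) hf _).trans ?_
    rw [s.redMap_val (isClosed_fib_univ _) (hf.isLoop _) (hf.cls _) (fibToThom p ν δ d1 d)
      (thomPt p ν δ d1 d) fun w => fibToThom_inl d w]
    congr 1
    funext t'
    rw [fsum_eq (x := d) rfl fun d' hd' _ => by rw [hinj hd']]
    simp only [thomTerm]
    rw [dil_one fun _ _ => rfl]
  apply_compl s z hz := by
    obtain ⟨m, hm⟩ := exists_isRep s.continuous_tot
    obtain ⟨f, hf⟩ := hm m le_rfl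
    refine (thomSum_apply h s (Nat.zero_le m) hf _).trans ?_
    rw [← cls_pt m]
    refine congrArg (cls G m) (funext fun t' => fsum_eq_pt fun d hd => ?_)
    obtain ⟨k, hk⟩ := hz d
    exact absurd ((congrArg Subtype.val (congrFun hd k)).symm.trans (het d k)) hk

end ThomSum

/-! ### Deformation of tubes -/

section Tubes

/-- The point of the unit cube with given coordinates. -/
def cubePt {N : ℕ} (x : EuclideanSpace ℝ (Fin N)) : Fin N → I :=
  fun k => Set.projIcc 0 1 zero_le_one (x k)

variable {N : ℕ}

theorem continuous_cubePt : Continuous (cubePt (N := N)) :=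
  continuous_pi fun k => continuous_projIcc.comp (by fun_prop)

theorem cubePt_apply {x : EuclideanSpace ℝ (Fin N)} (hx : ∀ k, 0 < x k ∧ x k < 1) (k : Fin N) :
    (cubePt x k : ℝ) = x k :=
  congrArg Subtype.val (Set.projIcc_of_mem zero_le_one
    (show x k ∈ Set.Icc (0 : ℝ) 1 from ⟨(hx k).1.le, (hx k).2.le⟩))

theorem cubePt_notMem_boundary {x : EuclideanSpace ℝ (Fin N)} (hx : ∀ k, 0 < x k ∧ x k < 1) :
    cubePt x ∉ Cube.boundary (Fin N) := by
  rintro ⟨k, hk⟩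
  have h1 := cubePt_apply hx k
  have h2 := hx k
  rcases hk with hk | hk <;> rw [hk] at h1
  · exact h2.1.ne h1
  · exact h2.2.ne h1.symm

theorem cubePt_injOn {x y : EuclideanSpace ℝ (Fin N)} (hx : ∀ k, 0 < x k ∧ x k < 1)
    (hy : ∀ k, 0 < y k ∧ y k < 1) (h : cubePt x = cubePt y) : x = y := by
  ext k
  rw [← cubePt_apply hx, h, cubePt_apply hy]

theorem isOpen_cubePt {T X : Type*} [TopologicalSpace T] {H : T × X → EuclideanSpace ℝ (Fin N)}
    (hH : ∀ z k, 0 < H z k ∧ H z k < 1) {U : Set X}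
    (hU : IsOpen {z : T × EuclideanSpace ℝ (Fin N) | ∃ d ∈ U, H (z.1, d) = z.2}) :
    IsOpen {z : T × (Fin N → I) | ∃ d ∈ U, cubePt (H (z.1, d)) = z.2} := by
  have hc : Continuous fun y : Fin N → I => (WithLp.toLp 2 fun k => (y k : ℝ) :
      EuclideanSpace ℝ (Fin N)) := (PiLp.continuous_toLp 2 _).comp (by fun_prop)
  convert hU.preimage (continuous_fst.prodMk (hc.comp continuous_snd)) using 1
  ext ⟨τ, y⟩
  refine exists_congr fun d => and_congr_right fun _ => ⟨?_, ?_⟩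
  · intro h
    ext k
    refine (cubePt_apply (hH _) k).symm.trans ?_
    exact congrArg (fun y : Fin N → I => (y k : ℝ)) h
  · intro h
    funext k
    apply Subtype.ext
    refine (cubePt_apply (hH _) k).trans ?_
    exact congrArg (fun x : EuclideanSpace ℝ (Fin N) => x k) h

variable {L V : Type*} [TopologicalSpace L] [NormedAddCommGroup V] [NormedSpace ℝ V]
  {ν : L → Submodule ℝ V} {δ : ℝ} {bd : Set L}
  {t t' : Disk (ContinuousMap.id L) ν δ → EuclideanSpace ℝ (Fin N)}

theorem IsTubular.injective_cubePt (ht : IsTubular ν δ bd t) :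
    Function.Injective fun d => cubePt (t d) :=
  fun d d' h => ht.injective (cubePt_injOn (ht.mem_cube d) (ht.mem_cube d') h)

/-- An embedded tube needs no dilations. -/
theorem IsTubular.isSeparatedTube (ht : IsTubular ν δ bd t) :
    IsSeparatedTube ν δ bd (fun d => cubePt (t d)) (fun _ => 1) (fun _ _ => 0) 0 where
  continuous := continuous_cubePt.comp ht.continuous
  notMem_boundary d := cubePt_notMem_boundary (ht.mem_cube d)
  isOpen_image U hU hUV := by
    have h1 : IsOpen {z : Unit × EuclideanSpace ℝ (Fin N) | ∃ d ∈ U, t d = z.2} :=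
      (ht.isOpen_image U hU hUV).preimage continuous_snd
    exact (isOpen_cubePt (H := fun z : Unit × _ => t z.2) (fun z => ht.mem_cube z.2) h1).preimage
      (by fun_prop : Continuous fun y : Fin N → I => ((), y))
  continuous_centre := continuous_const
  one_le _ := le_rfl
  eq_one _ _ := rfl
  sep d d' h hd := absurd (ht.injective_cubePt h) hd

/-- Dilation factors `1 + 3 c` in the first `k` directions and `1 + 3 c'` in the next `k'`
directions. -/
def splitSpread (k k' : ℕ) (c c' : ℝ) (i : ℕ) : ℝ :=
  if i < k then 1 + 3 * c else if i < k + k' then 1 + 3 * c' else 1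

theorem continuous_splitSpread (k k' : ℕ) :
    Continuous fun c : ℝ × ℝ => splitSpread k k' c.1 c.2 := by
  refine continuous_pi fun i => ?_
  unfold splitSpread
  split_ifs <;> fun_prop

/-- A regular homotopy of tubes, together with dilations that separate the double points: at the
end the double points are separated by the coordinates `j`, meanwhile by other coordinates. -/
theorem RegularlyHomotopic.exists_separatedTubes [T2Space L]
    [CompactSpace (Disk (ContinuousMap.id L) ν δ)] (ht : IsTubular ν δ bd t)
    (h : RegularlyHomotopic ν δ bd t t') {j : L → ℕ → I} (hj : Continuous j) {k : ℕ}
    (hs : ∀ d d', t' d = t' d' → d ≠ d' → ∃ i < k, 1 / 2 ≤ |(j d.1.1 i : ℝ) - j d'.1.1 i|) :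
    ∃ (K : ℕ) (e : I → Disk (ContinuousMap.id L) ν δ → Fin N → I) (S : I → ℕ → ℝ)
      (a : Disk (ContinuousMap.id L) ν δ → ℕ → I), k ≤ K ∧
      (Continuous fun z : I × Disk (ContinuousMap.id L) ν δ => e z.1 z.2) ∧ Continuous S ∧
      (∀ τ, IsSeparatedTube ν δ bd (e τ) (S τ) a K) ∧
      (∀ U : Set (Disk (ContinuousMap.id L) ν δ), IsOpen U →
        (∀ d ∈ U, ‖d.1.2‖ < δ ∧ d.1.1 ∉ bd) →
        IsOpen {z : I × (Fin N → I) | ∃ d ∈ U, e z.1 d = z.2}) ∧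
      (∀ d, e 0 d = cubePt (t d)) ∧ (∀ d, e 1 d = cubePt (t' d)) ∧ (∀ i, S 0 i = 1) ∧
      ∀ (m : ℕ) (u : Fin m → I) (d), dil (S 1) (a d) u = dil (spread k 1) (j d.1.1) u := by
  obtain ⟨H, hH0, hH1, hHc, hHinj, hHopen⟩ := h
  let D := Disk (ContinuousMap.id L) ν δ
  -- the double points of the track form a closed set
  let R₀ : Set (I × D × D) := {z | H (z.1, z.2.1) = H (z.1, z.2.2) ∧ z.2.1 ≠ z.2.2}
  have hR₀ : IsClosed R₀ := by
    rw [← isOpen_compl_iff, isOpen_iff_mem_nhds]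
    rintro ⟨τ, d, d'⟩ hz
    by_cases hd : d = d'
    · subst hd
      obtain ⟨U, hU, hUi⟩ := hHinj (τ, d)
      have h1 : Filter.Tendsto (fun z : I × D × D => (z.1, z.2.1)) (𝓝 (τ, d, d)) (𝓝 (τ, d)) :=
        (by fun_prop : Continuous fun z : I × D × D => (z.1, z.2.1)).tendsto (τ, d, d)
      have h2 : Filter.Tendsto (fun z : I × D × D => (z.1, z.2.2)) (𝓝 (τ, d, d)) (𝓝 (τ, d)) :=
        (by fun_prop : Continuous fun z : I × D × D => (z.1, z.2.2)).tendsto (τ, d, d)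
      filter_upwards [h1 hU, h2 hU] with z hz1 hz2 hzR
      exact hzR.2 (congrArg Prod.snd (hUi hz1 hz2 (Prod.ext rfl hzR.1)))
    · have hne : H (τ, d) ≠ H (τ, d') := fun he => hz ⟨he, hd⟩
      have ho : IsOpen {z : I × D × D | H (z.1, z.2.1) ≠ H (z.1, z.2.2)} :=
        isOpen_ne_fun (by fun_prop) (by fun_prop)
      filter_upwards [ho.mem_nhds hne] with z hz hzR
      exact hz hzR.1
  let R : Set (D × D) := Prod.snd '' R₀
  have hR : IsClosed R := isClosedMap_snd_of_compactSpace _ hR₀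
  obtain ⟨k', j', hj', hs'⟩ := exists_separating hR (by
    rintro d ⟨z, hz, hzd⟩
    exact hz.2 (by rw [hzd]))
  -- the homotopy runs during `[1/3, 2/3]`; the second dilations are at full size during `[1/3, 5/6]`,
  -- and the first ones from `5/6` on
  let h' : I → I := fun τ => Set.projIcc 0 1 zero_le_one (3 * (τ : ℝ) - 1)
  let c' : I → I := fun τ => Set.projIcc 0 1 zero_le_one (6 * (τ : ℝ) - 4)
  let c'' : I → I := fun τ => Set.projIcc 0 1 zero_le_one (min (3 * (τ : ℝ)) (6 - 6 * τ))
  have hh' : Continuous h' := continuous_projIcc.comp (by fun_prop)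
  have hc' : Continuous c' := continuous_projIcc.comp (by fun_prop)
  have hc'' : Continuous c'' := continuous_projIcc.comp (by fun_prop)
  have hcases : ∀ τ, h' τ = 0 ∨ c'' τ = 1 ∨ (h' τ = 1 ∧ c' τ = 1) := by
    intro τ
    rcases le_total (τ : ℝ) (1 / 3) with h1 | h1
    · exact Or.inl (Set.projIcc_of_le_left zero_le_one (by linarith))
    · rcases le_total (τ : ℝ) (5 / 6) with h2 | h2
      · exact Or.inr (Or.inl (Set.projIcc_of_right_le zero_le_one
          (le_min (by linarith) (by linarith))))
      · exact Or.inr (Or.inr ⟨Set.projIcc_of_right_le zero_le_one (by linarith),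
          Set.projIcc_of_right_le zero_le_one (by linarith)⟩)
  have hopen : ∀ U : Set D, IsOpen U → (∀ d ∈ U, ‖d.1.2‖ < δ ∧ d.1.1 ∉ bd) →
      IsOpen {z : I × (Fin N → I) | ∃ d ∈ U, cubePt (H (h' z.1, d)) = z.2} := by
    intro U hU hUV
    refine isOpen_cubePt (H := fun z : I × D => H (h' z.1, z.2)) (fun z => hHc _) ?_
    have h1 := hHopen (Set.univ ×ˢ U) (isOpen_univ.prod hU) fun z hz => hUV _ hz.2
    convert h1.preimage ((hh'.comp continuous_fst).prodMk continuous_snd) using 1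
    ext ⟨τ, x⟩
    constructor
    · rintro ⟨d, hd, hx⟩
      exact ⟨(h' τ, d), ⟨trivial, hd⟩, Prod.ext rfl hx⟩
    · rintro ⟨⟨τ', d⟩, hd, he⟩
      obtain ⟨h1, h2⟩ := Prod.mk.inj he
      have h1' : τ' = h' τ := h1
      subst h1'
      exact ⟨d, hd.2, h2⟩
  let a : D → ℕ → I := fun d i => if i < k then j d.1.1 i else j' d (i - k)
  have ha1 : ∀ d, ∀ i < k, a d i = j d.1.1 i := fun d i hi => if_pos hi
  have ha2 : ∀ d i, a d (k + i) = j' d i := fun d i => by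
    simp only [a]
    rw [if_neg (by omega), Nat.add_sub_cancel_left]
  refine ⟨k + k', fun τ d => cubePt (H (h' τ, d)), fun τ => splitSpread k k' (c' τ) (c'' τ), a,
    Nat.le_add_right _ _, continuous_cubePt.comp (H.continuous.comp (by fun_prop)), ?_,
    fun τ => ⟨?_, ?_, ?_, ?_, ?_, ?_, ?_⟩, hopen, ?_, ?_, ?_, ?_⟩
  · exact (continuous_splitSpread k k').comp (f := fun τ : I => ((c' τ : ℝ), (c'' τ : ℝ)))
      (by fun_prop)
  · exact continuous_cubePt.comp (H.continuous.comp (by fun_prop))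
  · exact fun d => cubePt_notMem_boundary (hHc _)
  · intro U hU hUV
    exact (hopen U hU hUV).preimage (by fun_prop : Continuous fun y : Fin N → I => (τ, y))
  · refine continuous_pi fun i => ?_
    simp only [a]
    split_ifs
    · exact (continuous_apply i).comp (hj.comp (by fun_prop))
    · exact (continuous_apply _).comp hj'
  · intro i
    have h1 := (c' τ).2.1
    have h2 := (c'' τ).2.1
    change 1 ≤ splitSpread k k' (c' τ) (c'' τ) i
    unfold splitSpread
    split_ifs <;> linarith
  · intro i hi
    change splitSpread k k' _ _ i = 1
    rw [splitSpread, if_neg (by omega), if_neg (by omega)]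
  · intro d d' he hd
    have hHe : H (h' τ, d) = H (h' τ, d') := cubePt_injOn (hHc _) (hHc _) he
    rcases hcases τ with hτ | hτ | ⟨hτ, hτ'⟩
    · rw [hτ, hH0, hH0] at hHe
      exact absurd (ht.injective hHe) hd
    · obtain ⟨i, hi, hi'⟩ := hs' d d' ⟨(h' τ, d, d'), ⟨hHe, hd⟩, rfl⟩
      refine ⟨k + i, by omega, ?_, by rwa [ha2, ha2]⟩
      change 4 ≤ splitSpread k k' (c' τ) (c'' τ) (k + i)
      rw [splitSpread, if_neg (by omega), if_pos (by omega), hτ]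
      norm_num
    · rw [hτ, hH1, hH1] at hHe
      obtain ⟨i, hi, hi'⟩ := hs d d' hHe hd
      refine ⟨i, by omega, ?_, by rwa [ha1 d i hi, ha1 d' i hi]⟩
      change 4 ≤ splitSpread k k' (c' τ) (c'' τ) i
      rw [splitSpread, if_pos hi, hτ']
      norm_num
  · intro d
    have : h' 0 = 0 := Set.projIcc_of_le_left zero_le_one (by norm_num)
    simp only [this, hH0]
  · intro d
    have : h' 1 = 1 := Set.projIcc_of_right_le zero_le_one (by norm_num)
    simp only [this, hH1]
  · intro i
    have h1 : c' 0 = 0 := Set.projIcc_of_le_left zero_le_one (by norm_num)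
    have h2 : c'' 0 = 0 := Set.projIcc_of_le_left zero_le_one (by norm_num)
    simp only [h1, h2, splitSpread]
    split_ifs <;> simp
  · intro m u d
    have h1 : c' 1 = 1 := Set.projIcc_of_right_le zero_le_one (by norm_num)
    have h2 : c'' 1 = 0 := Set.projIcc_of_le_left zero_le_one (by norm_num)
    refine dil_congr (fun i _ => ⟨?_, ?_⟩) u
    · simp only [h1, h2, splitSpread, spread]
      split_ifs <;> simp
    · by_cases hi : i < k
      · exact Or.inl (ha1 d i hi)
      · right
        simp only [h2, splitSpread, if_neg hi]
        split_ifs <;> simp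

end Tubes

/-! ### The duality square -/

section Square

variable {B L W E : Type*} [TopologicalSpace B] [TopologicalSpace L] [TopologicalSpace W]
  [TopologicalSpace E] {d0L : Set L} {p : C(W, B)} {π : C(E, L)} {lam : C(L, B)} {lamT : C(E, W)}
  {G : Prespectrum.{u}} {V : Type*} [NormedAddCommGroup V] [NormedSpace ℝ V]
  {ν : B → Submodule ℝ V} {δ : ℝ} {d0B d1B : Set B} {d1L : Set L} {N : ℕ}

/-- The map of Thom spaces on fibers: it is `lamT` followed by the inclusion of the fiber of `W`. -/
theorem smash_map_thomMap {m : ℕ} (comm : ∀ e, p (lamT e) = lam (π e))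
    (hd : ∀ x ∈ d1L, lam x ∈ d1B) (d : Disk (ContinuousMap.id L) (fun x => ν (lam x)) δ)
    {ζ : Smash (Plus E) (G.space m)} (ho : Over {e | e ∈ Set.univ ∧ π e = d.1.1} ζ) :
    (Smash.map (G.space m) (thomMap p π lam lamT comm ν δ d1B d1L hd)).toMap
        (zmap (thomPt π (fun x => ν (lam x)) δ d1L d) ζ) =
      zmap (thomPt p ν δ d1B (diskCover lam ν δ d))
        (zmap (fun e => (Sum.inl (lamT e) : Plus W)) ζ) := by
  rcases el_cases ζ with rfl | ⟨e, g, hg, rfl⟩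
  · rw [zmap_pt, zmap_pt, zmap_pt]
    exact (Smash.map (G.space m) _).map_pt
  · have he : π e = d.1.1 := (ho e g hg rfl).2
    have he' : p (lamT e) = (diskCover lam ν δ d).1.1 := by
      rw [comm, he]
      rfl
    rw [zmap_inl_el, zmap_el, el, zmap, thomPt_eq_mk he]
    change Smash.mk _ = Smash.mk (thomPt p ν δ d1B (diskCover lam ν δ d) (lamT e), g)
    rw [thomPt_eq_mk he']
    rfl

variable [CompactSpace L] [T2Space L] [CompactSpace E] [T2Space E]
  [T2Space B] [CompactSpace B] [CompactSpace W] [T2Space W]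
  [CompactSpace (Disk (ContinuousMap.id B) ν δ)]
  [CompactSpace (Disk (ContinuousMap.id L) (fun x => ν (lam x)) δ)]
  {k : ℕ} {j : L → ℕ → I}

/-- The sum along the immersed tube `eB ∘ (lam, id)` is the sum over the sheets of `lam` followed by
the sum along the tube `eB`. -/
theorem loopMap_thomSum (h : IsOpenImmersion d0L p π lam lamT) (hj : Continuous j)
    (hs : Separates lam k j) (hd : ∀ x ∈ d1L, lam x ∈ d1B)
    (hA : ∀ w ∈ stratSub d0L π lamT, p w ∉ d0B)
    {eB : Disk (ContinuousMap.id B) ν δ → Fin N → I} {aB : Disk (ContinuousMap.id B) ν δ → ℕ → I}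
    (hB : IsSeparatedTube ν δ (d0B ∪ d1B) eB (fun _ => 1) aB 0) (hBi : Function.Injective eB)
    {S : ℕ → ℝ} {a : Disk (ContinuousMap.id L) (fun x => ν (lam x)) δ → ℕ → I} {K : ℕ}
    (hK : k ≤ K) {eL : Disk (ContinuousMap.id L) (fun x => ν (lam x)) δ → Fin N → I}
    (heL : ∀ d, eL d = eB (diskCover lam ν δ d))
    (hL : IsSeparatedTube (fun x => ν (lam x)) δ (d0L ∪ d1L) eL S a K)
    (hdil : ∀ (m : ℕ) (u : Fin m → I) (d), dil S (a d) u = dil (spread k 1) (j d.1.1) u)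
    (γ : Sec G π Set.univ d0L) :
    loopMap G N (thomMap p π lam lamT h.comm ν δ d1B d1L hd) (thomSum hL γ) =
      thomSum hB (iota hA (mu h hj hs γ)) := by
  obtain ⟨m₀, hm₀⟩ := exists_isRep γ.continuous_tot
  obtain ⟨f, hf⟩ := hm₀ (max m₀ K) (le_max_left _ _)
  have hm := le_max_right m₀ K
  have hmu := isRep_mu h hj hs γ (hK.trans hm) hf
  have hio : IsRep (iota hA (mu h hj hs γ)).tot (max m₀ K) _ :=
    ⟨hmu.cont, hmu.bdry, fun b => (hmu.cls b).trans (iota_tot hA _ b).symm⟩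
  ext y
  rw [thomSum_apply hB _ (Nat.zero_le _) hio y]
  refine (congrArg (redMap G _) (thomSum_apply hL γ hm hf y)).trans ?_
  rw [redMap_cls' _ (hL.isLoop_fsum hm hf y)]
  congr 1
  funext u
  have hu := hL.uniqueOver (d1 := d1L) hm hf u
  have hφ := (Smash.map (G.space (max m₀ K)) (thomMap p π lam lamT h.comm ν δ d1B d1L hd)).map_pt
  rw [← hu.fsum_map hφ y]
  -- the summands on both sides
  let g : L → Smash (Plus W) (G.space (max m₀ K)) := fun x =>
    zmap (fun e => (Sum.inl (lamT e) : Plus W)) (f x (dil (spread k 1) (j x) u))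
  have hg : UniqueOver lam g := (isSheetFamily_squeeze hs (hK.trans hm) hf).unique u
  have hl : ∀ d, (Smash.map (G.space (max m₀ K))
      (thomMap p π lam lamT h.comm ν δ d1B d1L hd)).toMap (thomTerm π d1L S a f u d) =
        zmap (thomPt p ν δ d1B (diskCover lam ν δ d)) (g d.1.1) := fun d => by
    rw [thomTerm, smash_map_thomMap h.comm hd d (γ.over (hf.isLoop _) (hf.cls _) _), hdil]
  have hr : ∀ d, thomTerm p d1B (fun _ => 1) aB (fun b t => fsum lam (fun x =>
      zmap (fun e => (Sum.inl (lamT e) : Plus W)) (f x (dil (spread k 1) (j x) t))) b) u d =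
        zmap (thomPt p ν δ d1B d) (fsum lam g d.1.1) := fun d => by
    rw [thomTerm, dil_one fun _ _ => rfl]
  simp only [hl]
  by_cases hy : ∃ d, eB d = y
  · obtain ⟨d, rfl⟩ := hy
    have h2 : fsum eB (thomTerm p d1B (fun _ => 1) aB (fun b t => fsum lam (fun x =>
        zmap (fun e => (Sum.inl (lamT e) : Plus W)) (f x (dil (spread k 1) (j x) t))) b) u)
        (eB d) = zmap (thomPt p ν δ d1B d) (fsum lam g d.1.1) := by
      rw [← hr d]
      exact fsum_eq rfl fun d' hd' _ => by rw [hBi hd']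
    rw [h2]
    rcases fsum_cases lam g d.1.1 with h' | ⟨x, hx, hgx, h'⟩
    · rw [h'.1, zmap_pt]
      refine fsum_eq_pt fun d' hd' => ?_
      have h3 : diskCover lam ν δ d' = d := hBi ((heL d').symm.trans hd')
      rw [h'.2 d'.1.1 (congrArg (fun d => d.1.1) h3), zmap_pt]
    · rw [h']
      obtain ⟨⟨b, v⟩, hv⟩ := d
      change lam x = b at hx
      subst hx
      refine fsum_eq (x := (⟨(x, v), hv⟩ : Disk (ContinuousMap.id L) (fun x => ν (lam x)) δ))
        (g := fun d => zmap (thomPt p ν δ d1B (diskCover lam ν δ d)) (g d.1.1)) (heL _)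
        fun d' hd' hgd' => ?_
      have h3 : diskCover lam ν δ d' = ⟨(lam x, v), hv⟩ := hBi ((heL d').symm.trans hd')
      have h4 : g d'.1.1 ≠ pt _ := fun h0 => hgd' (by simp only [h0, zmap_pt])
      have h5 : lam d'.1.1 = lam x := congrArg (fun d => d.1.1) h3
      simp only [h3, hg _ _ h5 h4 hgx]
      rfl
  · push Not at hy
    rw [fsum_eq_pt fun d hd => absurd hd (hy d), fsum_eq_pt fun d hd => ?_]
    exact absurd ((heL d).symm.trans hd) (hy _)

/-- The duality square commutes up to homotopy, for a tube `t` of the disk bundle over `L` that is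
regularly homotopic to the immersed tube `tB ∘ (lam, id)`. -/
theorem homotopic_duality (h : IsOpenImmersion d0L p π lam lamT) (hj : Continuous j)
    (hs : Separates lam k j) (hd : ∀ x ∈ d1L, lam x ∈ d1B)
    (hA : ∀ w ∈ stratSub d0L π lamT, p w ∉ d0B)
    {tB : Disk (ContinuousMap.id B) ν δ → EuclideanSpace ℝ (Fin N)}
    {t : Disk (ContinuousMap.id L) (fun x => ν (lam x)) δ → EuclideanSpace ℝ (Fin N)}
    (hB : IsTubular ν δ (d0B ∪ d1B) tB) (hL : IsTubular (fun x => ν (lam x)) δ (d0L ∪ d1L) t)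
    (ht : RegularlyHomotopic (fun x => ν (lam x)) δ (d0L ∪ d1L) t (tB ∘ diskCover lam ν δ)) :
    ContinuousMap.Homotopic
      (ContinuousMap.comp ⟨thomSum (G := G) hB.isSeparatedTube,
          continuous_thomSum hB.isSeparatedTube⟩
        (ContinuousMap.comp ⟨iota hA, continuous_iota hA⟩ ⟨mu h hj hs, continuous_mu h hj hs⟩))
      ((loopMap G N (thomMap p π lam lamT h.comm ν δ d1B d1L hd)).comp
        ⟨thomSum hL.isSeparatedTube, continuous_thomSum hL.isSeparatedTube⟩) := by
  obtain ⟨K, e, S, a, hK, he, hS, hsep, hopen, he0, he1, hS0, hS1⟩ :=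
    ht.exists_separatedTubes hL hj (k := k) (by
      rintro ⟨⟨x, v⟩, hv⟩ ⟨⟨x', v'⟩, hv'⟩ hdd hne
      have h1 := congrArg Subtype.val (hB.injective hdd)
      obtain ⟨h2, h3⟩ := Prod.mk.inj h1
      have h3' : v = v' := h3
      subst h3'
      refine hs x x' h2 fun hx => hne ?_
      subst hx
      rfl)
  refine ContinuousMap.Homotopic.symm (homotopic_of_cube_families
    (fun τ γ => loopMap G N (thomMap p π lam lamT h.comm ν δ d1B d1L hd) (thomSum (hsep τ) γ))
    (fun γ => ?_) (fun γ => ?_) fun n s hsc => ?_)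
  · refine congrArg (loopMap G N _) ?_
    obtain ⟨m₀, hm₀⟩ := exists_isRep γ.continuous_tot
    obtain ⟨f, hf⟩ := hm₀ (max m₀ K) (le_max_left _ _)
    ext y
    refine (thomSum_apply (hsep 0) γ (le_max_right _ _) hf y).trans
      (Eq.trans ?_ (thomSum_apply hL.isSeparatedTube γ (Nat.zero_le _) hf y).symm)
    rw [funext he0]
    congr 1
    funext u
    congr 1
    funext d
    rw [thomTerm, thomTerm, dil_one fun i _ => hS0 i, dil_one fun _ _ => rfl]
  · exact loopMap_thomSum h hj hs hd hA hB.isSeparatedTube hB.injective_cubePt hK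
      (fun d => he1 d) (hsep 1) hS1 γ
  · exact (loopMap G N _).continuous.comp (continuous_thomSum_family he hS hsep hopen hsc)

end Square

section Geometry

variable {q : ℕ} {HB HL : Type*} [TopologicalSpace HB] [TopologicalSpace HL]
  {IB : ModelWithCorners ℝ (EuclideanSpace ℝ (Fin q)) HB}
  {IL : ModelWithCorners ℝ (EuclideanSpace ℝ (Fin q)) HL}
  {B : Type*} [TopologicalSpace B] [T2Space B] [ChartedSpace HB B] [IsManifold IB ∞ B]
  {L : Type*} [TopologicalSpace L] [T2Space L] [ChartedSpace HL L] [IsManifold IL ∞ L]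
  {W E : Type*} [TopologicalSpace W] [TopologicalSpace E]
  {d0B d1B : Set B} {d0L d1L : Set L} {p : C(W, B)} {π : C(E, L)} {lam : C(L, B)} {lamT : C(E, W)}

omit [T2Space L] in
theorem IsStratifiedEmbedding.isOpenImmersion
    (h : IsStratifiedEmbedding IB IL d0B d1B d1L p π lam lamT)
    (hB : IsBoundaryDecomposition IB d0B d1B) (hL : IsBoundaryDecomposition IL d0L d1L) :
    IsOpenImmersion d0L p π lam lamT where
  isClosed_doublePoints := h.isClosed_doublePoints
  isOpen_image _ hU hUd := h.isOpen_image hB hL hU hUd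
  isEmbedding := h.isEmbedding
  comm := h.comm

omit [T2Space B] [IsManifold IB ∞ B] [IsManifold IL ∞ L] in
theorem IsStratifiedEmbedding.fibIncl_proj
    (h : IsStratifiedEmbedding IB IL d0B d1B d1L p π lam lamT) (x : L)
    (w : Fib p (stratSub d0L π lamT) (lam x)) :
    (fibIncl π Set.univ x).toMap ((h.proj d0L x).toMap (Sum.inl w)) = fibProj π lamT x w.1 := by
  by_cases hw : ∃ e, π e = x ∧ lamT e = w.1
  · have h1 : (h.proj d0L x).toMap (Sum.inl w) =
        Sum.inl ⟨hw.choose, trivial, hw.choose_spec.1⟩ := dif_pos hw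
    rw [h1, fibProj, dif_pos hw]
    rfl
  · have h1 : (h.proj d0L x).toMap (Sum.inl w) = Sum.inr () := dif_neg hw
    rw [h1, fibProj, dif_neg hw]
    rfl

end Geometry

end StratHom

end

open StratHom in
theorem mainTheorem7 {q : ℕ}
    {HB HL : Type*} [TopologicalSpace HB] [TopologicalSpace HL]
    (IB : ModelWithCorners ℝ (EuclideanSpace ℝ (Fin q)) HB)
    (IL : ModelWithCorners ℝ (EuclideanSpace ℝ (Fin q)) HL)
    {B : Type*} [TopologicalSpace B] [CompactSpace B] [T2Space B]
    [ChartedSpace HB B] [IsManifold IB ∞ B]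
    {L : Type*} [TopologicalSpace L] [CompactSpace L] [T2Space L]
    [ChartedSpace HL L] [IsManifold IL ∞ L]
    {W : Type*} [TopologicalSpace W] [CompactSpace W] [T2Space W]
    {E : Type*} [TopologicalSpace E] [CompactSpace E] [T2Space E]
    (G : Prespectrum)
    (d0B d1B : Set B) (hB : IsBoundaryDecomposition IB d0B d1B)
    (d0L d1L : Set L) (hL : IsBoundaryDecomposition IL d0L d1L)
    (p : C(W, B)) (π : C(E, L)) (lam : C(L, B)) (lamT : C(E, W))
    (h : IsStratifiedEmbedding IB IL d0B d1B d1L p π lam lamT) :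
    ∃ (ρ : C(Sec G p (stratSub d0L π lamT) ∅, Sec G π Set.univ d0L))
      (ι : C(Sec G p (stratSub d0L π lamT) ∅, Sec G p Set.univ d0B))
      (μ : C(Sec G π Set.univ d0L, Sec G p (stratSub d0L π lamT) ∅)),
      (∀ s x, (ρ s).val x = redMap G (h.proj d0L x) (s.val (lam x))) ∧
      (∀ s b, (ι s).val b = redMap G (fibInclUniv p (stratSub d0L π lamT) b) (s.val b)) ∧
      (ρ.comp μ).Homotopic (ContinuousMap.id _) ∧
      IsWeakEquiv μ ∧
      ∀ (n : ℕ) (i : B → EuclideanSpace ℝ (Fin (q + n))) (δ : ℝ),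
        IsSmoothEmbedding IB i → 0 < δ →
        IsTubular (normalBundle IB i) δ (IB.boundary B) (normalTube IB i δ) →
        ∀ t : Disk (ContinuousMap.id L) (fun x => normalBundle IB i (lam x)) δ →
            EuclideanSpace ℝ (Fin (q + n)),
          IsTubular (fun x => normalBundle IB i (lam x)) δ (IL.boundary L) t →
          RegularlyHomotopic (fun x => normalBundle IB i (lam x)) δ (IL.boundary L) t
            (normalTube IB i δ ∘ diskCover lam (normalBundle IB i) δ) →
          ∃ (φL : C(Sec G π Set.univ d0L, Ω^ (Fin (q + n))
              (RedHom G (ThomQuo π (fun x => normalBundle IB i (lam x)) δ d1L)) (pt _)))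
            (φB : C(Sec G p Set.univ d0B, Ω^ (Fin (q + n))
              (RedHom G (ThomQuo p (normalBundle IB i) δ d1B)) (pt _))),
            IsDualityMap G π d0L d1L (fun x => normalBundle IB i (lam x)) δ t φL ∧
            IsDualityMap G p d0B d1B (normalBundle IB i) δ (normalTube IB i δ) φB ∧
            (φB.comp (ι.comp μ)).Homotopic
              ((loopMap G (q + n) (thomMap p π lam lamT h.comm (normalBundle IB i) δ d1B d1L
                (fun _ hx => h.preimage_eq.symm.subset hx))).comp φL) := by
  have hI := h.isOpenImmersion hB hL
  have hc := fun x => h.fibIncl_proj (d0L := d0L) x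
  obtain ⟨k, j, hj, hs⟩ := exists_separating hI.isClosed_doublePoints fun x hx => hx.2 rfl
  have hs' : Separates lam k j := fun x x' hx hne => hs x x' ⟨hx, hne⟩
  have hA : ∀ w ∈ stratSub d0L π lamT, p w ∉ d0B := by
    rintro _ ⟨e, -, rfl⟩ he
    rw [h.comm] at he
    exact h.notMem _ he
  refine ⟨⟨rho (fun x => h.proj d0L x) hc hI, continuous_rho _ hc hI⟩,
    ⟨iota hA, continuous_iota hA⟩, ⟨mu hI hj hs', continuous_mu hI hj hs'⟩,
    fun s x => rfl, fun s b => rfl, ?_, isWeakEquiv_mu _ hc hI hj hs', ?_⟩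
  · refine ⟨⟨⟨fun z => squeeze k hj (unitInterval.symm z.1) z.2,
      (continuous_squeeze k hj).comp
        ((unitInterval.continuous_symm.comp continuous_fst).prodMk continuous_snd)⟩, fun γ => ?_, fun γ => ?_⟩⟩
    · change squeeze k hj (unitInterval.symm 0) γ = rho _ hc hI (mu hI hj hs' γ)
      rw [rho_mu _ hc, unitInterval.symm_zero]
    · change squeeze k hj (unitInterval.symm 1) γ = γ
      rw [unitInterval.symm_one, StratHom.squeeze_zero]
  · intro n i δ hi _ htB t ht htt
    have hν := isClosed_normalBundle IB hi
    have hDB : CompactSpace (Disk (ContinuousMap.id B) (normalBundle IB i) δ) :=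
      compactSpace_disk hν δ
    have hDL : CompactSpace (Disk (ContinuousMap.id L) (fun x => normalBundle IB i (lam x)) δ) :=
      compactSpace_disk (ν := fun x => normalBundle IB i (lam x)) (hν.preimage (by fun_prop :
        Continuous fun z : L × EuclideanSpace ℝ (Fin (q + n)) => (lam z.1, z.2))) δ
    rw [← hB.union_eq] at htB
    rw [← hL.union_eq] at ht htt
    refine ⟨⟨thomSum ht.isSeparatedTube, continuous_thomSum ht.isSeparatedTube⟩,
      ⟨thomSum htB.isSeparatedTube, continuous_thomSum htB.isSeparatedTube⟩,
      isDualityMap_thomSum (fun d k => cubePt_apply (ht.mem_cube d) k) ht.injective_cubePt _,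
      isDualityMap_thomSum (fun d k => cubePt_apply (htB.mem_cube d) k) htB.injective_cubePt _,
      homotopic_duality hI hj hs' _ hA htB ht htt⟩
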